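/- Let $X$ be a compact connected Kähler manifold of complex dimension $d\ge 1$ with a fixed Kähler form $\omega$, and let $$\mathrm{degree}(\Omega^1_X)=\big(c_1(\Omega^1_X)\cup[\omega]^{d-1}\big)\cap[X]=\int_X c_1(\Omega^1_X,h)\wedge\omega^{d-1}\in\mathbb R,$$ where $c_1(\Omega^1_X,h)=\frac{i}{2\pi}\operatorname{tr}\Theta_h$ is the first Chern form of an arbitrary smooth Hermitian metric $h$ on the holomorphic cotangent bundle $\Omega^1_X$. Let $H=\mathrm{GL}(d,\mathbb C)\subset G=\mathbb C^d\rtimes\mathrm{GL}(d,\mathbb C)$, with Lie algebras $\mathfrak h\subset\mathfrak g$. A *branched holomorphic affine structure* on $X$ is a pair $(E_H,\theta)$, where $f:E_H\to X$ is a holomorphic principal $H$-bundle and $\theta$ is a holomorphic $\mathfrak g$-valued one-form on $E_H$ that is $H$-equivariant ($R_g^*\theta=\mathrm{Ad}(g^{-1})\theta$ for $g\in H$), restricts to the Maurer–Cartan form on the fibres of $f$, and is such that $\theta_p:T_pE_H\to\mathfrak g$ is an isomorphism for all $p$ over some nonempty open subset of $X$. (Equivalently, $\theta$ is a holomorphic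 homomorphism $\mathrm{At}(E_H)\to\mathrm{ad}(E_G)$, where $E_G=E_H\times^H G$, that restricts to the inclusion on $\mathrm{ad}(E_H)$ and is an isomorphism over a nonempty open subset of $X$.) It is a *holomorphic affine structure* if $\theta_p$ is an isomorphism for all $p\in E_H$. The *branching divisor* is the divisor of zeros of the section $\bigwedge^d\phi$ of $\bigwedge^d(\mathrm{ad}(E_G)/\mathrm{ad}(E_H))\otimes\Omega^d_X$, where $\phi:TX\to\mathrm{ad}(E_G)/\mathrm{ad}(E_H)$ is induced by $\theta$. (i) If $\mathrm{degree}(\Omega^1_X)<0$, then there is no branched holomorphic affine structure on $X$. (ii) If $\mathrm{degree}(\Omega^1_X)=0$, then every branched holomorphic affine structure on $X$ is actually a holomorphic affine structure; that is, its branching divisor is empty. -/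

import Mathlib

open scoped Manifold ContDiff ComplexOrder

universe u v

noncomputable section

namespace BranchedAffine

/-- The complex vector space `ℂ^d`. -/
abbrev Vec (d : ℕ) : Type := Fin d → ℂ

/-- The endomorphisms of `ℂ^d`, i.e. the Lie algebra `𝔥 = M(d, ℂ)` of `GL(d, ℂ)`. -/
abbrev EndVec (d : ℕ) : Type := Vec d →L[ℂ] Vec d

/-- The complex Lie group `H = GL(d, ℂ)`: the units of the Banach algebra of endomorphisms of
`ℂ^d`, with Mathlib's structure of a complex Lie group (an open subset of `M(d, ℂ)`). -/
abbrev GLVec (d : ℕ) : Type := (EndVec d)ˣ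

/-! ### Kähler forms

Tensors on a complex manifold are given by their expressions in the charts of the atlas, which
have to be compatible under the changes of charts. (The values at partial homeomorphisms that
are not in the atlas, and at points outside the target of a chart, play no role.) -/

section Forms

variable (d : ℕ) (X : Type u) [TopologicalSpace X] [ChartedSpace (Vec d) X]

/-- A Kähler form on the complex manifold `X`: a smooth real closed positive `(1,1)`-form. -/
structure KahlerForm where
  /-- the expression of the form in a chart, as a real alternating form on `ℂ^d = ℝ^{2d}` -/
  form : OpenPartialHomeomorph X (Vec d) → Vec d → (Vec d) [⋀^Fin 2]→L[ℝ] ℝ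
  smooth : ∀ e ∈ atlas (Vec d) X, ContDiffOn ℝ ∞ (form e) e.target
  compatible : ∀ e ∈ atlas (Vec d) X, ∀ e' ∈ atlas (Vec d) X,
    ∀ y ∈ e.target, e.symm y ∈ e'.source →
      form e y = (form e' (e' (e.symm y))).compContinuousLinearMap
        (fderiv ℝ (fun z => e' (e.symm z)) y)
  closed : ∀ e ∈ atlas (Vec d) X, ∀ y ∈ e.target, extDeriv (form e) y = 0
  /-- the form is of type `(1,1)` -/
  type_one_one : ∀ e ∈ atlas (Vec d) X, ∀ y ∈ e.target, ∀ v w : Vec d,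
    form e y ![Complex.I • v, Complex.I • w] = form e y ![v, w]
  positive : ∀ e ∈ atlas (Vec d) X, ∀ y ∈ e.target, ∀ v : Vec d, v ≠ 0 →
    0 < form e y ![v, Complex.I • v]

/-- A smooth Hermitian metric on the holomorphic cotangent bundle `Ω¹_X`. In a chart with
coordinates `z_1, …, z_d` it is given by its Gram matrix `(⟨dz_i, dz_j⟩)_{i,j}`. -/
structure CotangentHermitianMetric where
  gram : OpenPartialHomeomorph X (Vec d) → Vec d → Matrix (Fin d) (Fin d) ℂ
  smooth : ∀ e ∈ atlas (Vec d) X, ∀ i j, ContDiffOn ℝ ∞ (fun y => gram e y i j) e.target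
  posDef : ∀ e ∈ atlas (Vec d) X, ∀ y ∈ e.target, (gram e y).PosDef
  /-- If `z' = F(z)` is a change of charts with Jacobian matrix `J`, then `dz' = J dz`. -/
  compatible : ∀ e ∈ atlas (Vec d) X, ∀ e' ∈ atlas (Vec d) X,
    ∀ y ∈ e.target, e.symm y ∈ e'.source →
      gram e' (e' (e.symm y)) =
        LinearMap.toMatrix' (fderiv ℂ (fun z => e' (e.symm z)) y).toLinearMap * gram e y *
          (LinearMap.toMatrix' (fderiv ℂ (fun z => e' (e.symm z)) y).toLinearMap).conjTranspose

end Forms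

/-! ### The degree of `Ω¹_X` -/

/-- The real `(1,1)`-form `i∂∂̄u = ½ d dᶜu` of a real function `u` on an open subset of `ℂ^d`,
where `(dᶜu)(v) = -du(iv)`, evaluated at a pair of tangent vectors. -/
def iDDbar {d : ℕ} (f : Vec d → ℝ) (y v w : Vec d) : ℝ :=
  (1 / 2) * (fderiv ℝ (fderiv ℝ f) y w (Complex.I • v) - fderiv ℝ (fderiv ℝ f) y v (Complex.I • w))

/-- The wedge product `α_1 ∧ … ∧ α_d` of `d` two-forms, evaluated at `2d` vectors
`v (1,0), v (1,1), …, v (d,0), v (d,1)` in this order. -/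
def wedgeTwoForms {d : ℕ} (α : Fin d → Vec d → Vec d → ℝ) (v : Fin d × Fin 2 → Vec d) : ℝ :=
  ((2 : ℝ) ^ d)⁻¹ * ∑ σ : Equiv.Perm (Fin d × Fin 2),
    ((Equiv.Perm.sign σ : ℤ) : ℝ) * ∏ j, α j (v (σ (j, 0))) (v (σ (j, 1)))

/-- The positively oriented real basis `e_1, i e_1, …, e_d, i e_d` of `ℂ^d`. -/
def orientedBasis (d : ℕ) (q : Fin d × Fin 2) : Vec d :=
  if q.2 = 0 then Pi.single q.1 1 else Pi.single q.1 Complex.I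

section Degree

variable {d : ℕ} {X : Type u} [TopologicalSpace X] [ChartedSpace (Vec d) X]

/-- The first Chern form `(i/2π) tr Θ_h` of `(Ω¹_X, h)` in a chart. Here `Θ_h` is the curvature of
the Chern connection, so that `tr Θ_h = -∂∂̄ log det h`. It represents the real Chern class
`c₁(Ω¹_X)`, whatever the metric is. -/
def chernForm (h : CotangentHermitianMetric d X) (e : OpenPartialHomeomorph X (Vec d))
    (y v w : Vec d) : ℝ :=
  -(1 / (2 * Real.pi)) * iDDbar (fun z => Real.log (h.gram e z).det.re) y v w

/-- The coefficient of the top degree form `c₁(Ω¹_X, h) ∧ κ^{d-1}` with respect to the Lebesgue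
measure `dx_1 dy_1 … dx_d dy_d` in a chart. -/
def degreeDensity (κ : KahlerForm d X) (h : CotangentHermitianMetric d X)
    (e : OpenPartialHomeomorph X (Vec d)) (y : Vec d) : ℝ :=
  wedgeTwoForms
    (fun j v w => if (j : ℕ) = 0 then chernForm h e y v w else κ.form e y ![v, w])
    (orientedBasis d)

variable [T2Space X] [CompactSpace X]

variable (d X) in
theorem exists_chartPartition : ∃ ρ : PartitionOfUnity X X (Set.univ : Set X),
    ρ.IsSubordinate (fun x => (chartAt (Vec d) x).source) :=
  PartitionOfUnity.exists_isSubordinate isClosed_univ _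
    (fun x => (chartAt (Vec d) x).open_source)
    (fun x _ => Set.mem_iUnion.2 ⟨x, mem_chart_source (Vec d) x⟩)

variable (d X) in
/-- A partition of unity subordinate to the charts of `X`. -/
def chartPartition : PartitionOfUnity X X (Set.univ : Set X) :=
  (exists_chartPartition d X).choose

/-- The integral over `X` (with its complex orientation) of the top degree form with coefficient
`τ e` in the chart `e`, computed with a partition of unity. -/
def integralTopForm (τ : OpenPartialHomeomorph X (Vec d) → Vec d → ℝ) : ℝ :=
  ∑ᶠ x : X, ∫ y in (chartAt (Vec d) x).target,
    chartPartition d X x ((chartAt (Vec d) x).symm y) * τ (chartAt (Vec d) x) y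

/-- `degree(Ω¹_X) = (c₁(Ω¹_X) ∪ [κ]^{d-1}) ∩ [X]`, the class `c₁(Ω¹_X)` being represented by the
Chern form of a Hermitian metric. -/
def cotangentDegree (κ : KahlerForm d X) (h : CotangentHermitianMetric d X) : ℝ :=
  integralTopForm (degreeDensity κ h)

end Degree

/-! ### Branched holomorphic affine structures

These are the branched holomorphic Cartan geometries of type `G/H`, where `H = GL(d, ℂ)` and
`G = ℂ^d ⋊ GL(d, ℂ)`. -/

/-- The Lie algebra `𝔤 = ℂ^d ⋊ M(d, ℂ)` of the affine group; `𝔥 = M(d, ℂ)` is the subspace of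
the pairs `(0, A)`. -/
abbrev AffLie (d : ℕ) : Type := Vec d × EndVec d

/-- The adjoint action of `H ⊆ G` on `𝔤`. -/
def Ad {d : ℕ} (g : GLVec d) (a : AffLie d) : AffLie d :=
  ((g : EndVec d) a.1, (g : EndVec d) * a.2 * ((g⁻¹ : GLVec d) : EndVec d))

/-- The affine Lie algebra as the block matrices with rows `(A, v)` and `(0, 0)`. -/
def affMatrix {d : ℕ} (a : AffLie d) : (Vec d × ℂ) →ₗ[ℂ] (Vec d × ℂ) where
  toFun z := (a.2 z.1 + z.2 • a.1, 0)
  map_add' z w := by ext <;> simp [add_mul]; ring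
  map_smul' c z := by ext <;> simp [mul_assoc]

/-- `GL(d, ℂ)` inside the affine group, as the block diagonal matrices `diag(g, 1)`. -/
def glMatrix {d : ℕ} (g : GLVec d) : (Vec d × ℂ) →ₗ[ℂ] (Vec d × ℂ) :=
  LinearMap.prodMap (g : EndVec d).toLinearMap LinearMap.id

/-- `Ad` is the conjugation of matrices. -/
theorem affMatrix_Ad {d : ℕ} (g : GLVec d) (a : AffLie d) :
    affMatrix (Ad g a) = glMatrix g ∘ₗ affMatrix a ∘ₗ glMatrix g⁻¹ := by
  refine LinearMap.ext fun z => ?_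
  simp [affMatrix, glMatrix, Ad]

section Structures

variable (d : ℕ) (X : Type u) [TopologicalSpace X] [ChartedSpace (Vec d) X]

/-- The model with corners of the total space of a principal `GL(d, ℂ)`-bundle on a complex
manifold of dimension `d`. -/
abbrev bundleModel : ModelWithCorners ℂ (Vec d × EndVec d) (ModelProd (Vec d) (EndVec d)) :=
  𝓘(ℂ, Vec d).prod 𝓘(ℂ, EndVec d)

/-- A holomorphic principal `GL(d, ℂ)`-bundle `E_H` on `X`. -/
structure HolPrincipalBundle where
  /-- the total space, a complex manifold -/
  Total : Type v
  [topologicalSpace : TopologicalSpace Total]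
  [chartedSpace : ChartedSpace (ModelProd (Vec d) (EndVec d)) Total]
  [isManifold : IsManifold (bundleModel d) ω Total]
  proj : Total → X
  /-- the right action of `GL(d, ℂ)` -/
  act : Total → GLVec d → Total
  holomorphic_proj : ContMDiff (bundleModel d) 𝓘(ℂ, Vec d) ω proj
  holomorphic_act : ContMDiff ((bundleModel d).prod 𝓘(ℂ, EndVec d)) (bundleModel d) ω
    (fun q : Total × GLVec d => act q.1 q.2)
  act_one : ∀ p, act p 1 = p
  act_mul : ∀ p g h, act p (g * h) = act (act p g) h
  proj_act : ∀ p g, proj (act p g) = proj p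
  /-- local triviality: equivariant biholomorphisms of `proj ⁻¹ U` with `U × GL(d, ℂ)` -/
  locally_trivial : ∀ x : X, ∃ U : Set X, IsOpen U ∧ x ∈ U ∧
    ∃ t : OpenPartialHomeomorph Total (X × GLVec d),
      t.source = proj ⁻¹' U ∧ t.target = U ×ˢ Set.univ ∧
      ContMDiffOn (bundleModel d) (𝓘(ℂ, Vec d).prod 𝓘(ℂ, EndVec d)) ω t t.source ∧
      ContMDiffOn (𝓘(ℂ, Vec d).prod 𝓘(ℂ, EndVec d)) (bundleModel d) ω t.symm t.target ∧
      ∀ p ∈ t.source, (t p).1 = proj p ∧ ∀ g, (t (act p g)) = ((t p).1, (t p).2 * g)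

attribute [instance] HolPrincipalBundle.topologicalSpace HolPrincipalBundle.chartedSpace
  HolPrincipalBundle.isManifold

/-- A branched holomorphic affine structure on `X`: a holomorphic principal `GL(d, ℂ)`-bundle
`E_H` with a homomorphism `θ : At(E_H) = (TE_H)/H → ad(E_G) = E_H ×^H 𝔤` that restricts to the
inclusion of `ad(E_H)` and is an isomorphism over a nonempty open subset of `X`. Such a
homomorphism is an `H`-equivariant holomorphic `𝔤`-valued one-form `θ` on the total space. -/
structure BranchedAffineStructure where
  bundle : HolPrincipalBundle.{u, v} d X
  θ : ∀ p : bundle.Total, TangentSpace (bundleModel d) p →L[ℂ] AffLie d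
  /-- `θ` is a holomorphic function on the tangent bundle -/
  holomorphic : ContMDiff (bundleModel d).tangent 𝓘(ℂ, AffLie d) ω
    (fun w : TangentBundle (bundleModel d) bundle.Total => θ w.1 w.2)
  equivariant : ∀ (g : GLVec d) (p : bundle.Total) (w : TangentSpace (bundleModel d) p),
    θ (bundle.act p g)
        (mfderiv (bundleModel d) (bundleModel d) (fun q => bundle.act q g) p w) =
      Ad g⁻¹ (θ p w)
  /-- `θ` sends the value at `p = p · 1` of the fundamental vector field of `A ∈ 𝔥 = T_1 H`
  to `A`, i.e. it is the Maurer-Cartan form on the fibres -/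
  vertical : ∀ (p : bundle.Total) (A : EndVec d),
    θ (bundle.act p 1)
        (mfderiv 𝓘(ℂ, EndVec d) (bundleModel d) (fun g : GLVec d => bundle.act p g) 1 A) =
      (0, A)
  generically_iso : ∃ U : Set X, IsOpen U ∧ U.Nonempty ∧
    ∀ p, bundle.proj p ∈ U → Function.Bijective (θ p)

variable {d X}

/-- The structure is a holomorphic affine structure (a holomorphic Cartan geometry of type `G/H`):
`θ` is an isomorphism everywhere. -/
def BranchedAffineStructure.IsHolomorphicAffine (Q : BranchedAffineStructure.{u, v} d X) : Prop :=
  ∀ p, Function.Bijective (Q.θ p)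

/-- The homomorphism `⋀^d φ : ⋀^d TX → ⋀^d (ad(E_G)/ad(E_H))` induced by `θ`, on the images in `TX`
of `d` tangent vectors of the total space at `p`; here `p` identifies the fibre of
`ad(E_G)/ad(E_H)` with `𝔤/𝔥 = ℂ^d`. -/
def BranchedAffineStructure.detPhi (Q : BranchedAffineStructure.{u, v} d X) (p : Q.bundle.Total)
    (w : Fin d → TangentSpace (bundleModel d) p) : ℂ :=
  (Matrix.of fun i j => (Q.θ p (w j)).1 i).det

/-- The support of the branching divisor, which is the effective divisor of the section `⋀^d φ`:
the set of zeros of this section. -/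
def BranchedAffineStructure.branchingSupport (Q : BranchedAffineStructure.{u, v} d X) : Set X :=
  {x | ∀ p, Q.bundle.proj p = x → ∀ w, Q.detPhi p w = 0}

end Structures

end BranchedAffine

end

open BranchedAffine

noncomputable section
namespace BranchedAffine

/-! ### Top degree coefficients of wedge products -/

section WedgeAlgebra

variable {d : ℕ}

/-- The coefficient of `α ∧ K^{d-1}` in the oriented basis. -/
def topCoeff (K α : Vec d → Vec d → ℝ) : ℝ :=
  wedgeTwoForms (fun j v w => if (j : ℕ) = 0 then α v w else K v w) (orientedBasis d)

/-- The product of `d` bilinear forms as a multilinear map in `2d` vectors. -/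
def prodForms (β : Fin d → Vec d →ₗ[ℝ] Vec d →ₗ[ℝ] ℝ) :
    MultilinearMap ℝ (fun _ : Fin d × Fin 2 => Vec d) ℝ where
  toFun v := ∏ j, β j (v (j, 0)) (v (j, 1))
  map_update_add' := by
    intro _ v q x y
    obtain ⟨j, k⟩ := q
    rw [Fintype.prod_eq_mul_prod_compl j, Fintype.prod_eq_mul_prod_compl j,
      Fintype.prod_eq_mul_prod_compl j]
    have hne : ∀ z : Vec d, ∀ i ∈ ({j}ᶜ : Finset (Fin d)), ∀ l,
        Function.update v (j, k) z (i, l) = v (i, l) := fun z i hi l =>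
      Function.update_of_ne (by simp at hi; simp [hi]) _ _
    have hp : ∀ z : Vec d, ∏ i ∈ ({j}ᶜ : Finset (Fin d)),
        β i (Function.update v (j, k) z (i, 0)) (Function.update v (j, k) z (i, 1)) =
        ∏ i ∈ ({j}ᶜ : Finset (Fin d)), β i (v (i, 0)) (v (i, 1)) := fun z =>
      Finset.prod_congr rfl fun i hi => by rw [hne z i hi, hne z i hi]
    rw [hp, hp, hp, ← add_mul]
    congr 1
    fin_cases k <;> simp
  map_update_smul' := by
    intro _ v q c x
    obtain ⟨j, k⟩ := q
    rw [Fintype.prod_eq_mul_prod_compl j, Fintype.prod_eq_mul_prod_compl j]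
    have hne : ∀ z : Vec d, ∀ i ∈ ({j}ᶜ : Finset (Fin d)), ∀ l,
        Function.update v (j, k) z (i, l) = v (i, l) := fun z i hi l =>
      Function.update_of_ne (by simp at hi; simp [hi]) _ _
    have hp : ∀ z : Vec d, ∏ i ∈ ({j}ᶜ : Finset (Fin d)),
        β i (Function.update v (j, k) z (i, 0)) (Function.update v (j, k) z (i, 1)) =
        ∏ i ∈ ({j}ᶜ : Finset (Fin d)), β i (v (i, 0)) (v (i, 1)) := fun z =>
      Finset.prod_congr rfl fun i hi => by rw [hne z i hi, hne z i hi]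
    rw [hp, hp, smul_eq_mul, ← mul_assoc]
    congr 1
    fin_cases k <;> simp

theorem wedgeTwoForms_eq_alternatization (β : Fin d → Vec d →ₗ[ℝ] Vec d →ₗ[ℝ] ℝ)
    (v : Fin d × Fin 2 → Vec d) :
    wedgeTwoForms (fun j x y => β j x y) v =
      ((2 : ℝ) ^ d)⁻¹ * MultilinearMap.alternatization (prodForms β) v := by
  rw [MultilinearMap.alternatization_apply]
  unfold wedgeTwoForms
  congr 1
  refine Finset.sum_congr rfl fun σ _ => ?_
  rw [Units.smul_def, zsmul_eq_mul]
  rfl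

variable (d) in
/-- The standard real basis of `ℂ^d`. -/
def realBasis : Module.Basis (Fin d × Fin 2) ℝ (Vec d) :=
  ((Pi.basis fun _ : Fin d => Complex.basisOneI).reindex (Equiv.sigmaEquivProd (Fin d) (Fin 2)))

theorem realBasis_eq (d : ℕ) : ⇑(realBasis d) = orientedBasis d := by
  funext ⟨j, k⟩
  fin_cases k <;> simp [realBasis, orientedBasis, Pi.basis_apply]

theorem wedgeTwoForms_comp (β : Fin d → Vec d →ₗ[ℝ] Vec d →ₗ[ℝ] ℝ) (A : Vec d →ₗ[ℝ] Vec d) :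
    wedgeTwoForms (fun j x y => β j x y) (A ∘ orientedBasis d) =
      LinearMap.det A * wedgeTwoForms (fun j x y => β j x y) (orientedBasis d) := by
  rw [wedgeTwoForms_eq_alternatization, wedgeTwoForms_eq_alternatization, ← realBasis_eq]
  set f := MultilinearMap.alternatization (prodForms β)
  have h := AlternatingMap.eq_smul_basis_det (realBasis d) f
  have h2 : f (A ∘ realBasis d) = f (realBasis d) * LinearMap.det A := by
    conv_lhs => rw [h]
    rw [AlternatingMap.smul_apply, Module.Basis.det_comp, Module.Basis.det_self, mul_one, smul_eq_mul]
  rw [h2]; ring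

theorem topCoeff_pullback (K α : Vec d →ₗ[ℝ] Vec d →ₗ[ℝ] ℝ) (A : Vec d →ₗ[ℝ] Vec d) :
    topCoeff (fun v w => K (A v) (A w)) (fun v w => α (A v) (A w)) =
      LinearMap.det A * topCoeff (fun v w => K v w) (fun v w => α v w) := by
  have := wedgeTwoForms_comp (fun j : Fin d => if (j : ℕ) = 0 then α else K) A
  have e : (fun (j : Fin d) x y => (if (j : ℕ) = 0 then α else K) x y) =
      fun (j : Fin d) v w => if (j : ℕ) = 0 then α v w else K v w := by
    funext j x y; split_ifs <;> rfl
  simp only [e] at this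
  exact this

theorem topCoeff_eq (hd : 0 < d) (K α : Vec d → Vec d → ℝ) :
    topCoeff K α = ((2 : ℝ) ^ d)⁻¹ * ∑ σ : Equiv.Perm (Fin d × Fin 2),
      ((Equiv.Perm.sign σ : ℤ) : ℝ) *
        (α (orientedBasis d (σ (⟨0, hd⟩, 0))) (orientedBasis d (σ (⟨0, hd⟩, 1))) *
          ∏ j ∈ ({⟨0, hd⟩}ᶜ : Finset (Fin d)),
            K (orientedBasis d (σ (j, 0))) (orientedBasis d (σ (j, 1)))) := by
  unfold topCoeff wedgeTwoForms
  congr 1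
  refine Finset.sum_congr rfl fun σ _ => ?_
  rw [Fintype.prod_eq_mul_prod_compl ⟨0, hd⟩]
  congr 2
  refine Finset.prod_congr rfl fun j hj => ?_
  refine if_neg fun h => ?_
  simp at hj
  exact hj (Fin.ext h)

theorem topCoeff_add (hd : 0 < d) (K α β : Vec d → Vec d → ℝ) :
    topCoeff K (fun v w => α v w + β v w) = topCoeff K α + topCoeff K β := by
  rw [topCoeff_eq hd, topCoeff_eq hd, topCoeff_eq hd, ← mul_add, ← Finset.sum_add_distrib]
  congr 1
  exact Finset.sum_congr rfl fun σ _ => by ring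

theorem topCoeff_smul (hd : 0 < d) (K α : Vec d → Vec d → ℝ) (c : ℝ) :
    topCoeff K (fun v w => c * α v w) = c * topCoeff K α := by
  rw [topCoeff_eq hd, topCoeff_eq hd, mul_left_comm]
  congr 1
  rw [Finset.mul_sum]
  exact Finset.sum_congr rfl fun σ _ => by ring

theorem topCoeff_sum (hd : 0 < d) {ι : Type*} (s : Finset ι) (K : Vec d → Vec d → ℝ)
    (α : ι → Vec d → Vec d → ℝ) :
    topCoeff K (fun v w => ∑ i ∈ s, α i v w) = ∑ i ∈ s, topCoeff K (α i) := by
  classical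
  induction s using Finset.induction_on with
  | empty => simpa using topCoeff_smul hd K (fun _ _ => 0) 0
  | insert i s hi ih => simp only [Finset.sum_insert hi]; rw [topCoeff_add hd, ih]

/-- Multiplication by `i` as a real linear map. -/
def mulI (d : ℕ) : Vec d →L[ℝ] Vec d :=
  ((Complex.I • ContinuousLinearMap.id ℂ (Vec d) : Vec d →L[ℂ] Vec d)).restrictScalars ℝ

theorem det_restrictScalars_eq (A : Vec d →ₗ[ℂ] Vec d) :
    LinearMap.det (A.restrictScalars ℝ) = Complex.normSq (LinearMap.det A) := by
  have := LinearMap.det_restrictScalars (R := ℝ) (f := A)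
  rw [this, Algebra.norm_complex_eq]; rfl

/-- Forms of type `(2,0) + (0,2)` are killed by `K^{d-1}`. -/
theorem topCoeff_eq_zero (hd : 0 < d) (K α : Vec d →ₗ[ℝ] Vec d →ₗ[ℝ] ℝ)
    (hK : ∀ v w, K (Complex.I • v) (Complex.I • w) = K v w)
    (hα : ∀ v w, α (Complex.I • v) (Complex.I • w) = -α v w) :
    topCoeff (fun v w => K v w) (fun v w => α v w) = 0 := by
  have h := topCoeff_pullback K α
    ((Complex.I • LinearMap.id : Vec d →ₗ[ℂ] Vec d).restrictScalars ℝ)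
  rw [det_restrictScalars_eq] at h
  simp only [LinearMap.restrictScalars_apply, LinearMap.smul_apply, LinearMap.id_apply, hK, hα,
    LinearMap.det_smul, LinearMap.det_id, mul_one, map_pow, Complex.normSq_I, one_pow,
    one_mul] at h
  have h2 := topCoeff_smul hd (fun v w => K v w) (fun v w => α v w) (-1)
  simp only [neg_mul, one_mul] at h2
  linarith

theorem exists_basis_orthonormal_of_core {V : Type*} [AddCommGroup V] [Module ℂ V]
    [FiniteDimensional ℂ V] (c : InnerProductSpace.Core ℂ V) :
    ∃ b : Module.Basis (Fin (Module.finrank ℂ V)) ℂ V,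
      ∀ i j, c.inner (b i) (b j) = if i = j then 1 else 0 := by
  let _ : NormedAddCommGroup V := c.toNormedAddCommGroup
  let _ : InnerProductSpace ℂ V := InnerProductSpace.ofCore c.toCore
  refine ⟨(stdOrthonormalBasis ℂ V).toBasis, fun i j => ?_⟩
  have := orthonormal_iff_ite.1 (stdOrthonormalBasis ℂ V).orthonormal i j
  simpa using this

/-- A positive `(1,1)`-form is standard in a suitable complex basis. -/
theorem exists_unitary_basis (K : Vec d →ₗ[ℝ] Vec d →ₗ[ℝ] ℝ)
    (hK : ∀ v w, K (Complex.I • v) (Complex.I • w) = K v w)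
    (hanti : ∀ v w, K v w = -K w v) (hpos : ∀ v, v ≠ 0 → 0 < K v (Complex.I • v)) :
    ∃ b : Module.Basis (Fin d) ℂ (Vec d), ∀ i j,
      K (b i) (b j) = 0 ∧ K (b i) (Complex.I • b j) = if i = j then 1 else 0 := by
  have hII : ∀ v : Vec d, Complex.I • Complex.I • v = -v := fun v => by
    rw [smul_smul, Complex.I_mul_I, neg_one_smul]
  have hI : ∀ v w, K (Complex.I • v) w = -K v (Complex.I • w) := fun v w => by
    have := hK (Complex.I • v) w
    rw [hII] at this
    simp at this; linarith
  have hre : ∀ (r : ℂ) (v : Vec d), r • v = r.re • v + r.im • (Complex.I • v) := fun r v => by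
    ext i
    simp only [Pi.smul_apply, Pi.add_apply, smul_eq_mul, Complex.real_smul]
    nth_rewrite 1 [← Complex.re_add_im r]; ring
  let c : InnerProductSpace.Core ℂ (Vec d) :=
    { inner := fun v w => ⟨K v (Complex.I • w), K v w⟩
      conj_inner_symm := fun v w => by
        apply Complex.ext
        · simp
          rw [hanti w, hI]; simp
        · simp
          rw [hanti w]; simp
      re_inner_nonneg := fun v => by
        by_cases hv : v = 0
        · simp [hv]
        · exact (hpos v hv).le
      add_left := fun x y z => by
        apply Complex.ext <;> simp
      smul_left := fun x y r => by
        rw [hre r x]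
        apply Complex.ext
        · simp [hI, hII]
        · simp [hI]
      definite := fun v hv => by
        by_contra h
        have h1 := hpos v h
        have h2 : K v (Complex.I • v) = 0 := congrArg Complex.re hv
        linarith }
  obtain ⟨b, hb⟩ := exists_basis_orthonormal_of_core c
  have hfin : Module.finrank ℂ (Vec d) = d := by simp
  refine ⟨b.reindex (finCongr hfin), fun i j => ?_⟩
  have h := hb ((finCongr hfin).symm i) ((finCongr hfin).symm j)
  have h1 := congrArg Complex.re h
  have h2 := congrArg Complex.im h
  simp only [EmbeddingLike.apply_eq_iff_eq] at h1 h2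
  refine ⟨?_, ?_⟩
  · rw [Module.Basis.reindex_apply, Module.Basis.reindex_apply]
    refine h2.trans ?_
    split_ifs <;> simp
  · rw [Module.Basis.reindex_apply, Module.Basis.reindex_apply]
    refine h1.trans ?_
    split_ifs <;> simp

/-- In a unitary basis, the terms of `topCoeff` whose permutation preserves the pairs. -/
theorem unitary_term (i₀ : Fin d) (S T : Fin d × Fin 2 → Fin d × Fin 2 → ℝ)
    (hS : ∀ i, S (i, 0) (i, 1) = 1) (hSa : ∀ p q, S p q = -S q p) (hTa : ∀ p q, T p q = -T q p)
    (π : Equiv.Perm (Fin d)) (φ : Fin d → Equiv.Perm (Fin 2)) (σ : Equiv.Perm (Fin d × Fin 2))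
    (hσ : ∀ i k, σ (i, k) = (π i, φ i k)) :
    ((Equiv.Perm.sign σ : ℤ) : ℝ) *
      (T (σ (i₀, 0)) (σ (i₀, 1)) * ∏ j ∈ ({i₀}ᶜ : Finset (Fin d)), S (σ (j, 0)) (σ (j, 1))) =
    T (π i₀, 0) (π i₀, 1) := by
  have hsign : Equiv.Perm.sign σ = ∏ k, Equiv.Perm.sign (φ k) := by
    have : σ = Equiv.prodCongrLeft (fun _ => π) * Equiv.prodCongrRight φ := by
      ext1 ⟨i, k⟩
      rw [hσ]; rfl
    rw [this, Equiv.Perm.sign_mul, Equiv.Perm.sign_prodCongrRight,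
      Equiv.Perm.sign_prodCongrLeft]
    simp
  have hflip : ∀ (U : Fin d × Fin 2 → Fin d × Fin 2 → ℝ) (_ : ∀ p q, U p q = -U q p) (i : Fin d),
      U (σ (i, 0)) (σ (i, 1)) = ((Equiv.Perm.sign (φ i) : ℤ) : ℝ) * U (π i, 0) (π i, 1) := by
    intro U hU i
    rw [hσ, hσ]
    generalize φ i = τ
    have : τ = 1 ∨ τ = Equiv.swap 0 1 := by revert τ; decide
    rcases this with rfl | rfl
    · simp
    · rw [Equiv.Perm.sign_swap (by decide)]
      simpa using hU _ _
  have hsq : ∀ i, ((Equiv.Perm.sign (φ i) : ℤ) : ℝ) * ((Equiv.Perm.sign (φ i) : ℤ) : ℝ) = 1 := by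
    intro i
    rw [← Int.cast_mul, ← Units.val_mul, Int.units_mul_self]; simp
  rw [hsign, hflip T hTa, Finset.prod_congr rfl fun j _ => hflip S hSa j]
  simp only [hS, mul_one]
  rw [Units.coe_prod, Int.cast_prod, Fintype.prod_eq_mul_prod_compl i₀]
  have h2 : (∏ i ∈ ({i₀}ᶜ : Finset (Fin d)), ((Equiv.Perm.sign (φ i) : ℤ) : ℝ)) *
      (∏ i ∈ ({i₀}ᶜ : Finset (Fin d)), ((Equiv.Perm.sign (φ i) : ℤ) : ℝ)) = 1 := by
    rw [← Finset.prod_mul_distrib]; exact Finset.prod_eq_one fun i _ => hsq i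
  linear_combination (T (π i₀, 0) (π i₀, 1)) * (((Equiv.Perm.sign (φ i₀) : ℤ) : ℝ) *
    ((Equiv.Perm.sign (φ i₀) : ℤ) : ℝ)) * h2 + T (π i₀, 0) (π i₀, 1) * hsq i₀

theorem eq_of_pair {i₁ i₂ i₃ : Fin d × Fin 2} (h₁ : i₁.1 = i₂.1) (h₂ : i₁.1 = i₃.1)
    (h₁₂ : i₁ ≠ i₂) (h₁₃ : i₁ ≠ i₃) : i₂ = i₃ := by
  obtain ⟨a, k⟩ := i₁
  obtain ⟨b, l⟩ := i₂
  obtain ⟨c, m⟩ := i₃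
  simp only at h₁ h₂
  subst h₁ h₂
  simp only [ne_eq, Prod.mk.injEq, true_and] at *
  omega

/-- A permutation of `2d` elements preserving all pairs but one comes from a permutation of the
pairs and flips. -/
theorem exists_flips (i₀ : Fin d) (σ : Equiv.Perm (Fin d × Fin 2))
    (h : ∀ j, j ≠ i₀ → (σ (j, 0)).1 = (σ (j, 1)).1) :
    ∃ (π : Equiv.Perm (Fin d)) (φ : Fin d → Equiv.Perm (Fin 2)),
      ∀ i k, σ (i, k) = (π i, φ i k) := by
  have h01 : ∀ j, σ (j, 0) ≠ σ (j, 1) := fun j hj => by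
    have := σ.injective hj
    simp at this
  have hall : ∀ j, (σ (j, 0)).1 = (σ (j, 1)).1 := by
    intro j
    by_cases hj : j = i₀
    swap
    · exact h j hj
    subst hj
    obtain ⟨⟨i, k⟩, hik⟩ := σ.surjective ((σ (j, 0)).1, (σ (j, 0)).2 + 1)
    have hne : σ (i, k) ≠ σ (j, 0) := by
      intro hh
      rw [hik] at hh
      have := congrArg Prod.snd hh
      simp at this
    have h1 : (σ (i, k)).1 = (σ (j, 0)).1 := by rw [hik]
    by_cases hij : i = j
    · subst hij
      have hk : k = 1 := by
        by_contra hk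
        have : k = 0 := by omega
        exact hne (by rw [this])
      rw [hk] at h1
      exact h1.symm
    · exfalso
      have h2 := h i hij
      have hk : k = 0 ∨ k = 1 := by omega
      rcases hk with rfl | rfl
      · have := σ.injective (eq_of_pair h2 h1 (h01 i) hne)
        exact hij (congrArg Prod.fst this)
      · have := σ.injective (eq_of_pair h2.symm h1 (h01 i).symm hne)
        exact hij (congrArg Prod.fst this)
  have hfst : ∀ j k, (σ (j, k)).1 = (σ (j, 0)).1 := by
    intro j k
    have hk : k = 0 ∨ k = 1 := by omega
    rcases hk with rfl | rfl
    · rfl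
    · exact (hall j).symm
  have hπ : Function.Injective fun j => (σ (j, 0)).1 := by
    intro i j hij
    by_contra hne
    have h1 := eq_of_pair (hall i) hij (h01 i) (fun hh => hne (by simpa using σ.injective hh))
    have := σ.injective h1
    simp at this
  have hφ : ∀ j, Function.Injective fun k => (σ (j, k)).2 := by
    intro j k l hkl
    have : σ (j, k) = σ (j, l) := Prod.ext (by rw [hfst, hfst j l]) hkl
    simpa using σ.injective this
  refine ⟨Equiv.ofBijective _ (Finite.injective_iff_bijective.1 hπ),
    fun j => Equiv.ofBijective _ (Finite.injective_iff_bijective.1 (hφ j)), fun i k => ?_⟩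
  exact Prod.ext (hfst i k) rfl

theorem topCoeff_pos_of_unitary (hd : 0 < d) (K α : Vec d → Vec d → ℝ)
    (h0 : ∀ p q : Fin d × Fin 2, p.1 ≠ q.1 → K (orientedBasis d p) (orientedBasis d q) = 0)
    (h1 : ∀ i, K (orientedBasis d (i, 0)) (orientedBasis d (i, 1)) = 1)
    (hKa : ∀ v w, K v w = -K w v) (hαa : ∀ v w, α v w = -α w v)
    (hα : ∀ i, 0 ≤ α (orientedBasis d (i, 0)) (orientedBasis d (i, 1)))
    (hα' : ∃ i, 0 < α (orientedBasis d (i, 0)) (orientedBasis d (i, 1))) :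
    0 < topCoeff K α := by
  rw [topCoeff_eq hd]
  refine mul_pos (by positivity) (Finset.sum_pos' (fun σ _ => ?_) ?_)
  · by_cases hp : ∏ j ∈ ({⟨0, hd⟩}ᶜ : Finset (Fin d)),
        K (orientedBasis d (σ (j, 0))) (orientedBasis d (σ (j, 1))) = 0
    · rw [hp]; simp
    · obtain ⟨π, φ, hσ⟩ := exists_flips ⟨0, hd⟩ σ fun j hj => by
        by_contra hne
        exact hp (Finset.prod_eq_zero (i := j) (by simpa using hj) (h0 _ _ hne))
      rw [unitary_term ⟨0, hd⟩ (fun p q => K (orientedBasis d p) (orientedBasis d q))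
        (fun p q => α (orientedBasis d p) (orientedBasis d q)) h1 (fun _ _ => hKa _ _)
        (fun _ _ => hαa _ _) π φ σ hσ]
      exact hα _
  · obtain ⟨i, hi⟩ := hα'
    refine ⟨Equiv.prodCongrLeft fun _ => Equiv.swap ⟨0, hd⟩ i, Finset.mem_univ _, ?_⟩
    rw [unitary_term ⟨0, hd⟩ (fun p q => K (orientedBasis d p) (orientedBasis d q))
        (fun p q => α (orientedBasis d p) (orientedBasis d q)) h1 (fun _ _ => hKa _ _)
        (fun _ _ => hαa _ _) (Equiv.swap ⟨0, hd⟩ i) (fun _ => 1) _ (fun _ _ => rfl)]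
    simpa using hi

/-- The `(1,1)`-form `2i ∂g ∧ ∂̄g` for a real function `g` with differential `ξ`. -/
def rankOne (ξ : Vec d →L[ℝ] ℝ) (v w : Vec d) : ℝ :=
  (1 / 2) * (ξ w * ξ (Complex.I • v) - ξ v * ξ (Complex.I • w))

theorem rankOne_self (ξ : Vec d →L[ℝ] ℝ) (v : Vec d) :
    rankOne ξ v (Complex.I • v) = (1 / 2) * (ξ v ^ 2 + ξ (Complex.I • v) ^ 2) := by
  unfold rankOne
  rw [smul_smul, Complex.I_mul_I, neg_one_smul, map_neg]; ring

/-- `rankOne` as a bilinear form. -/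
def rankOneForm (ξ : Vec d →L[ℝ] ℝ) : Vec d →ₗ[ℝ] Vec d →ₗ[ℝ] ℝ :=
  LinearMap.mk₂ ℝ (rankOne ξ) (fun _ _ _ => by simp [rankOne]; ring)
    (fun c v w => by
      have : Complex.I • c • v = c • (Complex.I • v) := smul_comm _ _ _
      simp [rankOne, this]; ring) (fun _ _ _ => by simp [rankOne]; ring)
    (fun c v w => by
      have : Complex.I • c • w = c • (Complex.I • w) := smul_comm _ _ _
      simp [rankOne, this]; ring)

theorem topCoeff_rankOne_pos (hd : 0 < d) (K : Vec d →ₗ[ℝ] Vec d →ₗ[ℝ] ℝ)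
    (hK : ∀ v w, K (Complex.I • v) (Complex.I • w) = K v w)
    (hanti : ∀ v w, K v w = -K w v) (hpos : ∀ v, v ≠ 0 → 0 < K v (Complex.I • v))
    (ξ : Vec d →L[ℝ] ℝ) (hξ : ξ ≠ 0) :
    0 < topCoeff (fun v w => K v w) (rankOne ξ) := by
  obtain ⟨b, hb⟩ := exists_unitary_basis K hK hanti hpos
  have hI : ∀ v w, K (Complex.I • v) w = -K v (Complex.I • w) := fun v w => by
    have := hK (Complex.I • v) w
    rw [smul_smul, Complex.I_mul_I] at this
    simp at this; linarith
  let A : Vec d →ₗ[ℂ] Vec d := b.equivFun.symm.toLinearMap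
  have hA0 : ∀ i, A (orientedBasis d (i, 0)) = b i := fun i => by
    simp [A, orientedBasis, Module.Basis.equivFun_symm_apply, Pi.single_apply]
  have hA1 : ∀ i, A (orientedBasis d (i, 1)) = Complex.I • b i := fun i => by
    simp [A, orientedBasis, Module.Basis.equivFun_symm_apply, Pi.single_apply]
  have hdet : 0 < LinearMap.det (A.restrictScalars ℝ) := by
    rw [det_restrictScalars_eq, Complex.normSq_pos]
    exact (LinearEquiv.isUnit_det' b.equivFun.symm).ne_zero
  have hpull := topCoeff_pullback K (rankOneForm ξ) (A.restrictScalars ℝ)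
  have hmain : 0 < topCoeff (fun v w => K (A.restrictScalars ℝ v) (A.restrictScalars ℝ w))
      (fun v w => rankOneForm ξ (A.restrictScalars ℝ v) (A.restrictScalars ℝ w)) := by
    have hval : ∀ i, rankOneForm ξ (A (orientedBasis d (i, 0))) (A (orientedBasis d (i, 1))) =
        (1 / 2) * (ξ (b i) ^ 2 + ξ (Complex.I • b i) ^ 2) := fun i => by
      rw [hA0, hA1]; exact rankOne_self ξ (b i)
    refine topCoeff_pos_of_unitary hd _ _ ?_ ?_ (fun _ _ => hanti _ _) ?_ ?_ ?_
    · rintro ⟨i, k⟩ ⟨j, l⟩ hij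
      simp only [LinearMap.restrictScalars_apply]
      have hij' : i ≠ j := hij
      have e1 := (hb i j).1
      have e2 := (hb i j).2
      rw [if_neg hij'] at e2
      fin_cases k <;> fin_cases l <;>
        simp only [Fin.zero_eta, Fin.mk_one, hA0, hA1, hK, hI, e1, e2, neg_zero]
    · intro i
      simp only [LinearMap.restrictScalars_apply, hA0, hA1, (hb i i).2, if_true]
    · intro v w
      change rankOne ξ _ _ = -rankOne ξ _ _
      unfold rankOne; ring
    · intro i
      rw [LinearMap.restrictScalars_apply, LinearMap.restrictScalars_apply, hval]
      positivity
    · by_contra! hcon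
      refine hξ ?_
      have hz : ∀ i, ξ (b i) = 0 ∧ ξ (Complex.I • b i) = 0 := fun i => by
        have := hcon i
        rw [LinearMap.restrictScalars_apply, LinearMap.restrictScalars_apply, hval] at this
        constructor <;> nlinarith [sq_nonneg (ξ (b i)), sq_nonneg (ξ (Complex.I • b i))]
      ext v
      rw [← b.sum_repr v, map_sum]
      refine Finset.sum_eq_zero fun i _ => ?_
      have : b.repr v i • b i = (b.repr v i).re • b i + (b.repr v i).im • (Complex.I • b i) := by
        ext k
        simp only [Pi.smul_apply, Pi.add_apply, smul_eq_mul, Complex.real_smul]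
        nth_rewrite 1 [← Complex.re_add_im (b.repr v i)]; ring
      rw [this]; simp [hz]
  rw [hpull] at hmain
  exact (pos_iff_pos_of_mul_pos hmain).1 hdet

end WedgeAlgebra

/-! ### Differential calculus of real one-forms and of `i∂∂̄` on `ℂ^d` -/

section Calculus

open Filter Topology

variable {d : ℕ}

/-- `½ dᶜu`, where `(dᶜu)(v) = -du(iv)`. -/
def dc (u : Vec d → ℝ) (y : Vec d) : Vec d →L[ℝ] ℝ :=
  (-(1 / 2 : ℝ)) • (fderiv ℝ u y).comp (mulI d)

/-- The exterior derivative of a real one-form. -/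
def extD (η : Vec d → Vec d →L[ℝ] ℝ) (y v w : Vec d) : ℝ :=
  fderiv ℝ η y v w - fderiv ℝ η y w v

/-- The imaginary part of a complex one-form. -/
def imForm (a : Vec d → Vec d →L[ℂ] ℂ) (y : Vec d) : Vec d →L[ℝ] ℝ :=
  Complex.imCLM.comp ((a y).restrictScalars ℝ)

theorem dc_apply (u : Vec d → ℝ) (y v : Vec d) :
    dc u y v = -(1 / 2) * fderiv ℝ u y (Complex.I • v) := rfl

@[simp] theorem imForm_apply (a : Vec d → Vec d →L[ℂ] ℂ) (y v : Vec d) :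
    imForm a y v = (a y v).im := rfl

/-- The exterior derivative as a bilinear form. -/
def extDForm (η : Vec d → Vec d →L[ℝ] ℝ) (y : Vec d) : Vec d →ₗ[ℝ] Vec d →ₗ[ℝ] ℝ :=
  LinearMap.mk₂ ℝ (extD η y) (fun _ _ _ => by simp [extD]; ring)
    (fun _ _ _ => by simp [extD]; ring) (fun _ _ _ => by simp [extD]; ring)
    (fun _ _ _ => by simp [extD]; ring)

/-- The form `i∂∂̄u` as a bilinear form. -/
def iDDbarForm (u : Vec d → ℝ) (y : Vec d) : Vec d →ₗ[ℝ] Vec d →ₗ[ℝ] ℝ :=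
  LinearMap.mk₂ ℝ (iDDbar u y) (fun _ _ _ => by simp [iDDbar]; ring)
    (fun c v w => by
      have : Complex.I • c • v = c • (Complex.I • v) := smul_comm _ _ _
      simp [iDDbar, this]; ring) (fun _ _ _ => by simp [iDDbar]; ring)
    (fun c v w => by
      have : Complex.I • c • w = c • (Complex.I • w) := smul_comm _ _ _
      simp [iDDbar, this]; ring)

theorem ContDiffAt.differentiableAt_fderiv' {𝕜 E F : Type*} [NontriviallyNormedField 𝕜]
    [NormedAddCommGroup E] [NormedSpace 𝕜 E] [NormedAddCommGroup F] [NormedSpace 𝕜 F]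
    {u : E → F} {y : E} (hu : ContDiffAt 𝕜 2 u y) : DifferentiableAt 𝕜 (fderiv 𝕜 u) y :=
  (hu.fderiv_right (m := 1) (by norm_num)).differentiableAt (by norm_num)

theorem ContDiffAt.eventually_differentiableAt {𝕜 E F : Type*} [RCLike 𝕜]
    [NormedAddCommGroup E] [NormedSpace 𝕜 E] [NormedAddCommGroup F] [NormedSpace 𝕜 F]
    {u : E → F} {y : E} (hu : ContDiffAt 𝕜 2 u y) : ∀ᶠ z in 𝓝 y, DifferentiableAt 𝕜 u z :=
  (hu.eventually (by norm_num)).mono fun _ hz => hz.differentiableAt (by norm_num)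

theorem extD_dc {u : Vec d → ℝ} {y : Vec d} (hu : ContDiffAt ℝ 2 u y) (v w : Vec d) :
    extD (dc u) y v w = iDDbar u y v w := by
  have h1 : ∀ v w, fderiv ℝ (dc u) y v w = -(1 / 2) * fderiv ℝ (fderiv ℝ u) y v (Complex.I • w) := by
    intro v w
    have hd := ContDiffAt.differentiableAt_fderiv' hu
    have : HasFDerivAt (dc u) (((-(1 / 2 : ℝ)) •
        ((ContinuousLinearMap.compL ℝ (Vec d) (Vec d) ℝ).flip (mulI d))).comp
          (fderiv ℝ (fderiv ℝ u) y)) y :=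
      ((-(1 / 2 : ℝ)) • ((ContinuousLinearMap.compL ℝ (Vec d) (Vec d) ℝ).flip
        (mulI d))).hasFDerivAt.comp y hd.hasFDerivAt
    rw [this.fderiv]; rfl
  unfold extD iDDbar
  rw [h1, h1]; ring

theorem extD_congr {η η' : Vec d → Vec d →L[ℝ] ℝ} {y : Vec d} (h : η =ᶠ[𝓝 y] η') (v w : Vec d) :
    extD η y v w = extD η' y v w := by
  unfold extD; rw [h.fderiv_eq]

theorem iDDbar_congr {u u' : Vec d → ℝ} {y : Vec d} (h : u =ᶠ[𝓝 y] u') (v w : Vec d) :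
    iDDbar u y v w = iDDbar u' y v w := by
  unfold iDDbar; rw [h.fderiv.fderiv_eq]

theorem dc_congr {u u' : Vec d → ℝ} {y : Vec d} (h : u =ᶠ[𝓝 y] u') : dc u y = dc u' y := by
  unfold dc; rw [h.fderiv_eq]

theorem extD_add {η η' : Vec d → Vec d →L[ℝ] ℝ} {y : Vec d} (h : DifferentiableAt ℝ η y)
    (h' : DifferentiableAt ℝ η' y) (v w : Vec d) :
    extD (fun z => η z + η' z) y v w = extD η y v w + extD η' y v w := by
  unfold extD; rw [fderiv_fun_add h h']; simp; ring

theorem extD_smul {g : Vec d → ℝ} {η : Vec d → Vec d →L[ℝ] ℝ} {y : Vec d}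
    (hg : DifferentiableAt ℝ g y) (h : DifferentiableAt ℝ η y) (v w : Vec d) :
    extD (fun z => g z • η z) y v w =
      g y * extD η y v w + (fderiv ℝ g y v * η y w - fderiv ℝ g y w * η y v) := by
  unfold extD; rw [fderiv_fun_smul hg h]; simp; ring

theorem iDDbar_add {u u' : Vec d → ℝ} {y : Vec d} (h : ContDiffAt ℝ 2 u y)
    (h' : ContDiffAt ℝ 2 u' y) (v w : Vec d) :
    iDDbar (fun z => u z + u' z) y v w = iDDbar u y v w + iDDbar u' y v w := by
  have e : fderiv ℝ (fun z => u z + u' z) =ᶠ[𝓝 y] fun z => fderiv ℝ u z + fderiv ℝ u' z := by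
    filter_upwards [ContDiffAt.eventually_differentiableAt h,
      ContDiffAt.eventually_differentiableAt h'] with z hz hz'
    exact fderiv_fun_add hz hz'
  unfold iDDbar
  rw [e.fderiv_eq, fderiv_fun_add (ContDiffAt.differentiableAt_fderiv' h)
    (ContDiffAt.differentiableAt_fderiv' h')]
  simp; ring

theorem iDDbar_const_add {u : Vec d → ℝ} {y : Vec d} (c : ℝ) (v w : Vec d) :
    iDDbar (fun z => c + u z) y v w = iDDbar u y v w := by
  have : fderiv ℝ (fun z => c + u z) = fderiv ℝ u := funext fun z => fderiv_const_add c
  unfold iDDbar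
  rw [this]

theorem iDDbar_neg (u : Vec d → ℝ) (y v w : Vec d) :
    iDDbar (fun z => -u z) y v w = -iDDbar u y v w := by
  unfold iDDbar
  have : fderiv ℝ (fun z => -u z) = fun z => -fderiv ℝ u z := by funext z; exact fderiv_fun_neg
  rw [this, fderiv_fun_neg]; simp; ring

theorem iDDbar_sub {u u' : Vec d → ℝ} {y : Vec d} (h : ContDiffAt ℝ 2 u y)
    (h' : ContDiffAt ℝ 2 u' y) (v w : Vec d) :
    iDDbar (fun z => u z - u' z) y v w = iDDbar u y v w - iDDbar u' y v w := by
  simp only [sub_eq_add_neg]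
  rw [iDDbar_add h h'.neg, iDDbar_neg]

theorem dc_add {u u' : Vec d → ℝ} {y : Vec d} (h : DifferentiableAt ℝ u y)
    (h' : DifferentiableAt ℝ u' y) : dc (fun z => u z + u' z) y = dc u y + dc u' y := by
  unfold dc; rw [fderiv_fun_add h h', ContinuousLinearMap.add_comp, smul_add]

theorem iDDbar_comp_real {S S' : ℝ → ℝ} {S'' : ℝ} {g : Vec d → ℝ} {y : Vec d}
    (hg : ContDiffAt ℝ 2 g y) (hS : ∀ᶠ t in 𝓝 (g y), HasDerivAt S (S' t) t)
    (hS' : HasDerivAt S' S'' (g y)) (v w : Vec d) :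
    iDDbar (fun z => S (g z)) y v w =
      S' (g y) * iDDbar g y v w + S'' * rankOne (fderiv ℝ g y) v w := by
  have e : fderiv ℝ (fun z => S (g z)) =ᶠ[𝓝 y] fun z => S' (g z) • fderiv ℝ g z := by
    filter_upwards [ContDiffAt.eventually_differentiableAt hg,
      hg.continuousAt.eventually hS] with z hz hz'
    exact (hz'.comp_hasFDerivAt z hz.hasFDerivAt).fderiv
  have h2 : HasFDerivAt (fun z => S' (g z)) (S'' • fderiv ℝ g y) y :=
    hS'.comp_hasFDerivAt y (hg.differentiableAt (by norm_num)).hasFDerivAt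
  unfold iDDbar
  rw [e.fderiv_eq, (h2.fun_smul (ContDiffAt.differentiableAt_fderiv' hg).hasFDerivAt).fderiv]
  simp [rankOne]; ring

theorem eventually_fderiv_restrictScalars {G : Type*} [NormedAddCommGroup G] [NormedSpace ℂ G]
    {F : Vec d → G} {y : Vec d} (hF : ContDiffAt ℂ 2 F y) :
    ∀ᶠ z in 𝓝 y, HasFDerivAt F ((fderiv ℂ F z).restrictScalars ℝ) z :=
  (ContDiffAt.eventually_differentiableAt hF).mono fun _ hz =>
    hz.hasFDerivAt.restrictScalars ℝ

theorem hasFDerivAt_restrictScalars_fderiv {G : Type*} [NormedAddCommGroup G] [NormedSpace ℂ G]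
    {F : Vec d → G} {y : Vec d} (hF : ContDiffAt ℂ 2 F y) :
    HasFDerivAt (fun z => (fderiv ℂ F z).restrictScalars ℝ)
      ((ContinuousLinearMap.restrictScalarsL ℂ (Vec d) G ℝ ℝ).comp
        ((fderiv ℂ (fderiv ℂ F) y).restrictScalars ℝ)) y :=
  (ContinuousLinearMap.restrictScalarsL ℂ (Vec d) G ℝ ℝ).hasFDerivAt.comp y
    ((ContDiffAt.differentiableAt_fderiv' hF).hasFDerivAt.restrictScalars ℝ)

theorem snd_fderiv_symm {G : Type*} [NormedAddCommGroup G] [NormedSpace ℂ G]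
    {F : Vec d → G} {y : Vec d} (hF : ContDiffAt ℂ 2 F y) (v w : Vec d) :
    fderiv ℂ (fderiv ℂ F) y v w = fderiv ℂ (fderiv ℂ F) y w v :=
  (hF.isSymmSndFDerivAt (by simp)).eq v w

theorem iDDbar_comp_holomorphic {u : Vec d → ℝ} {F : Vec d → Vec d} {y : Vec d}
    (hF : ContDiffAt ℂ 2 F y) (hu : ContDiffAt ℝ 2 u (F y)) (v w : Vec d) :
    iDDbar (fun z => u (F z)) y v w =
      iDDbar u (F y) (fderiv ℂ F y v) (fderiv ℂ F y w) := by
  have e : fderiv ℝ (fun z => u (F z)) =ᶠ[𝓝 y]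
      fun z => (fderiv ℝ u (F z)).comp ((fderiv ℂ F z).restrictScalars ℝ) := by
    filter_upwards [eventually_fderiv_restrictScalars hF,
      hF.continuousAt.eventually (ContDiffAt.eventually_differentiableAt hu)] with z hz hz'
    exact (hz'.hasFDerivAt.comp z hz).fderiv
  have h1 : HasFDerivAt (fun z => fderiv ℝ u (F z))
      ((fderiv ℝ (fderiv ℝ u) (F y)).comp ((fderiv ℂ F y).restrictScalars ℝ)) y :=
    (ContDiffAt.differentiableAt_fderiv' hu).hasFDerivAt.comp y
      (eventually_fderiv_restrictScalars hF).self_of_nhds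
  unfold iDDbar
  rw [e.fderiv_eq, (h1.clm_comp (hasFDerivAt_restrictScalars_fderiv hF)).fderiv]
  have hs := snd_fderiv_symm hF v w
  simp [hs]

theorem iDDbar_re {G : Vec d → ℂ} {y : Vec d} (hG : ContDiffAt ℂ 2 G y) (v w : Vec d) :
    iDDbar (fun z => (G z).re) y v w = 0 := by
  have e : fderiv ℝ (fun z => (G z).re) =ᶠ[𝓝 y]
      fun z => Complex.reCLM.comp ((fderiv ℂ G z).restrictScalars ℝ) := by
    filter_upwards [eventually_fderiv_restrictScalars hG] with z hz
    exact (Complex.reCLM.hasFDerivAt.comp z hz).fderiv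
  have h2 := (ContinuousLinearMap.compL ℝ (Vec d) ℂ ℝ Complex.reCLM).hasFDerivAt.comp y
    (hasFDerivAt_restrictScalars_fderiv hG)
  have h3 : fderiv ℝ (fun z => Complex.reCLM.comp ((fderiv ℂ G z).restrictScalars ℝ)) y = _ :=
    h2.fderiv
  unfold iDDbar
  rw [e.fderiv_eq, h3]
  have hs := snd_fderiv_symm hG v w
  simp [hs]

theorem log_normSq_eventuallyEq {f : Vec d → ℂ} {y : Vec d} (hf : ContinuousAt f y)
    (h0 : f y ≠ 0) :
    (fun z => Real.log (Complex.normSq (f z))) =ᶠ[𝓝 y]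
      fun z => Real.log (Complex.normSq (f y)) + (2 * Complex.log (f z / f y)).re := by
  have : ∀ᶠ z in 𝓝 y, f z ≠ 0 := hf.eventually_ne h0
  filter_upwards [this] with z hz
  have h2 : Complex.normSq (f z) = Complex.normSq (f y) * Complex.normSq (f z / f y) := by
    rw [map_div₀, mul_div_cancel₀]; simpa using h0
  rw [h2, Real.log_mul (by simpa using h0) (by simp [h0, hz]), Complex.normSq_eq_norm_sq,
    Complex.normSq_eq_norm_sq, Real.log_pow (n := 2) (x := ‖f z / f y‖)]
  simp [Complex.log_re]

theorem contDiffAt_two_log {f : Vec d → ℂ} {y : Vec d} {n : WithTop ℕ∞}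
    (hf : ContDiffAt ℂ n f y) (h0 : f y ≠ 0) :
    ContDiffAt ℂ n (fun z => 2 * Complex.log (f z / f y)) y := by
  refine contDiffAt_const.mul ?_
  have : f y / f y ∈ Complex.slitPlane := by rw [div_self h0]; exact Complex.one_mem_slitPlane
  exact (Complex.contDiffAt_log this).comp y (hf.div_const _)

theorem iDDbar_log_normSq {f : Vec d → ℂ} {y : Vec d} (hf : ContDiffAt ℂ 2 f y)
    (h0 : f y ≠ 0) (v w : Vec d) :
    iDDbar (fun z => Real.log (Complex.normSq (f z))) y v w = 0 := by
  rw [iDDbar_congr (log_normSq_eventuallyEq hf.continuousAt h0), iDDbar_const_add,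
    iDDbar_re (contDiffAt_two_log hf h0)]

theorem dc_log_normSq {f : Vec d → ℂ} {y : Vec d} (hf : ContDiffAt ℂ 1 f y) (h0 : f y ≠ 0)
    (v : Vec d) :
    dc (fun z => Real.log (Complex.normSq (f z))) y v = (fderiv ℂ f y v / f y).im := by
  rw [dc_congr (log_normSq_eventuallyEq hf.continuousAt h0), dc_apply, fderiv_const_add]
  have h1 : HasFDerivAt f (fderiv ℂ f y) y := (hf.differentiableAt (by norm_num)).hasFDerivAt
  have h2 : HasFDerivAt (fun z => f z / f y) ((f y)⁻¹ • fderiv ℂ f y) y := by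
    have := h1.const_mul (f y)⁻¹
    refine this.congr_of_eventuallyEq (Eventually.of_forall fun z => ?_)
    simp [div_eq_inv_mul]
  have hs : f y / f y ∈ Complex.slitPlane := by rw [div_self h0]; exact Complex.one_mem_slitPlane
  have h3 := (h2.clog hs).const_mul 2
  have h4 := Complex.reCLM.hasFDerivAt.comp y (h3.restrictScalars ℝ)
  have h5 : fderiv ℝ (fun z => (2 * Complex.log (f z / f y)).re) y = _ := h4.fderiv
  rw [h5]
  have hn : Complex.normSq (f y) ≠ 0 := by simpa using h0
  simp [div_self h0, Complex.div_im]
  field_simp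
  ring

theorem dc_comp_holomorphic {u : Vec d → ℝ} {F : Vec d → Vec d} {y : Vec d}
    (hF : DifferentiableAt ℂ F y) (hu : DifferentiableAt ℝ u (F y)) (v : Vec d) :
    dc (fun z => u (F z)) y v = dc u (F y) (fderiv ℂ F y v) := by
  have := hu.hasFDerivAt.comp y (hF.hasFDerivAt.restrictScalars ℝ)
  have h2 : fderiv ℝ (fun z => u (F z)) y = _ := this.fderiv
  rw [dc_apply, dc_apply, h2]
  simp

theorem extD_imForm_I {a : Vec d → Vec d →L[ℂ] ℂ} {y : Vec d} (ha : DifferentiableAt ℂ a y)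
    (v w : Vec d) :
    extD (imForm a) y (Complex.I • v) (Complex.I • w) = -extD (imForm a) y v w := by
  have h1 : ∀ v w, fderiv ℝ (imForm a) y v w = (fderiv ℂ a y v w).im := by
    intro v w
    have := ((ContinuousLinearMap.compL ℝ (Vec d) ℂ ℝ Complex.imCLM).comp
      (ContinuousLinearMap.restrictScalarsL ℂ (Vec d) ℂ ℝ ℝ)).hasFDerivAt.comp y
      (ha.hasFDerivAt.restrictScalars ℝ)
    have h3 : fderiv ℝ (imForm a) y = _ := this.fderiv
    rw [h3]; rfl
  unfold extD
  simp only [h1, map_smul, _root_.smul_apply, smul_eq_mul, ← mul_assoc,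
    Complex.I_mul_I]
  simp; ring

end Calculus

/-! ### Stokes' theorem for compactly supported forms, and change of charts -/

section Stokes

open Filter Topology MeasureTheory

variable {d : ℕ}

theorem integral_fderiv_eq_zero {g : Vec d → ℝ} (hg : ContDiff ℝ 1 g) (hc : HasCompactSupport g)
    (v : Vec d) : ∫ y, fderiv ℝ g y v = 0 := by
  have hgi : Integrable g := hg.continuous.integrable_of_hasCompactSupport hc
  have hdi : Integrable fun y => fderiv ℝ g y v :=
    (hg.continuous_fderiv_apply (by norm_num) |>.comp
      (continuous_id.prodMk continuous_const)).integrable_of_hasCompactSupport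
      (hc.fderiv_apply ℝ v)
  have := integral_mul_fderiv_eq_neg_fderiv_mul_of_integrable (μ := volume) (f := fun _ => (1 : ℝ))
    (g := g) (v := v) (by simp) (by simpa using hdi) (by simpa using hgi)
    (fun _ _ => differentiableAt_const _) (fun x _ => hg.differentiable (by norm_num) x)
  simpa using this

/-- The values of a two-form as a function of two vectors. -/
abbrev pairing (α : (Vec d) [⋀^Fin 2]→L[ℝ] ℝ) (v w : Vec d) : ℝ := α ![v, w]

theorem pairing_antisymm (α : (Vec d) [⋀^Fin 2]→L[ℝ] ℝ) (v w : Vec d) :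
    pairing α v w = -pairing α w v := by
  have := α.toAlternatingMap.map_swap ![w, v] (i := 0) (j := 1) (by simp)
  have e : ![w, v] ∘ Equiv.swap (0 : Fin 2) 1 = ![v, w] := by
    ext i; fin_cases i <;> simp
  rw [e] at this
  exact this

theorem contDiff_of_forall_tsupport {E : Type*} [NormedAddCommGroup E] [NormedSpace ℝ E]
    {F : Type*} [NormedAddCommGroup F] [NormedSpace ℝ F] {n : WithTop ℕ∞} {g : E → F}
    (h : ∀ y ∈ tsupport g, ContDiffAt ℝ n g y) : ContDiff ℝ n g := by
  rw [contDiff_iff_contDiffAt]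
  intro y
  by_cases hy : y ∈ tsupport g
  · exact h y hy
  · exact contDiffAt_const.congr_of_eventuallyEq (notMem_tsupport_iff_eventuallyEq.1 hy)

theorem closed_cyclic {K : Vec d → (Vec d) [⋀^Fin 2]→L[ℝ] ℝ} {p : Vec d}
    (hK : DifferentiableAt ℝ K p) (hcl : extDeriv K p = 0) (x y z : Vec d) :
    fderiv ℝ (fun q => K q ![y, z]) p x + fderiv ℝ (fun q => K q ![z, x]) p y +
      fderiv ℝ (fun q => K q ![x, y]) p z = 0 := by
  have h := (extDeriv_apply hK ![x, y, z]).trans (Fin.sum_univ_three _)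
  rw [hcl] at h
  have e0 : Fin.removeNth 0 ![x, y, z] = ![y, z] := by
    ext i; fin_cases i <;> rfl
  have e1 : Fin.removeNth 1 ![x, y, z] = ![x, z] := by
    ext i; fin_cases i <;> rfl
  have e2 : Fin.removeNth 2 ![x, y, z] = ![x, y] := by
    ext i; fin_cases i <;> rfl
  have hs : (fun q => K q ![x, z]) = fun q => -K q ![z, x] := by
    funext q
    exact pairing_antisymm (K q) x z
  rw [e0, e1, e2, hs, fderiv_fun_neg] at h
  simp at h
  linarith

/-- An alternating sum over permutations vanishes if its cyclic sums do. -/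
theorem sum_perm_eq_zero_of_cyclic {ι : Type*} [Fintype ι] [DecidableEq ι]
    (T : Equiv.Perm ι → ℝ) (c : Equiv.Perm ι)
    (h : ∀ σ, T σ + T (σ * c) + T (σ * c * c) = 0) : ∑ σ, T σ = 0 := by
  have h1 : ∑ σ, T (σ * c) = ∑ σ, T σ := Equiv.sum_comp (Equiv.mulRight c) T
  have h2 : ∑ σ, T (σ * c * c) = ∑ σ, T σ := by
    rw [← h1]; exact Equiv.sum_comp (Equiv.mulRight c) fun σ => T (σ * c)
  have h3 : ∑ σ, (T σ + T (σ * c) + T (σ * c * c)) = 0 := Finset.sum_eq_zero fun σ _ => h σ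
  rw [Finset.sum_add_distrib, Finset.sum_add_distrib, h1, h2] at h3
  linarith

theorem differentiableAt_pairing {K : Vec d → (Vec d) [⋀^Fin 2]→L[ℝ] ℝ} {p : Vec d}
    (hK : DifferentiableAt ℝ K p) (v w : Vec d) :
    DifferentiableAt ℝ (fun q => pairing (K q) v w) p :=
  (ContinuousAlternatingMap.apply ℝ (Vec d) ℝ ![v, w]).differentiableAt.comp p hK

theorem contDiffAt_pairing {K : Vec d → (Vec d) [⋀^Fin 2]→L[ℝ] ℝ} {p : Vec d} {n : WithTop ℕ∞}
    (hK : ContDiffAt ℝ n K p) (v w : Vec d) :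
    ContDiffAt ℝ n (fun q => pairing (K q) v w) p :=
  (ContinuousAlternatingMap.apply ℝ (Vec d) ℝ ![v, w]).contDiff.contDiffAt.comp p hK

theorem topCoeff_extD_eq_sum_fderiv (hd : 0 < d) {K : Vec d → (Vec d) [⋀^Fin 2]→L[ℝ] ℝ}
    {p : Vec d} (hK : DifferentiableAt ℝ K p) (hcl : extDeriv K p = 0)
    {ζ : Vec d → Vec d →L[ℝ] ℝ} (hζ : DifferentiableAt ℝ ζ p) :
    topCoeff (pairing (K p)) (extD ζ p) =
      ((2 : ℝ) ^ d)⁻¹ * (2 * ∑ σ : Equiv.Perm (Fin d × Fin 2), ((Equiv.Perm.sign σ : ℤ) : ℝ) *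
        fderiv ℝ (fun q => ζ q (orientedBasis d (σ (⟨0, hd⟩, 1))) *
          ∏ j ∈ ({⟨0, hd⟩}ᶜ : Finset (Fin d)),
            pairing (K q) (orientedBasis d (σ (j, 0))) (orientedBasis d (σ (j, 1)))) p
          (orientedBasis d (σ (⟨0, hd⟩, 0)))) := by
  classical
  rw [topCoeff_eq hd]
  congr 1
  set b := orientedBasis d
  set i₀ : Fin d := ⟨0, hd⟩
  have hder : ∀ σ : Equiv.Perm (Fin d × Fin 2),
      fderiv ℝ (fun q => ζ q (b (σ (i₀, 1))) *
          ∏ j ∈ ({i₀}ᶜ : Finset (Fin d)), pairing (K q) (b (σ (j, 0))) (b (σ (j, 1)))) p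
          (b (σ (i₀, 0))) =
        fderiv ℝ ζ p (b (σ (i₀, 0))) (b (σ (i₀, 1))) *
          (∏ j ∈ ({i₀}ᶜ : Finset (Fin d)), pairing (K p) (b (σ (j, 0))) (b (σ (j, 1)))) +
        ∑ k ∈ ({i₀}ᶜ : Finset (Fin d)), ζ p (b (σ (i₀, 1))) *
          ((∏ j ∈ ({i₀}ᶜ : Finset (Fin d)).erase k,
            pairing (K p) (b (σ (j, 0))) (b (σ (j, 1)))) *
            fderiv ℝ (fun q => pairing (K q) (b (σ (k, 0))) (b (σ (k, 1)))) p
              (b (σ (i₀, 0)))) := by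
    intro σ
    have h1 : HasFDerivAt (fun q => ζ q (b (σ (i₀, 1))))
        ((ContinuousLinearMap.apply ℝ ℝ (b (σ (i₀, 1)))).comp (fderiv ℝ ζ p)) p :=
      (ContinuousLinearMap.apply ℝ ℝ (b (σ (i₀, 1)))).hasFDerivAt.comp p hζ.hasFDerivAt
    have h2 := HasFDerivAt.finsetProd (u := ({i₀}ᶜ : Finset (Fin d)))
      (g := fun j q => pairing (K q) (b (σ (j, 0))) (b (σ (j, 1)))) (x := p)
      (fun j _ => (differentiableAt_pairing hK (b (σ (j, 0))) (b (σ (j, 1)))).hasFDerivAt)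
    rw [(h1.fun_mul h2).fderiv]
    simp [Finset.mul_sum]
    ring
  simp only [hder, mul_add, Finset.sum_add_distrib]
  have hzero : ∑ σ : Equiv.Perm (Fin d × Fin 2), ((Equiv.Perm.sign σ : ℤ) : ℝ) *
      ∑ k ∈ ({i₀}ᶜ : Finset (Fin d)), ζ p (b (σ (i₀, 1))) *
          ((∏ j ∈ ({i₀}ᶜ : Finset (Fin d)).erase k,
            pairing (K p) (b (σ (j, 0))) (b (σ (j, 1)))) *
            fderiv ℝ (fun q => pairing (K q) (b (σ (k, 0))) (b (σ (k, 1)))) p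
              (b (σ (i₀, 0)))) = 0 := by
    simp only [Finset.mul_sum]
    rw [Finset.sum_comm]
    refine Finset.sum_eq_zero fun k hk => ?_
    have hk : k ≠ i₀ := by simpa using hk
    set c : Equiv.Perm (Fin d × Fin 2) :=
      Equiv.swap (i₀, 0) (k, 0) * Equiv.swap (k, 0) (k, 1) with hc
    have c0 : c (i₀, 0) = (k, 0) := by
      rw [hc, Equiv.Perm.mul_apply, Equiv.swap_apply_of_ne_of_ne (a := (k, 0)) (b := (k, 1))
        (by simp [hk.symm]) (by simp), Equiv.swap_apply_left]
    have c1 : c (k, 0) = (k, 1) := by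
      rw [hc, Equiv.Perm.mul_apply, Equiv.swap_apply_left,
        Equiv.swap_apply_of_ne_of_ne (by simp) (by simp)]
    have c2 : c (k, 1) = (i₀, 0) := by
      rw [hc, Equiv.Perm.mul_apply, Equiv.swap_apply_right, Equiv.swap_apply_right]
    have c3 : c (i₀, 1) = (i₀, 1) := by
      rw [hc, Equiv.Perm.mul_apply, Equiv.swap_apply_of_ne_of_ne (a := (k, 0)) (b := (k, 1))
        (by simp) (by simp [hk.symm]), Equiv.swap_apply_of_ne_of_ne (by simp) (by simp)]
    have c4 : ∀ j, j ≠ i₀ → j ≠ k → ∀ l, c (j, l) = (j, l) := fun j h1 h2 l => by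
      rw [hc, Equiv.Perm.mul_apply, Equiv.swap_apply_of_ne_of_ne (a := (k, 0)) (b := (k, 1))
        (by simp [h2]) (by simp [h2]), Equiv.swap_apply_of_ne_of_ne (by simp [h1])
        (by simp [h2])]
    have cs : Equiv.Perm.sign c = 1 := by
      rw [hc, Equiv.Perm.sign_mul, Equiv.Perm.sign_swap (by simp [hk.symm]),
        Equiv.Perm.sign_swap (by simp)]; simp
    refine sum_perm_eq_zero_of_cyclic _ c fun σ => ?_
    have hprod : ∀ τ : Equiv.Perm (Fin d × Fin 2), (∏ j ∈ ({i₀}ᶜ : Finset (Fin d)).erase k,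
            pairing (K p) (b ((τ * c) (j, 0))) (b ((τ * c) (j, 1)))) =
        ∏ j ∈ ({i₀}ᶜ : Finset (Fin d)).erase k,
            pairing (K p) (b (τ (j, 0))) (b (τ (j, 1))) := fun τ => by
      refine Finset.prod_congr rfl fun j hj => ?_
      simp only [Finset.mem_erase, Finset.mem_compl, Finset.mem_singleton] at hj
      change pairing (K p) (b (τ (c (j, 0)))) (b (τ (c (j, 1)))) = _
      rw [c4 j hj.2 hj.1, c4 j hj.2 hj.1]
    simp only [hprod]
    simp only [Equiv.Perm.mul_apply, c0, c1, c2, c3, Equiv.Perm.sign_mul, cs, mul_one]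
    have := closed_cyclic hK hcl (b (σ (i₀, 0))) (b (σ (k, 0))) (b (σ (k, 1)))
    linear_combination ((Equiv.Perm.sign σ : ℤ) : ℝ) * (ζ p (b (σ (i₀, 1)))) *
      (∏ j ∈ ({i₀}ᶜ : Finset (Fin d)).erase k,
            pairing (K p) (b (σ (j, 0))) (b (σ (j, 1)))) * this
  rw [hzero, mul_zero, add_zero]
  set s : Equiv.Perm (Fin d × Fin 2) := Equiv.swap (i₀, 0) (i₀, 1) with hs
  have hsub := Equiv.sum_comp (Equiv.mulRight s) fun σ : Equiv.Perm (Fin d × Fin 2) =>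
    ((Equiv.Perm.sign σ : ℤ) : ℝ) * (fderiv ℝ ζ p (b (σ (i₀, 0))) (b (σ (i₀, 1))) *
      (∏ j ∈ ({i₀}ᶜ : Finset (Fin d)), pairing (K p) (b (σ (j, 0))) (b (σ (j, 1)))))
  have hprod : ∀ τ : Equiv.Perm (Fin d × Fin 2), (∏ j ∈ ({i₀}ᶜ : Finset (Fin d)),
            pairing (K p) (b ((τ * s) (j, 0))) (b ((τ * s) (j, 1)))) =
        ∏ j ∈ ({i₀}ᶜ : Finset (Fin d)),
            pairing (K p) (b (τ (j, 0))) (b (τ (j, 1))) := fun τ => by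
    refine Finset.prod_congr rfl fun j hj => ?_
    have hj : j ≠ i₀ := by simpa using hj
    rw [Equiv.Perm.mul_apply, Equiv.Perm.mul_apply, hs,
      Equiv.swap_apply_of_ne_of_ne (by simp [hj]) (by simp [hj]),
      Equiv.swap_apply_of_ne_of_ne (by simp [hj]) (by simp [hj])]
  simp only [Equiv.coe_mulRight, hprod] at hsub
  simp only [Equiv.Perm.mul_apply, hs, Equiv.swap_apply_left, Equiv.swap_apply_right,
    Equiv.Perm.sign_mul, Equiv.Perm.sign_swap (show ((i₀, 0) : Fin d × Fin 2) ≠ (i₀, 1) by simp)]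
    at hsub
  rw [two_mul]
  nth_rewrite 2 [← hsub]
  rw [← Finset.sum_add_distrib]
  refine Finset.sum_congr rfl fun σ _ => ?_
  simp [extD]
  ring

theorem extD_eq_zero_of_notMem_tsupport {ζ : Vec d → Vec d →L[ℝ] ℝ} {y : Vec d}
    (hy : y ∉ tsupport ζ) : extD ζ y = 0 := by
  funext v w
  have : ζ =ᶠ[𝓝 y] fun _ => 0 := notMem_tsupport_iff_eventuallyEq.1 hy
  rw [extD_congr this]; simp [extD]

theorem topCoeff_zero (hd : 0 < d) (K : Vec d → Vec d → ℝ) : topCoeff K 0 = 0 := by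
  have := topCoeff_smul hd K 0 0
  rw [zero_mul] at this
  rw [← this]; congr 1; funext v w; simp

/-- Stokes' theorem for `d(ζ ∧ K^{d-1})`, where `K` is closed and `ζ` has compact support. -/
theorem integral_topCoeff_extD (hd : 0 < d) {K : Vec d → (Vec d) [⋀^Fin 2]→L[ℝ] ℝ}
    {V : Set (Vec d)} (hV : IsOpen V) (hK : ContDiffOn ℝ ∞ K V)
    (hcl : ∀ y ∈ V, extDeriv K y = 0) {ζ : Vec d → Vec d →L[ℝ] ℝ} (hζ : ContDiff ℝ 1 ζ)
    (hc : HasCompactSupport ζ) (hsupp : tsupport ζ ⊆ V) :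
    ∫ y, topCoeff (pairing (K y)) (extD ζ y) = 0 := by
  have hKat : ∀ y ∈ V, ContDiffAt ℝ 1 K y := fun y hy =>
    ((hK y hy).contDiffAt (hV.mem_nhds hy)).of_le (by norm_cast)
  let g : Equiv.Perm (Fin d × Fin 2) → Vec d → ℝ := fun σ q =>
    ζ q (orientedBasis d (σ (⟨0, hd⟩, 1))) * ∏ j ∈ ({⟨0, hd⟩}ᶜ : Finset (Fin d)),
            pairing (K q) (orientedBasis d (σ (j, 0))) (orientedBasis d (σ (j, 1)))
  have hgs : ∀ σ, tsupport (g σ) ⊆ tsupport ζ := fun σ => by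
    refine closure_mono fun y hy => ?_
    rw [Function.mem_support] at hy ⊢
    intro h
    exact hy (by simp [g, h])
  have hgc : ∀ σ, HasCompactSupport (g σ) := fun σ =>
    hc.of_isClosed_subset (isClosed_tsupport _) (hgs σ)
  have hgd : ∀ σ, ContDiff ℝ 1 (g σ) := fun σ => contDiff_of_forall_tsupport fun y hy => by
    have hyV := hKat y (hsupp (hgs σ hy))
    exact (hζ.contDiffAt.clm_apply contDiffAt_const).mul
      (contDiffAt_prod fun j _ => contDiffAt_pairing hyV _ _)
  have hpt : ∀ y, topCoeff (pairing (K y)) (extD ζ y) = ((2 : ℝ) ^ d)⁻¹ *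
      (2 * ∑ σ : Equiv.Perm (Fin d × Fin 2), ((Equiv.Perm.sign σ : ℤ) : ℝ) *
        fderiv ℝ (g σ) y (orientedBasis d (σ (⟨0, hd⟩, 0)))) := by
    intro y
    by_cases hy : y ∈ tsupport ζ
    · exact topCoeff_extD_eq_sum_fderiv hd ((hKat y (hsupp hy)).differentiableAt (by norm_num))
        (hcl y (hsupp hy)) (hζ.differentiable (by norm_num) y)
    · rw [extD_eq_zero_of_notMem_tsupport hy, topCoeff_zero hd]
      have : ∀ σ, fderiv ℝ (g σ) y = 0 := fun σ => by
        have := notMem_tsupport_iff_eventuallyEq.1 (fun h => hy (hgs σ h))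
        rw [this.fderiv_eq]; simp
      simp [this]
  simp only [hpt]
  rw [integral_const_mul, integral_const_mul, integral_finsetSum]
  · simp only [integral_const_mul, integral_fderiv_eq_zero (hgd _) (hgc _)]
    simp
  · intro σ _
    exact (((hgd σ).continuous_fderiv_apply (by norm_num) |>.comp
      (continuous_id.prodMk continuous_const)).integrable_of_hasCompactSupport
      ((hgc σ).fderiv_apply ℝ _)).const_mul _

end Stokes

section ChartChange

open Filter Topology MeasureTheory

variable {d : ℕ} {X : Type u} [TopologicalSpace X] [ChartedSpace (Vec d) X]

theorem contDiffAt_transition [IsManifold 𝓘(ℂ, Vec d) ω X] {e e' : OpenPartialHomeomorph X (Vec d)}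
    (he : e ∈ atlas (Vec d) X) (he' : e' ∈ atlas (Vec d) X) {y : Vec d} (hy : y ∈ e.target)
    (hy' : e.symm y ∈ e'.source) : ContDiffAt ℂ ω (fun z => e' (e.symm z)) y := by
  have h := (contDiffGroupoid ω 𝓘(ℂ, Vec d)).compatible he he'
  rw [contDiffGroupoid, mem_groupoid_of_pregroupoid] at h
  have h1 := h.1
  simp only [contDiffPregroupoid, modelWithCornersSelf_coe,
    modelWithCornersSelf_coe_symm, Set.range_id, Set.inter_univ, Set.preimage_id,
    Function.comp_id, Function.id_comp] at h1
  have hmem : y ∈ (e.symm ≫ₕ e').source := by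
    simp [hy, hy']
  exact (h1 y hmem).contDiffAt ((e.symm ≫ₕ e').open_source.mem_nhds hmem)

theorem det_fderiv_transition [IsManifold 𝓘(ℂ, Vec d) ω X]
    {e e' : OpenPartialHomeomorph X (Vec d)}
    (he : e ∈ atlas (Vec d) X) (he' : e' ∈ atlas (Vec d) X) {y : Vec d} (hy : y ∈ e.target)
    (hy' : e.symm y ∈ e'.source) :
    fderiv ℝ (fun z => e' (e.symm z)) y =
      (fderiv ℂ (fun z => e' (e.symm z)) y).restrictScalars ℝ :=
  ((contDiffAt_transition he he' hy hy').differentiableAt (by simp)).fderiv_restrictScalars ℝ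

theorem integral_chart_change [IsManifold 𝓘(ℂ, Vec d) ω X]
    {e e' : OpenPartialHomeomorph X (Vec d)}
    (he : e ∈ atlas (Vec d) X) (he' : e' ∈ atlas (Vec d) X) (δ δ' : Vec d → ℝ)
    (hδ : ∀ y ∈ e.target, e.symm y ∉ e'.source → δ y = 0)
    (hδ' : ∀ y ∈ e'.target, e'.symm y ∉ e.source → δ' y = 0)
    (h : ∀ y ∈ e.target, e.symm y ∈ e'.source →
      δ y = LinearMap.det ((fderiv ℂ (fun z => e' (e.symm z)) y).toLinearMap.restrictScalars ℝ) *
        δ' (e' (e.symm y))) :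
    ∫ y in e.target, δ y = ∫ y in e'.target, δ' y := by
  set T := e.symm ≫ₕ e' with hT
  have hTs : ∀ y, y ∈ T.source ↔ y ∈ e.target ∧ e.symm y ∈ e'.source := fun y => by simp [hT]
  have hTt : ∀ y, y ∈ T.target ↔ y ∈ e'.target ∧ e'.symm y ∈ e.source := fun y => by simp [hT]
  have h1 : ∫ y in e.target, δ y = ∫ y in T.source, δ y := by
    refine setIntegral_eq_of_subset_of_forall_sdiff_eq_zero e.open_target.measurableSet
      (fun y hy => ((hTs y).1 hy).1) fun y hy => hδ y hy.1 fun h2 => hy.2 ((hTs y).2 ⟨hy.1, h2⟩)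
  have h2 : ∫ y in e'.target, δ' y = ∫ y in T.target, δ' y := by
    refine setIntegral_eq_of_subset_of_forall_sdiff_eq_zero e'.open_target.measurableSet
      (fun y hy => ((hTt y).1 hy).1) fun y hy => hδ' y hy.1 fun h2 => hy.2 ((hTt y).2 ⟨hy.1, h2⟩)
  rw [h1, h2, integral_target_eq_integral_abs_det_fderiv_smul volume (f := T) (f' := fun y =>
    (fderiv ℂ (fun z => e' (e.symm z)) y).restrictScalars ℝ)]
  · refine setIntegral_congr_fun T.open_source.measurableSet fun y hy => ?_
    obtain ⟨hy1, hy2⟩ := (hTs y).1 hy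
    rw [h y hy1 hy2, smul_eq_mul]
    congr 1
    rw [ContinuousLinearMap.det]
    refine (abs_of_nonneg ?_).symm
    have := det_restrictScalars_eq (fderiv ℂ (fun z => e' (e.symm z)) y).toLinearMap
    exact this.symm ▸ Complex.normSq_nonneg _
  · intro y hy
    obtain ⟨hy1, hy2⟩ := (hTs y).1 hy
    exact ((contDiffAt_transition he he' hy1 hy2).differentiableAt
      (by simp)).hasFDerivAt.restrictScalars ℝ

end ChartChange

/-! ### Partitions of unity and global integrals -/

section Global

open Filter Topology MeasureTheory

variable {d : ℕ} {X : Type u} [TopologicalSpace X] [ChartedSpace (Vec d) X]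

theorem isManifold_real [IsManifold 𝓘(ℂ, Vec d) ω X] : IsManifold 𝓘(ℝ, Vec d) ∞ X := by
  refine isManifold_of_contDiffOn 𝓘(ℝ, Vec d) ∞ X fun e e' he he' => ?_
  intro y hy
  have hy' : y ∈ e.target ∧ e.symm y ∈ e'.source := by
    have h := hy.1
    rw [Set.mem_preimage, OpenPartialHomeomorph.trans_source] at h
    exact h
  have := ((contDiffAt_transition he he' hy'.1 hy'.2).restrict_scalars ℝ).of_le
    (m := ∞) le_top
  exact this.contDiffWithinAt

/-- A finite smooth partition of unity subordinate to an open cover. -/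
structure FinitePartition (d : ℕ) {X : Type u} [TopologicalSpace X] [ChartedSpace (Vec d) X]
    (W : X → Set X) where
  t : Finset X
  ψ : X → X → ℝ
  continuous : ∀ x, Continuous (ψ x)
  nonneg : ∀ x q, 0 ≤ ψ x q
  sum_eq_one : ∀ q, ∑ x ∈ t, ψ x q = 1
  tsupport_subset : ∀ x ∈ t, tsupport (ψ x) ⊆ W x
  smooth : ∀ x, ∀ e ∈ atlas (Vec d) X, ∀ y ∈ e.target,
    ContDiffAt ℝ ∞ (fun z => ψ x (e.symm z)) y

theorem exists_finitePartition [T2Space X] [CompactSpace X] [IsManifold 𝓘(ℂ, Vec d) ω X]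
    (W : X → Set X) (hW : ∀ x, IsOpen (W x)) (hmem : ∀ x, x ∈ W x) :
    Nonempty (FinitePartition d W) := by
  have : IsManifold 𝓘(ℝ, Vec d) ∞ X := isManifold_real
  obtain ⟨t, ht⟩ := isCompact_univ.elim_finite_subcover W hW
    (fun x _ => Set.mem_iUnion.2 ⟨x, hmem x⟩)
  obtain ⟨φ, hφ⟩ := SmoothPartitionOfUnity.exists_isSubordinate 𝓘(ℝ, Vec d) (s := Set.univ)
    isClosed_univ (fun x : t => W x) (fun x => hW x) (fun q _ => by
      have := ht (Set.mem_univ q)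
      simpa using this)
  classical
  refine ⟨⟨t, fun x q => if hx : x ∈ t then φ ⟨x, hx⟩ q else 0, ?_, ?_, ?_, ?_, ?_⟩⟩
  · intro x
    by_cases hx : x ∈ t
    · simp only [hx, dif_pos]; exact (φ ⟨x, hx⟩).contMDiff.continuous
    · simp only [hx, dif_neg, not_false_eq_true]; exact continuous_const
  · intro x q
    by_cases hx : x ∈ t
    · simp only [hx, dif_pos]; exact φ.nonneg _ _
    · simp [hx]
  · intro q
    rw [← Finset.sum_attach]
    have h1 := φ.sum_eq_one (Set.mem_univ q)
    rw [finsum_eq_sum_of_fintype] at h1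
    rw [← h1]
    simp only [Finset.coe_mem, dif_pos, Finset.univ_eq_attach]
  · intro x hx
    have := hφ ⟨x, hx⟩
    simp only [hx, dif_pos]
    exact this
  · intro x e he y hy
    by_cases hx : x ∈ t
    · simp only [hx, dif_pos]
      have h1 : ContMDiffOn 𝓘(ℝ, Vec d) 𝓘(ℝ, Vec d) ∞ e.symm e.target :=
        contMDiffOn_symm_of_mem_maximalAtlas (IsManifold.subset_maximalAtlas he)
      have h2 := ((φ ⟨x, hx⟩).contMDiff.comp_contMDiffOn h1).contMDiffAt (e.open_target.mem_nhds hy)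
      exact h2.contDiffAt
    · simp only [hx, dif_neg, not_false_eq_true]; exact contDiffAt_const

section Hat

variable {e : OpenPartialHomeomorph X (Vec d)} {g : X → ℝ}

theorem isCompact_image_tsupport [CompactSpace X] (hg : tsupport g ⊆ e.source) :
    IsCompact (e '' tsupport g) :=
  (isClosed_tsupport g).isCompact.image_of_continuousOn (e.continuousOn.mono hg)

theorem tsupport_hat_subset [CompactSpace X] {F : Type*} [Zero F] (hg : tsupport g ⊆ e.source)
    (T : Vec d → F) (hT : ∀ y ∈ e.target, g (e.symm y) = 0 → T y = 0) :
    tsupport (e.target.indicator T) ⊆ e '' tsupport g := by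
  refine closure_minimal (fun y hy => ?_) (isCompact_image_tsupport hg).isClosed
  have hy1 : y ∈ e.target := by
    by_contra h
    exact hy (Set.indicator_of_notMem h _)
  refine ⟨e.symm y, subset_tsupport _ fun h => hy ?_, e.right_inv hy1⟩
  rw [Set.indicator_of_mem hy1, hT y hy1 h]

theorem hasCompactSupport_hat [CompactSpace X] {F : Type*} [Zero F] (hg : tsupport g ⊆ e.source)
    (T : Vec d → F) (hT : ∀ y ∈ e.target, g (e.symm y) = 0 → T y = 0) :
    HasCompactSupport (e.target.indicator T) :=
  (isCompact_image_tsupport hg).of_isClosed_subset (isClosed_tsupport _)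
    (tsupport_hat_subset hg T hT)

theorem indicator_target_eventuallyEq {F : Type*} [Zero F] (T : Vec d → F) {y : Vec d}
    (hy : y ∈ e.target) : e.target.indicator T =ᶠ[𝓝 y] T := by
  filter_upwards [e.open_target.mem_nhds hy] with z hz
  exact Set.indicator_of_mem hz _

theorem continuous_hat [CompactSpace X] (hg : tsupport g ⊆ e.source) (T : Vec d → ℝ)
    (hT : ∀ y ∈ e.target, g (e.symm y) = 0 → T y = 0)
    (hc : ∀ y ∈ e.target, e.symm y ∈ tsupport g → ContinuousAt T y) :
    Continuous (e.target.indicator T) := by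
  rw [continuous_iff_continuousAt]
  intro y
  by_cases hy : y ∈ tsupport (e.target.indicator T)
  · obtain ⟨q, hq, rfl⟩ := tsupport_hat_subset hg T hT hy
    refine (hc _ (e.map_source (hg hq)) ?_).congr
      (indicator_target_eventuallyEq T (e.map_source (hg hq))).symm
    rwa [e.left_inv (hg hq)]
  · exact continuousAt_const.congr (notMem_tsupport_iff_eventuallyEq.1 hy).symm

theorem integrableOn_hat [CompactSpace X] (hg : tsupport g ⊆ e.source) (T : Vec d → ℝ)
    (hT : ∀ y ∈ e.target, g (e.symm y) = 0 → T y = 0)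
    (hc : ∀ y ∈ e.target, e.symm y ∈ tsupport g → ContinuousAt T y) :
    IntegrableOn T e.target := by
  rw [← integrable_indicator_iff e.open_target.measurableSet]
  exact (continuous_hat hg T hT hc).integrable_of_hasCompactSupport
    (hasCompactSupport_hat hg T hT)

end Hat

theorem continuousAt_topCoeff {Y : Type*} [TopologicalSpace Y] {K α : Y → Vec d → Vec d → ℝ}
    {y : Y} (hK : ∀ v w, ContinuousAt (fun z => K z v w) y)
    (hα : ∀ v w, ContinuousAt (fun z => α z v w) y) :
    ContinuousAt (fun z => topCoeff (K z) (α z)) y := by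
  unfold topCoeff wedgeTwoForms
  refine continuousAt_const.mul (tendsto_finsetSum _ fun σ _ => continuousAt_const.mul
    (tendsto_finsetProd _ fun j _ => ?_))
  by_cases hj : (j : ℕ) = 0
  · simp only [hj, if_true]; exact hα _ _
  · simp only [hj, if_false]; exact hK _ _

theorem update_fst (x y z : Vec d) : Function.update ![x, z] 0 y = ![y, z] := by
  ext i; fin_cases i <;> simp

theorem update_snd (x y z : Vec d) : Function.update ![z, x] 1 y = ![z, y] := by
  ext i; fin_cases i <;> simp

/-- A two-form at a point, as a bilinear form. -/
def pairingForm (α : (Vec d) [⋀^Fin 2]→L[ℝ] ℝ) : Vec d →ₗ[ℝ] Vec d →ₗ[ℝ] ℝ :=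
  LinearMap.mk₂ ℝ (pairing α)
    (fun x y z => by
      have := α.toAlternatingMap.map_update_add ![0, z] 0 x y
      rwa [update_fst, update_fst, update_fst] at this)
    (fun c x z => by
      have := α.toAlternatingMap.map_update_smul ![0, z] 0 c x
      rwa [update_fst, update_fst] at this)
    (fun z x y => by
      have := α.toAlternatingMap.map_update_add ![z, 0] 1 x y
      rwa [update_snd, update_snd, update_snd] at this)
    (fun c z x => by
      have := α.toAlternatingMap.map_update_smul ![z, 0] 1 c x
      rwa [update_snd, update_snd] at this)

/-- The wedge product of two real covectors. -/
def wedgeForm (ξ η : Vec d →L[ℝ] ℝ) : Vec d →ₗ[ℝ] Vec d →ₗ[ℝ] ℝ :=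
  LinearMap.mk₂ ℝ (fun v w => ξ v * η w - ξ w * η v) (fun _ _ _ => by simp; ring)
    (fun _ _ _ => by simp; ring) (fun _ _ _ => by simp; ring) (fun _ _ _ => by simp; ring)

@[simp] theorem wedgeForm_apply (ξ η : Vec d →L[ℝ] ℝ) (v w : Vec d) :
    wedgeForm ξ η v w = ξ v * η w - ξ w * η v := rfl

theorem KahlerForm.pairing_transition [IsManifold 𝓘(ℂ, Vec d) ω X] (κ : KahlerForm d X)
    {e e' : OpenPartialHomeomorph X (Vec d)}
    (he : e ∈ atlas (Vec d) X) (he' : e' ∈ atlas (Vec d) X) {y : Vec d} (hy : y ∈ e.target)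
    (hy' : e.symm y ∈ e'.source) (v w : Vec d) :
    pairing (κ.form e y) v w = pairing (κ.form e' (e' (e.symm y)))
      (fderiv ℂ (fun z => e' (e.symm z)) y v) (fderiv ℂ (fun z => e' (e.symm z)) y w) := by
  rw [pairing, κ.compatible e he e' he' y hy hy', det_fderiv_transition he he' hy hy']
  simp only [ContinuousAlternatingMap.compContinuousLinearMap_apply, pairing]
  congr 1
  ext i; fin_cases i <;> rfl

theorem topCoeff_transition [IsManifold 𝓘(ℂ, Vec d) ω X] (κ : KahlerForm d X)
    {e e' : OpenPartialHomeomorph X (Vec d)}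
    (he : e ∈ atlas (Vec d) X) (he' : e' ∈ atlas (Vec d) X) {y : Vec d} (hy : y ∈ e.target)
    (hy' : e.symm y ∈ e'.source) (α : Vec d → Vec d → ℝ) (β : Vec d →ₗ[ℝ] Vec d →ₗ[ℝ] ℝ)
    (hα : ∀ v w, α v w = β (fderiv ℂ (fun z => e' (e.symm z)) y v)
      (fderiv ℂ (fun z => e' (e.symm z)) y w)) :
    topCoeff (pairing (κ.form e y)) α =
      LinearMap.det ((fderiv ℂ (fun z => e' (e.symm z)) y).toLinearMap.restrictScalars ℝ) *
        topCoeff (pairing (κ.form e' (e' (e.symm y)))) (fun v w => β v w) := by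
  have h := topCoeff_pullback (pairingForm (κ.form e' (e' (e.symm y)))) β
    ((fderiv ℂ (fun z => e' (e.symm z)) y).toLinearMap.restrictScalars ℝ)
  have e1 : pairing (κ.form e y) = fun v w => pairingForm (κ.form e' (e' (e.symm y)))
      (fderiv ℂ (fun z => e' (e.symm z)) y v) (fderiv ℂ (fun z => e' (e.symm z)) y w) := by
    funext v w; exact κ.pairing_transition he he' hy hy' v w
  have e2 : α = fun v w => β (fderiv ℂ (fun z => e' (e.symm z)) y v)
      (fderiv ℂ (fun z => e' (e.symm z)) y w) := by funext v w; exact hα v w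
  rw [e1, e2]
  exact h

theorem KahlerForm.continuousAt_pairing (κ : KahlerForm d X) {e : OpenPartialHomeomorph X (Vec d)}
    (he : e ∈ atlas (Vec d) X) {y : Vec d} (hy : y ∈ e.target) (v w : Vec d) :
    ContinuousAt (fun z => pairing (κ.form e z) v w) y :=
  (contDiffAt_pairing ((κ.smooth e he y hy).contDiffAt (e.open_target.mem_nhds hy)) v w).continuousAt

theorem KahlerForm.pairing_I (κ : KahlerForm d X) {e : OpenPartialHomeomorph X (Vec d)}
    (he : e ∈ atlas (Vec d) X) {y : Vec d} (hy : y ∈ e.target) (v w : Vec d) :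
    pairing (κ.form e y) (Complex.I • v) (Complex.I • w) = pairing (κ.form e y) v w :=
  κ.type_one_one e he y hy v w

/-- The integral of a density computed with a smooth partition of unity. -/
theorem integralTopForm_eq_sum [T2Space X] [CompactSpace X] [IsManifold 𝓘(ℂ, Vec d) ω X]
    {W : X → Set X} (hW : ∀ x, W x ⊆ (chartAt (Vec d) x).source)
    (P : FinitePartition d W) (τ : OpenPartialHomeomorph X (Vec d) → Vec d → ℝ)
    (hτc : ∀ e ∈ atlas (Vec d) X, ∀ y ∈ e.target, ContinuousAt (τ e) y)
    (hτ : ∀ e ∈ atlas (Vec d) X, ∀ e' ∈ atlas (Vec d) X, ∀ y ∈ e.target, e.symm y ∈ e'.source →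
      τ e y = LinearMap.det ((fderiv ℂ (fun z => e' (e.symm z)) y).toLinearMap.restrictScalars ℝ) *
        τ e' (e' (e.symm y))) :
    integralTopForm τ = ∑ i ∈ P.t, ∫ y in (chartAt (Vec d) i).target,
      P.ψ i ((chartAt (Vec d) i).symm y) * τ (chartAt (Vec d) i) y := by
  classical
  set ρ := chartPartition d X
  have hρ : ∀ x, tsupport (ρ x) ⊆ (chartAt (Vec d) x).source :=
    (exists_chartPartition d X).choose_spec
  have hfin : {x | ρ x ≠ 0}.Finite := by
    have h1 : LocallyFinite fun x => Function.support (ρ x) := ρ.locallyFinite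
    refine (h1.finite_nonempty_of_compact).subset fun x hx => ?_
    by_contra h
    rw [Set.mem_ofPred_eq, Set.not_nonempty_iff_eq_empty, Function.support_eq_empty_iff] at h
    exact hx (by ext q; exact congrFun h q)
  set S := hfin.toFinset
  have hsumρ : ∀ q, ∑ x ∈ S, ρ x q = 1 := by
    intro q
    rw [← ρ.sum_eq_one (Set.mem_univ q)]
    symm
    refine finsum_eq_sum_of_support_subset _ fun x hx => ?_
    simp only [S, Set.Finite.coe_toFinset, Set.mem_ofPred_eq]
    intro h0
    exact hx (by simp [h0])
  have h1 : integralTopForm τ = ∑ x ∈ S, ∫ y in (chartAt (Vec d) x).target,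
      ρ x ((chartAt (Vec d) x).symm y) * τ (chartAt (Vec d) x) y := by
    refine finsum_eq_sum_of_support_subset _ fun x hx => ?_
    simp only [S, Set.Finite.coe_toFinset, Set.mem_ofPred_eq]
    intro h0
    refine hx ?_
    have : ∀ q, chartPartition d X x q = 0 := fun q => by
      change ρ x q = 0
      rw [h0]; rfl
    simp [this]
  have hsymm : ∀ x : X, ∀ y ∈ (chartAt (Vec d) x).target, ∀ g : X → ℝ, Continuous g →
      ContinuousAt (fun z => g ((chartAt (Vec d) x).symm z)) y := fun x y hy g hg =>
    hg.continuousAt.comp ((chartAt (Vec d) x).continuousAt_symm hy)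
  have hprod : ∀ (x : X) (g g' : X → ℝ), Continuous g → Continuous g' →
      tsupport g ⊆ (chartAt (Vec d) x).source →
      IntegrableOn (fun y => g ((chartAt (Vec d) x).symm y) *
        (g' ((chartAt (Vec d) x).symm y) * τ (chartAt (Vec d) x) y)) (chartAt (Vec d) x).target := by
    intro x g g' hg hg' hs
    refine integrableOn_hat hs _ (fun y _ h => by simp [h]) fun y hy _ => ?_
    exact (hsymm x y hy g hg).mul ((hsymm x y hy g' hg').mul
      (hτc _ (chart_mem_atlas (Vec d) x) y hy))
  have h2 : ∀ x ∈ S, ∫ y in (chartAt (Vec d) x).target,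
      ρ x ((chartAt (Vec d) x).symm y) * τ (chartAt (Vec d) x) y =
      ∑ i ∈ P.t, ∫ y in (chartAt (Vec d) x).target, ρ x ((chartAt (Vec d) x).symm y) *
        (P.ψ i ((chartAt (Vec d) x).symm y) * τ (chartAt (Vec d) x) y) := by
    intro x _
    rw [← integral_finsetSum]
    · congr 1
      funext y
      rw [← Finset.mul_sum, ← Finset.sum_mul, P.sum_eq_one, one_mul]
    · intro i _
      exact hprod x (ρ x) (P.ψ i) (ρ x).continuous (P.continuous i) (hρ x)
  have h3 : ∀ i ∈ P.t, ∫ y in (chartAt (Vec d) i).target,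
      P.ψ i ((chartAt (Vec d) i).symm y) * τ (chartAt (Vec d) i) y =
      ∑ x ∈ S, ∫ y in (chartAt (Vec d) i).target, P.ψ i ((chartAt (Vec d) i).symm y) *
        (ρ x ((chartAt (Vec d) i).symm y) * τ (chartAt (Vec d) i) y) := by
    intro i hi
    rw [← integral_finsetSum]
    · congr 1
      funext y
      rw [← Finset.mul_sum, ← Finset.sum_mul, hsumρ, one_mul]
    · intro x _
      exact hprod i (P.ψ i) (ρ x) (P.continuous i) (ρ x).continuous
        ((P.tsupport_subset i hi).trans (hW i))
  rw [h1, Finset.sum_congr rfl h2, Finset.sum_congr rfl h3, Finset.sum_comm]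
  refine Finset.sum_congr rfl fun i hi => Finset.sum_congr rfl fun x _ => ?_
  refine integral_chart_change (chart_mem_atlas (Vec d) x) (chart_mem_atlas (Vec d) i) _ _ ?_ ?_ ?_
  · intro y _ hy'
    have : P.ψ i ((chartAt (Vec d) x).symm y) = 0 :=
      image_eq_zero_of_notMem_tsupport fun h => hy' (hW i (P.tsupport_subset i hi h))
    simp [this]
  · intro y _ hy'
    have : ρ x ((chartAt (Vec d) i).symm y) = 0 :=
      image_eq_zero_of_notMem_tsupport fun h => hy' (hρ x h)
    simp [this]
  · intro y hy hy'
    rw [hτ _ (chart_mem_atlas (Vec d) x) _ (chart_mem_atlas (Vec d) i) y hy hy',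
      (chartAt (Vec d) i).left_inv hy']
    ring

end Global

section GlobalStokes

open Filter Topology MeasureTheory

variable {d : ℕ} {X : Type u} [TopologicalSpace X] [ChartedSpace (Vec d) X]

theorem contDiffAt_extD {ζ : Vec d → Vec d →L[ℝ] ℝ} {y : Vec d} (h : ContDiffAt ℝ 2 ζ y)
    (v w : Vec d) : ContinuousAt (fun z => extD ζ z v w) y := by
  have h1 : ContinuousAt (fderiv ℝ ζ) y :=
    (h.fderiv_right (m := 1) (by norm_num)).continuousAt
  unfold extD
  exact ((h1.clm_apply continuousAt_const).clm_apply continuousAt_const).sub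
    ((h1.clm_apply continuousAt_const).clm_apply continuousAt_const)

/-- Stokes' theorem on `X` for a real one-form `Γ` given in local charts. -/
theorem sum_integral_extD_eq_zero [T2Space X] [CompactSpace X] [IsManifold 𝓘(ℂ, Vec d) ω X]
    (hd : 0 < d) (κ : KahlerForm d X) {W : X → Set X}
    (hW : ∀ x, W x ⊆ (chartAt (Vec d) x).source)
    (P : FinitePartition d W) (Γ : X → Vec d → Vec d →L[ℝ] ℝ)
    (hΓs : ∀ i, ∀ y ∈ (chartAt (Vec d) i).target, (chartAt (Vec d) i).symm y ∈ W i →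
      ContDiffAt ℝ 2 (Γ i) y)
    (hΓ : ∀ i j, ∀ y ∈ (chartAt (Vec d) i).target, (chartAt (Vec d) i).symm y ∈ W i →
      (chartAt (Vec d) i).symm y ∈ W j → ∀ v, Γ i y v =
        Γ j (chartAt (Vec d) j ((chartAt (Vec d) i).symm y))
          (fderiv ℂ (fun z => chartAt (Vec d) j ((chartAt (Vec d) i).symm z)) y v)) :
    ∑ i ∈ P.t, ∫ y in (chartAt (Vec d) i).target, P.ψ i ((chartAt (Vec d) i).symm y) *
      topCoeff (pairing (κ.form (chartAt (Vec d) i) y)) (extD (Γ i) y) = 0 := by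
  classical
  have hat : ∀ i : X, chartAt (Vec d) i ∈ atlas (Vec d) X := chart_mem_atlas (Vec d)
  have hsub : ∀ i ∈ P.t, tsupport (P.ψ i) ⊆ (chartAt (Vec d) i).source := fun i hi =>
    (P.tsupport_subset i hi).trans (hW i)
  have hψs : ∀ i j : X, ∀ y ∈ (chartAt (Vec d) j).target,
      ContDiffAt ℝ 2 (fun z => P.ψ i ((chartAt (Vec d) j).symm z)) y := fun i j y hy =>
    (P.smooth i _ (hat j) y hy).of_le (by norm_cast)
  have hψ0 : ∀ i j : X, ∀ y ∈ (chartAt (Vec d) j).target,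
      (chartAt (Vec d) j).symm y ∉ tsupport (P.ψ i) →
      (fun z => P.ψ i ((chartAt (Vec d) j).symm z)) =ᶠ[𝓝 y] fun _ => 0 := fun i j y hy h =>
    ((chartAt (Vec d) j).continuousAt_symm hy).eventually
      (notMem_tsupport_iff_eventuallyEq.1 h)
  have hdψ0 : ∀ i j : X, ∀ y ∈ (chartAt (Vec d) j).target,
      (chartAt (Vec d) j).symm y ∉ tsupport (P.ψ i) →
      fderiv ℝ (fun z => P.ψ i ((chartAt (Vec d) j).symm z)) y = 0 := fun i j y hy h => by
    rw [(hψ0 i j y hy h).fderiv_eq]; simp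
  -- the integrands
  set A : X → Vec d → ℝ := fun i y => P.ψ i ((chartAt (Vec d) i).symm y) *
      topCoeff (pairing (κ.form (chartAt (Vec d) i) y)) (extD (Γ i) y) with hA
  set C : X → X → Vec d → ℝ := fun i j y =>
      topCoeff (pairing (κ.form (chartAt (Vec d) j) y)) (fun v w => wedgeForm
        (fderiv ℝ (fun z => P.ψ i ((chartAt (Vec d) j).symm z)) y) (Γ j y) v w) with hC
  have hCcont : ∀ i j : X, ∀ y ∈ (chartAt (Vec d) j).target, (chartAt (Vec d) j).symm y ∈ W j →
      ContinuousAt (C i j) y := by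
    intro i j y hy hyW
    refine continuousAt_topCoeff (fun v w => κ.continuousAt_pairing (hat j) hy v w) fun v w => ?_
    have h1 : ContinuousAt (fderiv ℝ (fun z => P.ψ i ((chartAt (Vec d) j).symm z))) y :=
      ((hψs i j y hy).fderiv_right (m := 1) (by norm_num)).continuousAt
    have h2 := (hΓs j y hy hyW).continuousAt
    simp only [wedgeForm_apply]
    exact ((h1.clm_apply continuousAt_const).mul (h2.clm_apply continuousAt_const)).sub
      ((h1.clm_apply continuousAt_const).mul (h2.clm_apply continuousAt_const))
  have hAcont : ∀ i ∈ P.t, IntegrableOn (A i) (chartAt (Vec d) i).target := fun i hi =>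
    integrableOn_hat (hsub i hi) _ (fun y _ h => by simp [hA, h]) fun y hy hyt => by
      refine (hψs i i y hy).continuousAt.mul (continuousAt_topCoeff
        (fun v w => κ.continuousAt_pairing (hat i) hy v w)
        fun v w => contDiffAt_extD (hΓs i y hy (P.tsupport_subset i hi hyt)) v w)
  have hC0 : ∀ i j : X, ∀ y ∈ (chartAt (Vec d) j).target,
      (chartAt (Vec d) j).symm y ∉ tsupport (P.ψ i) → C i j y = 0 := by
    intro i j y hy h
    have : (fun v w => wedgeForm
        (fderiv ℝ (fun z => P.ψ i ((chartAt (Vec d) j).symm z)) y) (Γ j y) v w) = 0 := by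
      funext v w; rw [wedgeForm_apply, hdψ0 i j y hy h]; simp
    simp only [hC, this]
    exact topCoeff_zero hd _
  have hψC : ∀ i ∈ P.t, ∀ j ∈ P.t, ∀ k ∈ P.t,
      IntegrableOn (fun y => P.ψ j ((chartAt (Vec d) k).symm y) * C i k y)
        (chartAt (Vec d) k).target ∨ (k ≠ i ∧ k ≠ j) := by
    intro i hi j hj k hk
    by_cases h1 : k = j
    · left
      subst h1
      exact integrableOn_hat (hsub k hk) _ (fun y _ h => by simp [h]) fun y hy hyt =>
        (hψs k k y hy).continuousAt.mul (hCcont i k y hy (P.tsupport_subset k hk hyt))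
    by_cases h2 : k = i
    · left
      subst h2
      rw [← integrable_indicator_iff (chartAt (Vec d) k).open_target.measurableSet]
      have hts : tsupport ((chartAt (Vec d) k).target.indicator
          fun y => P.ψ j ((chartAt (Vec d) k).symm y) * C k k y) ⊆
          chartAt (Vec d) k '' tsupport (P.ψ k) := by
        refine closure_minimal (fun y hy => ?_) (isCompact_image_tsupport (hsub k hk)).isClosed
        have hy1 : y ∈ (chartAt (Vec d) k).target := by
          by_contra h
          exact hy (Set.indicator_of_notMem h _)
        refine ⟨(chartAt (Vec d) k).symm y, ?_, (chartAt (Vec d) k).right_inv hy1⟩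
        by_contra h
        rw [Function.mem_support, Set.indicator_of_mem hy1, hC0 k k y hy1 h, mul_zero] at hy
        exact hy rfl
      refine Continuous.integrable_of_hasCompactSupport ?_
        ((isCompact_image_tsupport (hsub k hk)).of_isClosed_subset (isClosed_tsupport _) hts)
      rw [continuous_iff_continuousAt]
      intro y
      by_cases hy : y ∈ chartAt (Vec d) k '' tsupport (P.ψ k)
      · obtain ⟨q, hq, rfl⟩ := hy
        have hqs := (chartAt (Vec d) k).map_source (hsub k hk hq)
        refine ContinuousAt.congr ?_ (indicator_target_eventuallyEq _ hqs).symm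
        refine (hψs j k _ hqs).continuousAt.mul (hCcont k k _ hqs ?_)
        rw [(chartAt (Vec d) k).left_inv (hsub k hk hq)]
        exact P.tsupport_subset k hk hq
      · exact continuousAt_const.congr
          (notMem_tsupport_iff_eventuallyEq.1 fun h => hy (hts h)).symm
    · right; exact ⟨h2, h1⟩
  have hCint : ∀ i ∈ P.t, IntegrableOn (C i i) (chartAt (Vec d) i).target := by
    intro i hi
    have : C i i = fun y => ∑ j ∈ P.t, P.ψ j ((chartAt (Vec d) i).symm y) * C i i y := by
      funext y; rw [← Finset.sum_mul, P.sum_eq_one, one_mul]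
    rw [this]
    refine integrable_finsetSum _ fun j hj => ?_
    rcases hψC i hi j hj i hi with h | h
    · exact h
    · exact absurd rfl h.1
  -- Stokes in one chart
  have hstokes : ∀ i ∈ P.t, ∫ y in (chartAt (Vec d) i).target, A i y =
      -∫ y in (chartAt (Vec d) i).target, C i i y := by
    intro i hi
    set e := chartAt (Vec d) i
    let T : Vec d → Vec d →L[ℝ] ℝ := fun y => P.ψ i (e.symm y) • Γ i y
    have hT0 : ∀ y ∈ e.target, P.ψ i (e.symm y) = 0 → T y = 0 := fun y _ h => by simp [T, h]
    have hts := tsupport_hat_subset (hsub i hi) T hT0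
    have hz := integral_topCoeff_extD hd e.open_target (κ.smooth e (hat i)) (κ.closed e (hat i))
      (ζ := e.target.indicator T) ?_ (hasCompactSupport_hat (hsub i hi) T hT0)
      (hts.trans (by rintro _ ⟨q, hq, rfl⟩; exact e.map_source (hsub i hi hq)))
    · have hpt : ∀ y ∈ e.target,
          topCoeff (pairing (κ.form e y)) (extD (e.target.indicator T) y) = A i y + C i i y := by
        intro y hy
        have hin := indicator_target_eventuallyEq T hy
        by_cases hyt : e.symm y ∈ tsupport (P.ψ i)
        · have hyW := P.tsupport_subset i hi hyt
          rw [hA, hC]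
          simp only
          rw [← topCoeff_smul hd, ← topCoeff_add hd]
          congr 1
          funext v w
          rw [extD_congr hin, extD_smul ((hψs i i y hy).differentiableAt (by norm_num))
            ((hΓs i y hy hyW).differentiableAt (by norm_num))]
          rfl
        · rw [hC0 i i y hy hyt]
          have h1 : y ∉ tsupport (e.target.indicator T) := by
            intro h
            obtain ⟨q, hq, rfl⟩ := hts h
            rw [e.left_inv (hsub i hi hq)] at hyt
            exact hyt hq
          rw [extD_eq_zero_of_notMem_tsupport h1, topCoeff_zero hd]
          have : P.ψ i (e.symm y) = 0 := image_eq_zero_of_notMem_tsupport hyt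
          change 0 = P.ψ i (e.symm y) * _ + 0
          rw [this]; ring
      have hout : ∀ y, y ∉ e.target →
          topCoeff (pairing (κ.form e y)) (extD (e.target.indicator T) y) = 0 := by
        intro y hy
        have h1 : y ∉ tsupport (e.target.indicator T) := by
          intro h
          obtain ⟨q, hq, rfl⟩ := hts h
          exact hy (e.map_source (hsub i hi hq))
        rw [extD_eq_zero_of_notMem_tsupport h1, topCoeff_zero hd]
      rw [← setIntegral_eq_integral_of_forall_compl_eq_zero hout,
        setIntegral_congr_fun e.open_target.measurableSet hpt,
        integral_add (hAcont i hi) (hCint i hi)] at hz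
      linarith
    · refine contDiff_of_forall_tsupport fun y hy => ?_
      obtain ⟨q, hq, rfl⟩ := hts hy
      have hqs := e.map_source (hsub i hi hq)
      refine ContDiffAt.congr_of_eventuallyEq ?_ (indicator_target_eventuallyEq T hqs)
      refine ((hψs i i _ hqs).smul (hΓs i _ hqs ?_)).of_le (by norm_num)
      rw [e.left_inv (hsub i hi hq)]
      exact P.tsupport_subset i hi hq
  rw [Finset.sum_congr rfl hstokes, Finset.sum_neg_distrib, neg_eq_zero]
  have hsplit : ∀ i ∈ P.t, ∫ y in (chartAt (Vec d) i).target, C i i y =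
      ∑ j ∈ P.t, ∫ y in (chartAt (Vec d) i).target,
        P.ψ j ((chartAt (Vec d) i).symm y) * C i i y := by
    intro i hi
    rw [← integral_finsetSum]
    · congr 1; funext y; rw [← Finset.sum_mul, P.sum_eq_one, one_mul]
    · intro j hj
      rcases hψC i hi j hj i hi with h | h
      · exact h
      · exact absurd rfl h.1
  rw [Finset.sum_congr rfl hsplit]
  have hchange : ∀ i ∈ P.t, ∀ j ∈ P.t, ∫ y in (chartAt (Vec d) i).target,
        P.ψ j ((chartAt (Vec d) i).symm y) * C i i y =
      ∫ y in (chartAt (Vec d) j).target, P.ψ j ((chartAt (Vec d) j).symm y) * C i j y := by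
    intro i hi j hj
    refine integral_chart_change (hat i) (hat j) _ _ ?_ ?_ ?_
    · intro y _ hy'
      have : P.ψ j ((chartAt (Vec d) i).symm y) = 0 :=
        image_eq_zero_of_notMem_tsupport fun h => hy' (hsub j hj h)
      simp [this]
    · intro y hy hy'
      rw [hC0 i j y hy fun h => hy' (hsub i hi h), mul_zero]
    · intro y hy hy'
      rw [(chartAt (Vec d) j).left_inv hy']
      by_cases h1 : (chartAt (Vec d) i).symm y ∈ tsupport (P.ψ j)
      swap
      · rw [image_eq_zero_of_notMem_tsupport h1]; ring
      have hys : chartAt (Vec d) j ((chartAt (Vec d) i).symm y) ∈ (chartAt (Vec d) j).target :=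
        (chartAt (Vec d) j).map_source hy'
      by_cases h2 : (chartAt (Vec d) i).symm y ∈ tsupport (P.ψ i)
      swap
      · rw [hC0 i i y hy h2, hC0 i j _ hys (by rwa [(chartAt (Vec d) j).left_inv hy'])]; ring
      have hder : fderiv ℝ (fun z => P.ψ i ((chartAt (Vec d) i).symm z)) y =
          (fderiv ℝ (fun z => P.ψ i ((chartAt (Vec d) j).symm z))
            (chartAt (Vec d) j ((chartAt (Vec d) i).symm y))).comp
          ((fderiv ℂ (fun z => chartAt (Vec d) j ((chartAt (Vec d) i).symm z))
            y).restrictScalars ℝ) := by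
        have hF := ((contDiffAt_transition (hat i) (hat j) hy hy').differentiableAt
          (by simp)).hasFDerivAt.restrictScalars ℝ
        have hg := ((hψs i j _ hys).differentiableAt (by norm_num)).hasFDerivAt
        rw [← (hg.comp y hF).fderiv]
        refine Filter.EventuallyEq.fderiv_eq ?_
        have hnear : ∀ᶠ z in 𝓝 y, (chartAt (Vec d) i).symm z ∈ (chartAt (Vec d) j).source :=
          ((chartAt (Vec d) i).continuousAt_symm hy).eventually
            ((chartAt (Vec d) j).open_source.mem_nhds hy')
        filter_upwards [hnear] with z hz
        simp [(chartAt (Vec d) j).left_inv hz]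
      have := topCoeff_transition κ (hat i) (hat j) hy hy' (fun v w => wedgeForm
        (fderiv ℝ (fun z => P.ψ i ((chartAt (Vec d) i).symm z)) y) (Γ i y) v w)
        (wedgeForm (fderiv ℝ (fun z => P.ψ i ((chartAt (Vec d) j).symm z))
          (chartAt (Vec d) j ((chartAt (Vec d) i).symm y)))
          (Γ j (chartAt (Vec d) j ((chartAt (Vec d) i).symm y)))) (fun v w => by
          have hW1 := P.tsupport_subset i hi h2
          have hW2 := P.tsupport_subset j hj h1
          simp only [wedgeForm_apply]
          rw [hder, hΓ i j y hy hW1 hW2, hΓ i j y hy hW1 hW2]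
          rfl)
      simp only [hC]
      rw [this]; ring
  rw [Finset.sum_congr rfl fun i hi => Finset.sum_congr rfl fun j hj => hchange i hi j hj,
    Finset.sum_comm]
  refine Finset.sum_eq_zero fun j hj => ?_
  rw [← integral_finsetSum]
  · refine setIntegral_eq_zero_of_forall_eq_zero fun y hy => ?_
    rw [← Finset.mul_sum]
    simp only [hC]
    rw [← topCoeff_sum hd]
    have hz : (fun v w => ∑ i ∈ P.t, wedgeForm
        (fderiv ℝ (fun z => P.ψ i ((chartAt (Vec d) j).symm z)) y) (Γ j y) v w) = 0 := by
      have hs : ∑ i ∈ P.t, fderiv ℝ (fun z => P.ψ i ((chartAt (Vec d) j).symm z)) y = 0 := by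
        rw [← fderiv_fun_sum fun i _ => (hψs i j y hy).differentiableAt (by norm_num)]
        simp [P.sum_eq_one]
      have hs' : ∀ v, ∑ i ∈ P.t, fderiv ℝ (fun z => P.ψ i ((chartAt (Vec d) j).symm z)) y v = 0 :=
        fun v => by
          have := congrArg (fun L : Vec d →L[ℝ] ℝ => L v) hs
          simpa using this
      funext v w
      simp only [wedgeForm_apply, Finset.sum_sub_distrib, ← Finset.sum_mul, hs']
      simp
    rw [hz, topCoeff_zero hd, mul_zero]
  · intro i hi
    rcases hψC i hi j hj j hj with h | h
    · exact h
    · exact absurd rfl h.2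

end GlobalStokes

section Frames

open Filter Topology MeasureTheory

variable {d : ℕ} {X : Type u} [TopologicalSpace X] [ChartedSpace (Vec d) X]

theorem contDiffAt_matrix_det {𝕜 E R : Type*} [NontriviallyNormedField 𝕜] [NormedAddCommGroup E]
    [NormedSpace 𝕜 E] [NormedCommRing R] [NormedAlgebra 𝕜 R] {n : WithTop ℕ∞}
    {A : E → Matrix (Fin d) (Fin d) R} {y : E}
    (hA : ∀ i j, ContDiffAt 𝕜 n (fun z => A z i j) y) : ContDiffAt 𝕜 n (fun z => (A z).det) y := by
  simp only [Matrix.det_apply, Units.smul_def, zsmul_eq_mul]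
  exact ContDiffAt.sum fun σ _ => contDiffAt_const.mul (contDiffAt_prod fun i _ => hA _ _)

/-- The complex Jacobian determinant. -/
def jac (F : Vec d → Vec d) (y : Vec d) : ℂ := LinearMap.det (fderiv ℂ F y).toLinearMap

theorem contDiffAt_jac {F : Vec d → Vec d} {y : Vec d} (hF : ContDiffAt ℂ ω F y) :
    ContDiffAt ℂ ω (jac F) y := by
  have : jac F = fun z => (LinearMap.toMatrix' (fderiv ℂ F z).toLinearMap).det := by
    funext z; rw [LinearMap.det_toMatrix']; rfl
  rw [this]
  refine contDiffAt_matrix_det fun i j => ?_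
  have h1 : ContDiffAt ℂ ω (fderiv ℂ F) y := hF.fderiv_right (by simp)
  have h2 : ContDiffAt ℂ ω (fun z => fderiv ℂ F z (Pi.single j 1)) y :=
    h1.clm_apply contDiffAt_const
  have h3 := contDiffAt_pi.1 h2 i
  refine h3.congr_of_eventuallyEq (Eventually.of_forall fun z => ?_)
  simp [LinearMap.toMatrix'_apply]

/-- The determinant of the Gram matrix of `Ω¹_X` in a chart. -/
def gramDet (h : CotangentHermitianMetric d X) (e : OpenPartialHomeomorph X (Vec d))
    (y : Vec d) : ℝ := (h.gram e y).det.re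

theorem gramDet_pos (h : CotangentHermitianMetric d X) {e : OpenPartialHomeomorph X (Vec d)}
    (he : e ∈ atlas (Vec d) X) {y : Vec d} (hy : y ∈ e.target) : 0 < gramDet h e y :=
  (Complex.pos_iff.1 (h.posDef e he y hy).det_pos).1

theorem gramDet_ofReal (h : CotangentHermitianMetric d X) {e : OpenPartialHomeomorph X (Vec d)}
    (he : e ∈ atlas (Vec d) X) {y : Vec d} (hy : y ∈ e.target) :
    (h.gram e y).det = gramDet h e y :=
  Complex.ext rfl (Complex.pos_iff.1 (h.posDef e he y hy).det_pos).2.symm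

theorem contDiffAt_gramDet (h : CotangentHermitianMetric d X)
    {e : OpenPartialHomeomorph X (Vec d)}
    (he : e ∈ atlas (Vec d) X) {y : Vec d} (hy : y ∈ e.target) :
    ContDiffAt ℝ ∞ (gramDet h e) y := by
  have h1 : ContDiffAt ℝ ∞ (fun z => (h.gram e z).det) y := contDiffAt_matrix_det fun i j =>
    (h.smooth e he i j y hy).contDiffAt (e.open_target.mem_nhds hy)
  exact Complex.reCLM.contDiff.contDiffAt.comp y h1

theorem gramDet_transition (h : CotangentHermitianMetric d X)
    {e e' : OpenPartialHomeomorph X (Vec d)}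
    (he : e ∈ atlas (Vec d) X) (he' : e' ∈ atlas (Vec d) X) {y : Vec d} (hy : y ∈ e.target)
    (hy' : e.symm y ∈ e'.source) :
    gramDet h e' (e' (e.symm y)) =
      Complex.normSq (jac (fun z => e' (e.symm z)) y) * gramDet h e y := by
  have h1 := congrArg Matrix.det (h.compatible e he e' he' y hy hy')
  rw [Matrix.det_mul, Matrix.det_mul, Matrix.det_conjTranspose, LinearMap.det_toMatrix',
    gramDet_ofReal h he hy, gramDet_ofReal h he' (e'.map_source hy')] at h1
  have h2 : (gramDet h e' (e' (e.symm y)) : ℂ) =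
      (Complex.normSq (jac (fun z => e' (e.symm z)) y) : ℂ) * gramDet h e y := by
    rw [h1, Complex.normSq_eq_conj_mul_self]
    simp only [jac, RCLike.star_def]
    ring
  exact_mod_cast h2

theorem jac_ne_zero (h : CotangentHermitianMetric d X)
    {e e' : OpenPartialHomeomorph X (Vec d)}
    (he : e ∈ atlas (Vec d) X) (he' : e' ∈ atlas (Vec d) X) {y : Vec d} (hy : y ∈ e.target)
    (hy' : e.symm y ∈ e'.source) : jac (fun z => e' (e.symm z)) y ≠ 0 := by
  intro h0
  have h1 := gramDet_transition h he he' hy hy'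
  have h2 := gramDet_pos h he' (e'.map_source hy')
  rw [h1, h0] at h2
  simp at h2

theorem continuousAt_iDDbar {u : Vec d → ℝ} {y : Vec d} (hu : ContDiffAt ℝ 3 u y) (v w : Vec d) :
    ContinuousAt (fun z => iDDbar u z v w) y := by
  have h1 : ContinuousAt (fderiv ℝ (fderiv ℝ u)) y :=
    ((hu.fderiv_right (m := 2) (by norm_num)).fderiv_right (m := 1) (by norm_num)).continuousAt
  unfold iDDbar
  exact continuousAt_const.mul (((h1.clm_apply continuousAt_const).clm_apply
    continuousAt_const).sub ((h1.clm_apply continuousAt_const).clm_apply continuousAt_const))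

theorem degreeDensity_eq (κ : KahlerForm d X) (h : CotangentHermitianMetric d X)
    (e : OpenPartialHomeomorph X (Vec d)) (y : Vec d) :
    degreeDensity κ h e y = topCoeff (pairing (κ.form e y)) (chernForm h e y) := rfl

theorem contDiffAt_log_gramDet (h : CotangentHermitianMetric d X)
    {e : OpenPartialHomeomorph X (Vec d)}
    (he : e ∈ atlas (Vec d) X) {y : Vec d} (hy : y ∈ e.target) :
    ContDiffAt ℝ ∞ (fun z => Real.log (gramDet h e z)) y :=
  (contDiffAt_gramDet h he hy).log (gramDet_pos h he hy).ne'

theorem continuousAt_degreeDensity (κ : KahlerForm d X) (h : CotangentHermitianMetric d X)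
    {e : OpenPartialHomeomorph X (Vec d)} (he : e ∈ atlas (Vec d) X) {y : Vec d}
    (hy : y ∈ e.target) : ContinuousAt (degreeDensity κ h e) y :=
  continuousAt_topCoeff (fun v w => κ.continuousAt_pairing he hy v w) fun v w =>
    continuousAt_const.mul (continuousAt_iDDbar
      ((contDiffAt_log_gramDet h he hy).of_le (by norm_cast)) v w)

theorem eventually_transition {e : OpenPartialHomeomorph X (Vec d)} {y : Vec d}
    (hy : y ∈ e.target) {U : Set X} (hU : IsOpen U) (hy' : e.symm y ∈ U) :
    ∀ᶠ z in 𝓝 y, z ∈ e.target ∧ e.symm z ∈ U :=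
  Filter.Eventually.and (e.open_target.mem_nhds hy)
    ((e.continuousAt_symm hy).eventually (hU.mem_nhds hy'))

theorem iDDbar_log_gramDet_transition [IsManifold 𝓘(ℂ, Vec d) ω X]
    (h : CotangentHermitianMetric d X) {e e' : OpenPartialHomeomorph X (Vec d)}
    (he : e ∈ atlas (Vec d) X) (he' : e' ∈ atlas (Vec d) X) {y : Vec d} (hy : y ∈ e.target)
    (hy' : e.symm y ∈ e'.source) (v w : Vec d) :
    iDDbar (fun z => Real.log (gramDet h e z)) y v w =
      iDDbar (fun z => Real.log (gramDet h e' z)) (e' (e.symm y))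
        (fderiv ℂ (fun z => e' (e.symm z)) y v) (fderiv ℂ (fun z => e' (e.symm z)) y w) := by
  have hF := contDiffAt_transition he he' hy hy'
  have hj := contDiffAt_jac hF
  have hj0 := jac_ne_zero h he he' hy hy'
  have hlj : ContDiffAt ℝ 2 (fun z => Real.log (Complex.normSq
      (jac (fun z => e' (e.symm z)) z))) y := by
    refine ContDiffAt.log ?_ (by simpa using hj0)
    have h1 : ContDiffAt ℝ 2 (jac (fun z => e' (e.symm z))) y :=
      (hj.restrict_scalars ℝ).of_le le_top
    simp only [Complex.normSq_apply]
    have hre := Complex.reCLM.contDiff.contDiffAt.comp y h1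
    have him := Complex.imCLM.contDiff.contDiffAt.comp y h1
    exact (hre.mul hre).add (him.mul him)
  have hlg : ContDiffAt ℝ 2 (fun z => Real.log (gramDet h e z)) y :=
    (contDiffAt_log_gramDet h he hy).of_le (by norm_cast)
  rw [← iDDbar_comp_holomorphic (hF.of_le le_top)
    ((contDiffAt_log_gramDet h he' (e'.map_source hy')).of_le (by norm_cast))]
  have hev : (fun z => Real.log (gramDet h e' (e' (e.symm z)))) =ᶠ[𝓝 y] fun z =>
      Real.log (Complex.normSq (jac (fun z => e' (e.symm z)) z)) + Real.log (gramDet h e z) := by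
    filter_upwards [eventually_transition hy e'.open_source hy'] with z hz
    rw [gramDet_transition h he he' hz.1 hz.2, Real.log_mul
      (by simpa using jac_ne_zero h he he' hz.1 hz.2) (gramDet_pos h he hz.1).ne']
  rw [iDDbar_congr hev, iDDbar_add hlj hlg, iDDbar_log_normSq (hj.of_le le_top) hj0, zero_add]

theorem degreeDensity_transition [IsManifold 𝓘(ℂ, Vec d) ω X] (κ : KahlerForm d X)
    (h : CotangentHermitianMetric d X) {e e' : OpenPartialHomeomorph X (Vec d)}
    (he : e ∈ atlas (Vec d) X) (he' : e' ∈ atlas (Vec d) X) {y : Vec d} (hy : y ∈ e.target)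
    (hy' : e.symm y ∈ e'.source) :
    degreeDensity κ h e y =
      LinearMap.det ((fderiv ℂ (fun z => e' (e.symm z)) y).toLinearMap.restrictScalars ℝ) *
        degreeDensity κ h e' (e' (e.symm y)) := by
  rw [degreeDensity_eq, degreeDensity_eq]
  refine topCoeff_transition κ he he' hy hy' _ ((-(1 / (2 * Real.pi))) •
    iDDbarForm (fun z => Real.log (gramDet h e' z)) (e' (e.symm y))) fun v w => ?_
  change -(1 / (2 * Real.pi)) * iDDbar (fun z => Real.log (gramDet h e z)) y v w = _
  rw [iDDbar_log_gramDet_transition h he he' hy hy']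
  rfl

variable (d X) in
/-- The local data of a holomorphic `GL(d)`-bundle with a holomorphic connection and a
homomorphism `φ` from `TX` to the associated vector bundle, in terms of local frames. -/
structure FrameData where
  W : X → Set X
  isOpen_W : ∀ x, IsOpen (W x)
  mem_W : ∀ x, x ∈ W x
  W_subset : ∀ x, W x ⊆ (chartAt (Vec d) x).source
  /-- the determinant of `φ` -/
  f : X → Vec d → ℂ
  /-- the trace of the connection form -/
  a : X → Vec d → Vec d →L[ℂ] ℂ
  /-- the determinants of the changes of frames -/
  γ : X → X → X → ℂ
  f_an : ∀ i, ∀ y ∈ (chartAt (Vec d) i).target, (chartAt (Vec d) i).symm y ∈ W i →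
    ContDiffAt ℂ ω (f i) y
  a_an : ∀ i, ∀ y ∈ (chartAt (Vec d) i).target, (chartAt (Vec d) i).symm y ∈ W i →
    ContDiffAt ℂ ω (a i) y
  γ_an : ∀ i j, ∀ y ∈ (chartAt (Vec d) i).target, (chartAt (Vec d) i).symm y ∈ W i →
    (chartAt (Vec d) i).symm y ∈ W j →
    ContDiffAt ℂ ω (fun z => γ i j ((chartAt (Vec d) i).symm z)) y
  γ_ne : ∀ i j q, q ∈ W i → q ∈ W j → γ i j q ≠ 0
  γ_mul : ∀ i j k q, q ∈ W i → q ∈ W j → q ∈ W k → γ i k q = γ j k q * γ i j q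
  f_trans : ∀ i j, ∀ y ∈ (chartAt (Vec d) i).target, (chartAt (Vec d) i).symm y ∈ W i →
    (chartAt (Vec d) i).symm y ∈ W j →
    f i y * γ i j ((chartAt (Vec d) i).symm y) =
      f j (chartAt (Vec d) j ((chartAt (Vec d) i).symm y)) *
        jac (fun z => chartAt (Vec d) j ((chartAt (Vec d) i).symm z)) y
  a_trans : ∀ i j, ∀ y ∈ (chartAt (Vec d) i).target, (chartAt (Vec d) i).symm y ∈ W i →
    (chartAt (Vec d) i).symm y ∈ W j → ∀ v,
    a i y v = a j (chartAt (Vec d) j ((chartAt (Vec d) i).symm y))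
        (fderiv ℂ (fun z => chartAt (Vec d) j ((chartAt (Vec d) i).symm z)) y v) +
      fderiv ℂ (fun z => γ i j ((chartAt (Vec d) i).symm z)) y v /
        γ i j ((chartAt (Vec d) i).symm y)

namespace FrameData

variable (D : FrameData d X) (P : FinitePartition d D.W)

/-- A Hermitian metric on the determinant of the associated bundle, in the local frames. -/
def metric (i : X) (y : Vec d) : ℝ :=
  ∑ k ∈ P.t, P.ψ k ((chartAt (Vec d) i).symm y) *
    (Complex.normSq (D.γ i k ((chartAt (Vec d) i).symm y)))⁻¹

theorem contDiffAt_normSq {f : Vec d → ℂ} {y : Vec d} {n : WithTop ℕ∞} (hf : ContDiffAt ℂ n f y) :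
    ContDiffAt ℝ n (fun z => Complex.normSq (f z)) y := by
  have h1 := hf.restrict_scalars ℝ
  simp only [Complex.normSq_apply]
  have hre := Complex.reCLM.contDiff.contDiffAt.comp y h1
  have him := Complex.imCLM.contDiff.contDiffAt.comp y h1
  exact (hre.mul hre).add (him.mul him)

theorem contDiffAt_metric (i : X) {y : Vec d} (hy : y ∈ (chartAt (Vec d) i).target)
    (hyW : (chartAt (Vec d) i).symm y ∈ D.W i) : ContDiffAt ℝ ∞ (D.metric P i) y := by
  refine ContDiffAt.sum fun k hk => ?_
  by_cases hyk : (chartAt (Vec d) i).symm y ∈ tsupport (P.ψ k)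
  · have hkW := P.tsupport_subset k hk hyk
    refine (P.smooth k _ (chart_mem_atlas _ i) y hy).mul (ContDiffAt.inv ?_ ?_)
    · exact (contDiffAt_normSq (D.γ_an i k y hy hyW hkW)).of_le le_top
    · simpa using D.γ_ne i k _ hyW hkW
  · refine (contDiffAt_const (c := (0 : ℝ))).congr_of_eventuallyEq ?_
    filter_upwards [((chartAt (Vec d) i).continuousAt_symm hy).eventually
      (notMem_tsupport_iff_eventuallyEq.1 hyk)] with z hz
    have hz' : P.ψ k ((chartAt (Vec d) i).symm z) = 0 := hz
    rw [hz', zero_mul]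

theorem metric_pos (i : X) {y : Vec d} (hyW : (chartAt (Vec d) i).symm y ∈ D.W i) :
    0 < D.metric P i y := by
  have hnn : ∀ k ∈ P.t, 0 ≤ P.ψ k ((chartAt (Vec d) i).symm y) *
      (Complex.normSq (D.γ i k ((chartAt (Vec d) i).symm y)))⁻¹ := fun k _ =>
    mul_nonneg (P.nonneg _ _) (inv_nonneg.2 (Complex.normSq_nonneg _))
  refine Finset.sum_pos' hnn ?_
  by_contra! hcon
  have h1 := P.sum_eq_one ((chartAt (Vec d) i).symm y)
  rw [Finset.sum_eq_zero] at h1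
  · exact zero_ne_one h1
  · intro k hk
    by_contra h0
    have hkW := P.tsupport_subset k hk (subset_tsupport _ h0)
    have hpos : 0 < P.ψ k ((chartAt (Vec d) i).symm y) := lt_of_le_of_ne (P.nonneg _ _) (Ne.symm h0)
    have := mul_pos hpos (inv_pos.2 (Complex.normSq_pos.2 (D.γ_ne i k _ hyW hkW)))
    exact absurd (hcon k hk) (not_le.2 this)

theorem metric_transition (i j : X) {y : Vec d}
    (hyi : (chartAt (Vec d) i).symm y ∈ D.W i) (hyj : (chartAt (Vec d) i).symm y ∈ D.W j) :
    D.metric P i y * Complex.normSq (D.γ i j ((chartAt (Vec d) i).symm y)) =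
      D.metric P j (chartAt (Vec d) j ((chartAt (Vec d) i).symm y)) := by
  unfold metric
  rw [Finset.sum_mul, (chartAt (Vec d) j).left_inv (D.W_subset j hyj)]
  refine Finset.sum_congr rfl fun k hk => ?_
  by_cases h0 : P.ψ k ((chartAt (Vec d) i).symm y) = 0
  · simp [h0]
  · have hkW := P.tsupport_subset k hk (subset_tsupport _ h0)
    have h1 := D.γ_ne i j _ hyi hyj
    have h2 := D.γ_ne j k _ hyj hkW
    rw [D.γ_mul i j k _ hyi hyj hkW, map_mul]
    have h1' : Complex.normSq (D.γ i j ((chartAt (Vec d) i).symm y)) ≠ 0 := by simpa using h1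
    field_simp

variable (h : CotangentHermitianMetric d X)

/-- The norm squared of `⋀^d φ`, plus a multiple of the metric. -/
def regNorm (ε : ℝ) (i : X) (y : Vec d) : ℝ :=
  gramDet h (chartAt (Vec d) i) y * Complex.normSq (D.f i y) + ε * D.metric P i y

/-- The weight `Q` of the regularization `|f|² + ε Q`. -/
def weight (i : X) (y : Vec d) : ℝ := D.metric P i y / gramDet h (chartAt (Vec d) i) y

theorem contDiffAt_regNorm (ε : ℝ) (i : X) {y : Vec d} (hy : y ∈ (chartAt (Vec d) i).target)
    (hyW : (chartAt (Vec d) i).symm y ∈ D.W i) : ContDiffAt ℝ ∞ (D.regNorm P h ε i) y :=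
  ((contDiffAt_gramDet h (chart_mem_atlas _ i) hy).mul
    ((contDiffAt_normSq (D.f_an i y hy hyW)).of_le le_top)).add
    (contDiffAt_const.mul (D.contDiffAt_metric P i hy hyW))

theorem regNorm_pos {ε : ℝ} (hε : 0 < ε) (i : X) {y : Vec d}
    (hy : y ∈ (chartAt (Vec d) i).target)
    (hyW : (chartAt (Vec d) i).symm y ∈ D.W i) : 0 < D.regNorm P h ε i y :=
  add_pos_of_nonneg_of_pos (mul_nonneg (gramDet_pos h (chart_mem_atlas _ i) hy).le
    (Complex.normSq_nonneg _)) (mul_pos hε (D.metric_pos P i hyW))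

theorem regNorm_transition (ε : ℝ) (i j : X) {y : Vec d} (hy : y ∈ (chartAt (Vec d) i).target)
    (hyi : (chartAt (Vec d) i).symm y ∈ D.W i) (hyj : (chartAt (Vec d) i).symm y ∈ D.W j) :
    D.regNorm P h ε i y * Complex.normSq (D.γ i j ((chartAt (Vec d) i).symm y)) =
      D.regNorm P h ε j (chartAt (Vec d) j ((chartAt (Vec d) i).symm y)) := by
  unfold regNorm
  rw [← D.metric_transition P i j hyi hyj, gramDet_transition h (chart_mem_atlas _ i)
    (chart_mem_atlas _ j) hy (D.W_subset j hyj)]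
  have := congrArg Complex.normSq (D.f_trans i j y hy hyi hyj)
  rw [map_mul, map_mul] at this
  linear_combination gramDet h (chartAt (Vec d) i) y * this

/-- The real one-form `Im a + ½ dᶜ log (…)`, a global form on `X`. -/
def connForm (ε : ℝ) (i : X) (y : Vec d) : Vec d →L[ℝ] ℝ :=
  imForm (D.a i) y + dc (fun z => Real.log (D.regNorm P h ε i z)) y

theorem contDiffAt_log_regNorm {ε : ℝ} (hε : 0 < ε) (i : X) {y : Vec d}
    (hy : y ∈ (chartAt (Vec d) i).target) (hyW : (chartAt (Vec d) i).symm y ∈ D.W i) :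
    ContDiffAt ℝ ∞ (fun z => Real.log (D.regNorm P h ε i z)) y :=
  (D.contDiffAt_regNorm P h ε i hy hyW).log (D.regNorm_pos P h hε i hy hyW).ne'

theorem contDiffAt_imForm (i : X) {y : Vec d}
    (hy : y ∈ (chartAt (Vec d) i).target) (hyW : (chartAt (Vec d) i).symm y ∈ D.W i) :
    ContDiffAt ℝ 2 (imForm (D.a i)) y :=
  (((ContinuousLinearMap.compL ℝ (Vec d) ℂ ℝ Complex.imCLM).comp
      (ContinuousLinearMap.restrictScalarsL ℂ (Vec d) ℂ ℝ ℝ)).contDiff.contDiffAt.comp y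
      ((D.a_an i y hy hyW).restrict_scalars ℝ)).of_le le_top

theorem contDiffAt_dc {u : Vec d → ℝ} {y : Vec d} (hu : ContDiffAt ℝ 3 u y) :
    ContDiffAt ℝ 2 (dc u) y :=
  ((-(1 / 2 : ℝ)) • ((ContinuousLinearMap.compL ℝ (Vec d) (Vec d) ℝ).flip
    (mulI d))).contDiff.contDiffAt.comp y (hu.fderiv_right (by norm_num))

theorem contDiffAt_connForm {ε : ℝ} (hε : 0 < ε) (i : X) {y : Vec d}
    (hy : y ∈ (chartAt (Vec d) i).target) (hyW : (chartAt (Vec d) i).symm y ∈ D.W i) :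
    ContDiffAt ℝ 2 (D.connForm P h ε i) y :=
  (D.contDiffAt_imForm i hy hyW).add
    (contDiffAt_dc ((D.contDiffAt_log_regNorm P h hε i hy hyW).of_le (by norm_cast)))

theorem connForm_transition [IsManifold 𝓘(ℂ, Vec d) ω X] {ε : ℝ} (hε : 0 < ε) (i j : X)
    {y : Vec d} (hy : y ∈ (chartAt (Vec d) i).target)
    (hyi : (chartAt (Vec d) i).symm y ∈ D.W i) (hyj : (chartAt (Vec d) i).symm y ∈ D.W j)
    (v : Vec d) :
    D.connForm P h ε i y v =
      D.connForm P h ε j (chartAt (Vec d) j ((chartAt (Vec d) i).symm y))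
        (fderiv ℂ (fun z => chartAt (Vec d) j ((chartAt (Vec d) i).symm z)) y v) := by
  have hjs := (chartAt (Vec d) j).map_source (D.W_subset j hyj)
  have hF := contDiffAt_transition (chart_mem_atlas (Vec d) i) (chart_mem_atlas (Vec d) j) hy
    (D.W_subset j hyj)
  have hγ := D.γ_an i j y hy hyi hyj
  have hγ0 := D.γ_ne i j _ hyi hyj
  have hyj' : (chartAt (Vec d) j).symm (chartAt (Vec d) j ((chartAt (Vec d) i).symm y)) ∈ D.W j := by
    rwa [(chartAt (Vec d) j).left_inv (D.W_subset j hyj)]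
  have hev : (fun z => Real.log (D.regNorm P h ε j
      (chartAt (Vec d) j ((chartAt (Vec d) i).symm z)))) =ᶠ[𝓝 y] fun z =>
      Real.log (D.regNorm P h ε i z) +
        Real.log (Complex.normSq (D.γ i j ((chartAt (Vec d) i).symm z))) := by
    filter_upwards [eventually_transition hy
      ((D.isOpen_W i).inter (D.isOpen_W j)) ⟨hyi, hyj⟩] with z hz
    rw [← D.regNorm_transition P h ε i j hz.1 hz.2.1 hz.2.2, Real.log_mul
      (D.regNorm_pos P h hε i hz.1 hz.2.1).ne' (by simpa using D.γ_ne i j _ hz.2.1 hz.2.2)]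
  have hlog : DifferentiableAt ℝ (fun z => Real.log (D.regNorm P h ε j z))
      (chartAt (Vec d) j ((chartAt (Vec d) i).symm y)) :=
    (D.contDiffAt_log_regNorm P h hε j hjs hyj').differentiableAt (by simp)
  have h1 := dc_comp_holomorphic (u := fun z => Real.log (D.regNorm P h ε j z))
    (hF.differentiableAt (by simp)) hlog v
  have hγlog : DifferentiableAt ℝ
      (fun z => Real.log (Complex.normSq (D.γ i j ((chartAt (Vec d) i).symm z)))) y :=
    ((contDiffAt_normSq hγ).log (by simpa using hγ0)).differentiableAt (by simp)
  rw [dc_congr hev, dc_add ((D.contDiffAt_log_regNorm P h hε i hy hyi).differentiableAt (by simp))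
    hγlog, _root_.add_apply, dc_log_normSq (hγ.of_le le_top) hγ0] at h1
  unfold connForm
  rw [_root_.add_apply, _root_.add_apply, ← h1, imForm_apply,
    imForm_apply, D.a_trans i j y hy hyi hyj, Complex.add_im]
  ring

theorem weight_pos (i : X) {y : Vec d} (hy : y ∈ (chartAt (Vec d) i).target)
    (hyW : (chartAt (Vec d) i).symm y ∈ D.W i) : 0 < D.weight P h i y :=
  div_pos (D.metric_pos P i hyW) (gramDet_pos h (chart_mem_atlas _ i) hy)

theorem contDiffAt_weight (i : X) {y : Vec d} (hy : y ∈ (chartAt (Vec d) i).target)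
    (hyW : (chartAt (Vec d) i).symm y ∈ D.W i) : ContDiffAt ℝ ∞ (D.weight P h i) y :=
  (D.contDiffAt_metric P i hy hyW).div (contDiffAt_gramDet h (chart_mem_atlas _ i) hy)
    (gramDet_pos h (chart_mem_atlas _ i) hy).ne'

/-- The degree of `Ω¹_X` in terms of the regularized section `⋀^d φ`. -/
theorem degree_eq [T2Space X] [CompactSpace X] [IsManifold 𝓘(ℂ, Vec d) ω X] (hd : 0 < d)
    (κ : KahlerForm d X) {ε : ℝ} (hε : 0 < ε) :
    2 * Real.pi * cotangentDegree κ h = ∑ i ∈ P.t, ∫ y in (chartAt (Vec d) i).target,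
      P.ψ i ((chartAt (Vec d) i).symm y) * topCoeff (pairing (κ.form (chartAt (Vec d) i) y))
        (iDDbar (fun z => Real.log (Complex.normSq (D.f i z) + ε * D.weight P h i z)) y) := by
  have hat : ∀ i : X, chartAt (Vec d) i ∈ atlas (Vec d) X := chart_mem_atlas (Vec d)
  have hstokes := sum_integral_extD_eq_zero hd κ D.W_subset P (D.connForm P h ε)
    (fun i y hy hyW => D.contDiffAt_connForm P h hε i hy hyW)
    (fun i j y hy hyi hyj v => D.connForm_transition P h hε i j hy hyi hyj v)
  have hdeg := integralTopForm_eq_sum D.W_subset P (degreeDensity κ h)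
    (fun e he y hy => continuousAt_degreeDensity κ h he hy)
    (fun e he e' he' y hy hy' => degreeDensity_transition κ h he he' hy hy')
  have hlogP : ∀ i, ∀ y ∈ (chartAt (Vec d) i).target, (chartAt (Vec d) i).symm y ∈ D.W i →
      ContDiffAt ℝ ∞ (fun z => Real.log (Complex.normSq (D.f i z) + ε * D.weight P h i z)) y := by
    intro i y hy hyW
    refine ContDiffAt.log (((contDiffAt_normSq (D.f_an i y hy hyW)).of_le le_top).add
      (contDiffAt_const.mul (D.contDiffAt_weight P h i hy hyW))) ?_
    exact (add_pos_of_nonneg_of_pos (Complex.normSq_nonneg _)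
      (mul_pos hε (D.weight_pos P h i hy hyW))).ne'
  have hpt : ∀ i ∈ P.t, ∀ y ∈ (chartAt (Vec d) i).target,
      P.ψ i ((chartAt (Vec d) i).symm y) *
        topCoeff (pairing (κ.form (chartAt (Vec d) i) y)) (extD (D.connForm P h ε i) y) =
      P.ψ i ((chartAt (Vec d) i).symm y) * topCoeff (pairing (κ.form (chartAt (Vec d) i) y))
        (iDDbar (fun z => Real.log (Complex.normSq (D.f i z) + ε * D.weight P h i z)) y) -
      2 * Real.pi * (P.ψ i ((chartAt (Vec d) i).symm y) *
        degreeDensity κ h (chartAt (Vec d) i) y) := by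
    intro i hi y hy
    by_cases h0 : P.ψ i ((chartAt (Vec d) i).symm y) = 0
    · rw [h0]; ring
    have hyW := P.tsupport_subset i hi (subset_tsupport _ h0)
    have hK := topCoeff_eq_zero hd (pairingForm (κ.form (chartAt (Vec d) i) y))
      (extDForm (imForm (D.a i)) y) (fun v w => κ.pairing_I (hat i) hy v w)
      (fun v w => extD_imForm_I ((D.a_an i y hy hyW).differentiableAt (by simp)) v w)
    have hlg := (contDiffAt_log_gramDet h (hat i) hy).of_le (n := ∞) (m := 2) (by norm_cast)
    have hsplit : extD (D.connForm P h ε i) y = fun v w =>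
        extD (imForm (D.a i)) y v w + ((-(2 * Real.pi)) * chernForm h (chartAt (Vec d) i) y v w +
        iDDbar (fun z => Real.log (Complex.normSq (D.f i z) + ε * D.weight P h i z)) y v w) := by
      funext v w
      have hY := (D.contDiffAt_log_regNorm P h hε i hy hyW)
      have e1 : extD (D.connForm P h ε i) y v w = _ :=
        extD_add ((D.contDiffAt_imForm i hy hyW).differentiableAt (by norm_num))
          ((contDiffAt_dc (hY.of_le (by norm_cast))).differentiableAt (by norm_num)) v w
      rw [e1, extD_dc (hY.of_le (by norm_cast))]
      congr 1
      have hev : (fun z => Real.log (D.regNorm P h ε i z)) =ᶠ[𝓝 y] fun z =>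
          Real.log (gramDet h (chartAt (Vec d) i) z) +
            Real.log (Complex.normSq (D.f i z) + ε * D.weight P h i z) := by
        filter_upwards [eventually_transition hy
          (D.isOpen_W i) hyW] with z hz
        have hg := gramDet_pos h (hat i) hz.1
        rw [← Real.log_mul hg.ne' (add_pos_of_nonneg_of_pos (Complex.normSq_nonneg _)
          (mul_pos hε (D.weight_pos P h i hz.1 hz.2))).ne']
        congr 1
        unfold regNorm weight
        field_simp
      rw [iDDbar_congr hev, iDDbar_add hlg ((hlogP i y hy hyW).of_le (by norm_cast))]
      congr 1
      change _ = -(2 * Real.pi) * (-(1 / (2 * Real.pi)) *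
        iDDbar (fun z => Real.log (gramDet h (chartAt (Vec d) i) z)) y v w)
      have := Real.pi_ne_zero
      field_simp
    have hK' : topCoeff (pairing (κ.form (chartAt (Vec d) i) y)) (extD (imForm (D.a i)) y) = 0 := hK
    rw [hsplit, topCoeff_add hd, topCoeff_add hd, topCoeff_smul hd, degreeDensity_eq]
    have : topCoeff (pairing (κ.form (chartAt (Vec d) i) y))
      (fun v w => extD (imForm (D.a i)) y v w) = 0 := hK'
    rw [this]
    have e3 : topCoeff (pairing (κ.form (chartAt (Vec d) i) y))
      (fun v w => chernForm h (chartAt (Vec d) i) y v w) =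
      topCoeff (pairing (κ.form (chartAt (Vec d) i) y)) (chernForm h (chartAt (Vec d) i) y) := rfl
    have e4 : topCoeff (pairing (κ.form (chartAt (Vec d) i) y)) (fun v w =>
        iDDbar (fun z => Real.log (Complex.normSq (D.f i z) + ε * D.weight P h i z)) y v w) =
      topCoeff (pairing (κ.form (chartAt (Vec d) i) y)) (
        iDDbar (fun z => Real.log (Complex.normSq (D.f i z) + ε * D.weight P h i z)) y) := rfl
    rw [e3, e4]
    ring
  have hsum : ∀ i ∈ P.t, ∫ y in (chartAt (Vec d) i).target,
      P.ψ i ((chartAt (Vec d) i).symm y) *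
        topCoeff (pairing (κ.form (chartAt (Vec d) i) y)) (extD (D.connForm P h ε i) y) =
      (∫ y in (chartAt (Vec d) i).target,
      P.ψ i ((chartAt (Vec d) i).symm y) * topCoeff (pairing (κ.form (chartAt (Vec d) i) y))
        (iDDbar (fun z => Real.log (Complex.normSq (D.f i z) + ε * D.weight P h i z)) y)) -
      2 * Real.pi * ∫ y in (chartAt (Vec d) i).target, (P.ψ i ((chartAt (Vec d) i).symm y) *
        degreeDensity κ h (chartAt (Vec d) i) y) := by
    intro i hi
    have hs := (P.tsupport_subset i hi).trans (D.W_subset i)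
    rw [setIntegral_congr_fun (chartAt (Vec d) i).open_target.measurableSet (hpt i hi),
      integral_sub, integral_const_mul]
    · refine integrableOn_hat hs _ (fun y _ h => by simp [h]) fun y hy hyt => ?_
      refine (P.smooth i _ (hat i) y hy).continuousAt.mul (continuousAt_topCoeff
        (fun v w => κ.continuousAt_pairing (hat i) hy v w) fun v w => continuousAt_iDDbar
        ((hlogP i y hy (P.tsupport_subset i hi hyt)).of_le (by norm_cast)) v w)
    · refine Integrable.const_mul ?_ _
      refine integrableOn_hat hs _ (fun y _ h => by simp [h]) fun y hy hyt => ?_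
      exact (P.smooth i _ (hat i) y hy).continuousAt.mul
        (continuousAt_degreeDensity κ h (hat i) hy)
  rw [Finset.sum_congr rfl hsum, Finset.sum_sub_distrib, ← Finset.mul_sum, ← hdeg] at hstokes
  unfold cotangentDegree
  linarith

end FrameData

end Frames

/-! ### Zeros of holomorphic functions -/

section Zeros

open Filter Topology MeasureTheory

variable {d : ℕ}

theorem contDiffAt_line {E : Type*} [NormedAddCommGroup E] [NormedSpace ℂ E] (p v : E)
    {f : E → ℂ} {ζ : ℂ} (hf : ContDiffAt ℂ ω f (p + ζ • v)) :
    AnalyticAt ℂ (fun ζ : ℂ => f (p + ζ • v)) ζ := by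
  have h : ContDiffAt ℂ ω (fun ζ : ℂ => f (p + ζ • v)) ζ :=
    hf.comp ζ (contDiffAt_const.add (contDiffAt_id.smul contDiffAt_const))
  exact h.analyticAt

theorem exists_line {f : Vec d → ℂ} {V : Set (Vec d)} (hV : IsOpen V)
    (hf : ∀ y ∈ V, ContDiffAt ℂ ω f y) {p : Vec d} (hp : p ∈ V) (hfp : f p = 0)
    (hne : ¬ ∀ᶠ y in 𝓝 p, f y = 0) :
    ∃ v : Vec d, v ≠ 0 ∧ ∀ᶠ ζ in 𝓝[≠] (0 : ℂ), f (p + ζ • v) ≠ 0 := by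
  obtain ⟨r, hr, hball⟩ := Metric.isOpen_iff.1 hV p hp
  have h1 : ∃ q ∈ Metric.ball p r, f q ≠ 0 := by
    by_contra! hcon
    exact hne (Filter.eventually_of_mem (Metric.ball_mem_nhds p hr) hcon)
  obtain ⟨q, hq, hfq⟩ := h1
  refine ⟨q - p, fun h => hfq ?_, ?_⟩
  · rw [sub_eq_zero.1 h, hfp]
  set g : ℂ → ℂ := fun ζ => f (p + ζ • (q - p)) with hg
  set S : Set ℂ := {ζ | p + ζ • (q - p) ∈ Metric.ball p r}
  have hSc : Convex ℝ S := by
    have : S = ((LinearMap.toSpanSingleton ℂ (Vec d) (q - p)).restrictScalars ℝ) ⁻¹'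
        Metric.ball 0 r := by
      ext ζ
      simp [S]
    rw [this]
    exact (convex_ball 0 r).linear_preimage _
  have hgS : AnalyticOnNhd ℂ g S := fun ζ hζ => contDiffAt_line p (q - p) (hf _ (hball hζ))
  have h0 : (0 : ℂ) ∈ S := by simp [S, hr]
  have h1 : (1 : ℂ) ∈ S := by simpa [S, dist_eq_norm] using hq
  rcases (hgS 0 h0).eventually_eq_zero_or_eventually_ne_zero with h | h
  · exfalso
    have := hgS.eqOn_zero_of_preconnected_of_eventuallyEq_zero hSc.isPreconnected h0 h h1
    simp [hg] at this
    exact hfq this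
  · exact h

/-- The projection to the kernel of `ℓ` along `v`. -/
def transverse (ℓ : Vec d →L[ℂ] ℂ) (v : Vec d) : Vec d →L[ℂ] Vec d :=
  ContinuousLinearMap.id ℂ (Vec d) - ℓ.smulRight v

theorem transverse_apply (ℓ : Vec d →L[ℂ] ℂ) (v z : Vec d) :
    transverse ℓ v z = z - ℓ z • v := rfl

/-- A closed cylinder around `p` with axis `v`. -/
def cylinder (p v : Vec d) (ℓ : Vec d →L[ℂ] ℂ) (b η : ℝ) : Set (Vec d) :=
  {z | ‖ℓ (z - p)‖ ≤ b ∧ ‖transverse ℓ v (z - p)‖ ≤ η}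

theorem isCompact_cylinder (p v : Vec d) (ℓ : Vec d →L[ℂ] ℂ) (b η : ℝ) :
    IsCompact (cylinder p v ℓ b η) := by
  refine Metric.isCompact_of_isClosed_isBounded ?_ ?_
  · have h1 : IsClosed {z : Vec d | ‖ℓ (z - p)‖ ≤ b} := isClosed_le
      (ℓ.continuous.comp (continuous_id.sub continuous_const)).norm continuous_const
    have h2 : IsClosed {z : Vec d | ‖transverse ℓ v (z - p)‖ ≤ η} := isClosed_le
      ((transverse ℓ v).continuous.comp (continuous_id.sub continuous_const)).norm continuous_const
    exact h1.inter h2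
  · refine (Metric.isBounded_closedBall (x := p) (r := η + b * ‖v‖)).subset fun z hz => ?_
    rw [Metric.mem_closedBall, dist_eq_norm]
    have h1 : z - p = transverse ℓ v (z - p) + ℓ (z - p) • v := by
      rw [transverse_apply]; abel
    rw [h1]
    refine (norm_add_le _ _).trans (add_le_add hz.2 ?_)
    rw [norm_smul]
    exact mul_le_mul_of_nonneg_right hz.1 (norm_nonneg _)

theorem exists_cylinder {f : Vec d → ℂ} {V : Set (Vec d)} (hV : IsOpen V)
    (hf : ∀ y ∈ V, ContDiffAt ℂ ω f y) {p : Vec d} (hp : p ∈ V) (hfp : f p = 0)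
    (hne : ¬ ∀ᶠ y in 𝓝 p, f y = 0) :
    ∃ (v : Vec d) (ℓ : Vec d →L[ℂ] ℂ) (b η δ : ℝ), ℓ v = 1 ∧ 0 < b ∧ 0 < η ∧ 0 < δ ∧
      cylinder p v ℓ b η ⊆ V ∧
      ∀ z ∈ cylinder p v ℓ b η, b / 2 ≤ ‖ℓ (z - p)‖ → δ < Complex.normSq (f z) := by
  obtain ⟨v, hv, hiso⟩ := exists_line hV hf hp hfp hne
  obtain ⟨k, hk⟩ : ∃ k, v k ≠ 0 := by
    by_contra! hcon
    exact hv (funext hcon)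
  set ℓ : Vec d →L[ℂ] ℂ := (v k)⁻¹ • ContinuousLinearMap.proj k
  have hℓ : ℓ v = 1 := by simp [ℓ, hk]
  have hline : Continuous fun ζ : ℂ => p + ζ • v := by fun_prop
  have hVline : ∀ᶠ ζ in 𝓝 (0 : ℂ), p + ζ • v ∈ V :=
    hline.continuousAt.eventually (hV.mem_nhds (by simpa using hp))
  rw [eventually_nhdsWithin_iff] at hiso
  obtain ⟨r, hr, hball⟩ := Metric.eventually_nhds_iff_ball.1 (hiso.and hVline)
  set b := r / 2
  have hb : 0 < b := by positivity
  have hbr : ∀ ζ : ℂ, ‖ζ‖ ≤ b → ζ ∈ Metric.ball (0 : ℂ) r := fun ζ hζ => by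
    rw [mem_ball_zero_iff]; exact lt_of_le_of_lt hζ (half_lt_self hr)
  set S₁ : Set (Vec d) := (fun ζ : ℂ => p + ζ • v) '' Metric.closedBall 0 b
  set A : Set ℂ := Metric.closedBall 0 b ∩ {ζ | b / 2 ≤ ‖ζ‖}
  have hA : IsCompact A := (isCompact_closedBall _ _).inter_right
    (isClosed_le continuous_const continuous_norm)
  set S₂ : Set (Vec d) := (fun ζ : ℂ => p + ζ • v) '' A
  have hfV : ContinuousOn f V := fun y hy => (hf y hy).continuousAt.continuousWithinAt
  have hS₁ : IsCompact S₁ := (isCompact_closedBall _ _).image hline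
  have hS₂ : IsCompact S₂ := hA.image hline
  have hS₁V : S₁ ⊆ V := by
    rintro _ ⟨ζ, hζ, rfl⟩
    exact (hball ζ (hbr ζ (by simpa using hζ))).2
  have hS₂V : S₂ ⊆ V := (Set.image_mono Set.inter_subset_left).trans hS₁V
  have hnS : ContinuousOn (fun z => Complex.normSq (f z)) V :=
    Complex.continuous_normSq.comp_continuousOn hfV
  have hS₂ne : S₂.Nonempty := by
    refine ⟨_, (b : ℂ), ⟨?_, ?_⟩, rfl⟩
    · simp [abs_of_pos hb]
    · simp [abs_of_pos hb, hb.le]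
  obtain ⟨z₀, hz₀, hmin⟩ := hS₂.exists_isMinOn hS₂ne (hnS.mono hS₂V)
  have hpos : 0 < Complex.normSq (f z₀) := by
    obtain ⟨ζ, hζ, rfl⟩ := hz₀
    rw [Complex.normSq_pos]
    refine (hball ζ (hbr ζ (by simpa using hζ.1))).1 ?_
    intro h0
    have h2 : b / 2 ≤ ‖ζ‖ := hζ.2
    rw [h0, norm_zero] at h2
    linarith
  set δ := Complex.normSq (f z₀) / 2
  set O : Set (Vec d) := V ∩ (fun z => Complex.normSq (f z)) ⁻¹' Set.Ioi δ
  have hO : IsOpen O := hnS.isOpen_inter_preimage hV isOpen_Ioi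
  have hS₂O : S₂ ⊆ O := fun z hz => ⟨hS₂V hz, lt_of_lt_of_le (half_lt_self hpos) (hmin hz)⟩
  obtain ⟨η₁, hη₁, hth₁⟩ := hS₁.exists_cthickening_subset_open hV hS₁V
  obtain ⟨η₂, hη₂, hth₂⟩ := hS₂.exists_cthickening_subset_open hO hS₂O
  have hnear : ∀ z : Vec d, dist z (p + ℓ (z - p) • v) = ‖transverse ℓ v (z - p)‖ := fun z => by
    rw [dist_eq_norm, transverse_apply]; congr 1; abel
  refine ⟨v, ℓ, b, min η₁ η₂, δ, hℓ, hb, lt_min hη₁ hη₂, by positivity, fun z hz => ?_,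
    fun z hz hzb => ?_⟩
  · refine hth₁ (Metric.mem_cthickening_of_dist_le z (p + ℓ (z - p) • v) _ _
      ⟨_, by simpa using hz.1, rfl⟩ ?_)
    rw [hnear]; exact hz.2.trans (min_le_left _ _)
  · refine (hth₂ (Metric.mem_cthickening_of_dist_le z (p + ℓ (z - p) • v) _ _
      ⟨_, ⟨by simpa using hz.1, hzb⟩, rfl⟩ ?_)).2
    rw [hnear]; exact hz.2.trans (min_le_right _ _)

theorem ae_ne_zero_of_analytic {g : ℂ → ℂ} {U : Set ℂ} (hU : IsOpen U) (hUc : IsPreconnected U)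
    (hg : AnalyticOnNhd ℂ g U) {x : ℂ} (hx : x ∈ U) (hgx : g x ≠ 0) :
    ∀ᵐ ζ : ℂ, ζ ∈ U → g ζ ≠ 0 := by
  have h1 := hg.preimage_zero_mem_codiscreteWithin hgx hx ⟨⟨x, hx⟩, hUc⟩
  have h2 := ae_restrict_le_codiscreteWithin (μ := volume) hU.measurableSet h1
  have h3 : ∀ᵐ ζ ∂(volume.restrict U), g ζ ≠ 0 := by
    filter_upwards [h2] with ζ hζ
    simpa using hζ
  exact (ae_restrict_iff' hU.measurableSet).1 h3

/-- The zero set of a holomorphic function that is nowhere locally zero is a null set. -/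
theorem volume_zeros_eq_zero {f : Vec d → ℂ} {V : Set (Vec d)} (hV : IsOpen V)
    (hf : ∀ y ∈ V, ContDiffAt ℂ ω f y) (hne : ∀ p ∈ V, ¬ ∀ᶠ y in 𝓝 p, f y = 0) :
    volume {y ∈ V | f y = 0} = 0 := by
  refine measure_null_of_locally_null _ fun p hp => ?_
  obtain ⟨v, ℓ, b, η, δ, hℓ, hb, hη, hδ, hcyl, hbd⟩ := exists_cylinder hV hf hp.1 hp.2 (hne p hp.1)
  set Ω : Set (Vec d) := {z | ‖ℓ (z - p)‖ < b ∧ ‖transverse ℓ v (z - p)‖ < η}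
  have hΩo : IsOpen Ω := by
    have h1 : IsOpen {z : Vec d | ‖ℓ (z - p)‖ < b} := isOpen_lt
      (ℓ.continuous.comp (continuous_id.sub continuous_const)).norm continuous_const
    have h2 : IsOpen {z : Vec d | ‖transverse ℓ v (z - p)‖ < η} := isOpen_lt
      ((transverse ℓ v).continuous.comp (continuous_id.sub continuous_const)).norm continuous_const
    exact h1.inter h2
  have hpΩ : p ∈ Ω := by simp [Ω, hb, hη]
  have hΩV : Ω ⊆ V := fun z hz => hcyl ⟨hz.1.le, hz.2.le⟩
  refine ⟨{y ∈ V | f y = 0} ∩ Ω, inter_mem_nhdsWithin _ (hΩo.mem_nhds hpΩ), ?_⟩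
  set s : Set (Vec d) := {z | z ∈ Ω → f z ≠ 0}
  have hsm : MeasurableSet s := by
    have hfΩ : ContinuousOn f Ω := fun z hz => (hf z (hΩV hz)).continuousAt.continuousWithinAt
    have h1 : IsOpen (Ω ∩ f ⁻¹' {0}ᶜ) := hfΩ.isOpen_inter_preimage hΩo isOpen_compl_singleton
    have h2 : s = Ωᶜ ∪ (Ω ∩ f ⁻¹' {0}ᶜ) := by
      ext z
      by_cases hz : z ∈ Ω <;> simp [s, hz]
    rw [h2]
    exact hΩo.measurableSet.compl.union h1.measurableSet
  have hs : ∀ᵐ z : Vec d, z ∈ s := by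
    refine ae_mem_of_ae_add_linearMap_mem (𝕜 := ℝ)
      (((LinearMap.toSpanSingleton ℂ (Vec d) v).restrictScalars ℝ)) volume volume hsm fun y => ?_
    have htr : ∀ ζ : ℂ, transverse ℓ v (y + ζ • v - p) = transverse ℓ v (y - p) := fun ζ => by
      have : y + ζ • v - p = (y - p) + ζ • v := by abel
      rw [this, map_add, map_smul, transverse_apply ℓ v v, hℓ]
      simp
    have hlo : ∀ ζ : ℂ, ℓ (y + ζ • v - p) = ζ - (-ℓ (y - p)) := fun ζ => by
      have : y + ζ • v - p = (y - p) + ζ • v := by abel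
      rw [this, map_add, map_smul, hℓ]
      simp; ring
    by_cases hy : ‖transverse ℓ v (y - p)‖ < η
    swap
    · refine Eventually.of_forall fun ζ hζ => absurd hζ.2 ?_
      have := htr ζ
      simp only [LinearMap.restrictScalars_apply, LinearMap.toSpanSingleton_apply]
      rwa [this]
    have hmem : ∀ ζ : ℂ, ζ ∈ Metric.ball (-ℓ (y - p)) b ↔ y + ζ • v ∈ Ω := fun ζ => by
      rw [Metric.mem_ball, dist_eq_norm, ← hlo]
      exact ⟨fun h => ⟨h, by rwa [htr]⟩, fun h => h.1⟩
    have hx : (-ℓ (y - p) + ((3 / 4 * b : ℝ) : ℂ)) ∈ Metric.ball (-ℓ (y - p)) b := by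
      simp [Metric.mem_ball, dist_eq_norm, abs_of_pos hb]; linarith
    have := ae_ne_zero_of_analytic (g := fun ζ => f (y + ζ • v)) Metric.isOpen_ball
      (convex_ball (-ℓ (y - p)) b).isPreconnected
      (fun ζ hζ => contDiffAt_line y v (hf _ (hΩV ((hmem ζ).1 hζ)))) hx (by
        have hz := (hmem _).1 hx
        have h2 := hbd _ ⟨hz.1.le, hz.2.le⟩ (by
          rw [hlo]; simp [abs_of_pos hb]; linarith)
        exact Complex.normSq_pos.1 (hδ.trans h2))
    filter_upwards [this] with ζ hζ hζΩ
    exact hζ ((hmem ζ).2 hζΩ)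
  have := ae_iff.1 hs
  refine measure_mono_null (fun z hz => ?_) this
  intro h
  exact h hz.2 hz.1.2

end Zeros

/-! ### Local estimates for the regularized logarithm -/

section LocalEstimates

open Filter Topology MeasureTheory

variable {d : ℕ}

/-- The regularization `log (|f|² + ε Q)` of `log |f|²`. -/
def logReg (f : Vec d → ℂ) (Q : Vec d → ℝ) (ε : ℝ) (y : Vec d) : ℝ :=
  Real.log (Complex.normSq (f y) + ε * Q y)

/-- The function `ε Q / (|f|² + ε Q)`. -/
def regRatio (f : Vec d → ℂ) (Q : Vec d → ℝ) (ε : ℝ) (y : Vec d) : ℝ :=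
  ε * Q y / (Complex.normSq (f y) + ε * Q y)

theorem reg_pos (w : ℂ) {ε q : ℝ} (hε : 0 < ε) (hq : 0 < q) : 0 < Complex.normSq w + ε * q :=
  add_pos_of_nonneg_of_pos (Complex.normSq_nonneg _) (mul_pos hε hq)

theorem contDiffAt_logReg {f : Vec d → ℂ} {Q : Vec d → ℝ} {y : Vec d} {ε : ℝ}
    (hf : ContDiffAt ℂ ω f y) (hQ : ContDiffAt ℝ ∞ Q y) (hQ0 : 0 < Q y) (hε : 0 < ε) :
    ContDiffAt ℝ ∞ (logReg f Q ε) y :=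
  (((FrameData.contDiffAt_normSq hf).of_le le_top).add (contDiffAt_const.mul hQ)).log
    (reg_pos _ hε hQ0).ne'

theorem iDDbar_logReg {f : Vec d → ℂ} {Q : Vec d → ℝ} {y : Vec d} {ε : ℝ}
    (hf : ContDiffAt ℂ ω f y) (hf0 : f y ≠ 0) (hQ : ContDiffAt ℝ ∞ Q y) (hQ0 : 0 < Q y)
    (hε : 0 < ε) :
    ∃ (μ : ℝ) (ξ : Vec d →L[ℝ] ℝ), 0 ≤ μ ∧ ∀ v w, iDDbar (logReg f Q ε) y v w =
      regRatio f Q ε y * iDDbar (fun z => Real.log (Q z)) y v w + μ * rankOne ξ v w := by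
  have hN0 : 0 < Complex.normSq (f y) := Complex.normSq_pos.2 hf0
  have hlogQ : ContDiffAt ℝ 2 (fun z => Real.log (Q z)) y :=
    (hQ.log hQ0.ne').of_le (by norm_cast)
  have hlogN : ContDiffAt ℝ 2 (fun z => Real.log (Complex.normSq (f z))) y :=
    ((FrameData.contDiffAt_normSq hf).log hN0.ne').of_le le_top
  set g : Vec d → ℝ := fun z => -Real.log ε +
    (Real.log (Complex.normSq (f z)) - Real.log (Q z)) with hg
  have hgc : ContDiffAt ℝ 2 g y := contDiffAt_const.add (hlogN.sub hlogQ)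
  have hexp : ∀ z, 0 < Complex.normSq (f z) → 0 < Q z →
      Real.exp (g z) = Complex.normSq (f z) / (ε * Q z) := fun z h1 h2 => by
    rw [hg]
    simp only
    rw [Real.exp_add, Real.exp_neg, Real.exp_sub, Real.exp_log hε, Real.exp_log h1, Real.exp_log h2]
    field_simp
  have hS : ∀ t : ℝ, HasDerivAt (fun t => Real.log (1 + Real.exp t))
      (Real.exp t / (1 + Real.exp t)) t := fun t =>
    ((Real.hasDerivAt_exp t).const_add 1).log (by positivity)
  have hS' : ∀ t : ℝ, HasDerivAt (fun t => Real.exp t / (1 + Real.exp t))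
      (Real.exp t / (1 + Real.exp t) ^ 2) t := fun t => by
    have := (Real.hasDerivAt_exp t).div ((Real.hasDerivAt_exp t).const_add 1)
      (show 1 + Real.exp t ≠ 0 by positivity)
    refine this.congr_deriv ?_
    congr 1; ring
  have hev : logReg f Q ε =ᶠ[𝓝 y] fun z => (Real.log ε + Real.log (Q z)) +
      Real.log (1 + Real.exp (g z)) := by
    filter_upwards [(FrameData.contDiffAt_normSq hf).continuousAt.eventually (lt_mem_nhds hN0),
      hQ.continuousAt.eventually (lt_mem_nhds hQ0)] with z h1 h2
    have h1' : 0 < Complex.normSq (f z) := h1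
    have h2' : 0 < Q z := h2
    have h3 : 0 < ε * Q z := mul_pos hε h2'
    have h4 : 0 < 1 + Real.exp (g z) := by positivity
    rw [← Real.log_mul hε.ne' h2'.ne', ← Real.log_mul h3.ne' h4.ne', hexp z h1' h2', logReg]
    congr 1
    field_simp
    ring
  refine ⟨Real.exp (g y) / (1 + Real.exp (g y)) ^ 2, fderiv ℝ g y, by positivity, fun v w => ?_⟩
  have hSg : ContDiffAt ℝ 2 (fun z => Real.log (1 + Real.exp (g z))) y :=
    (contDiffAt_const.add hgc.exp).log (by positivity)
  rw [iDDbar_congr hev, iDDbar_add (contDiffAt_const.add hlogQ) hSg, iDDbar_const_add,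
    iDDbar_comp_real hgc (Eventually.of_forall hS) (hS' _)]
  have hgB : iDDbar g y v w = -iDDbar (fun z => Real.log (Q z)) y v w := by
    rw [hg, iDDbar_const_add, iDDbar_sub hlogN hlogQ, iDDbar_log_normSq (hf.of_le le_top) hf0]
    ring
  have hr : regRatio f Q ε y = 1 - Real.exp (g y) / (1 + Real.exp (g y)) := by
    have hP := reg_pos (f y) hε hQ0
    rw [hexp y hN0 hQ0, regRatio]
    field_simp
    ring
  rw [hgB, hr]
  ring

theorem regRatio_mem {f : Vec d → ℂ} {Q : Vec d → ℝ} {y : Vec d} {ε : ℝ}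
    (hQ0 : 0 < Q y) (hε : 0 < ε) : 0 ≤ regRatio f Q ε y ∧ regRatio f Q ε y ≤ 1 :=
  ⟨div_nonneg (mul_pos hε hQ0).le (reg_pos _ hε hQ0).le,
    (div_le_one (reg_pos _ hε hQ0)).2 (by linarith [Complex.normSq_nonneg (f y)])⟩

theorem tendsto_reg (w : ℂ) (q : ℝ) :
    Tendsto (fun n : ℕ => Complex.normSq w + (1 / ((n : ℝ) + 1)) * q) atTop
      (𝓝 (Complex.normSq w)) := by
  have := tendsto_one_div_add_atTop_nhds_zero_nat (𝕜 := ℝ)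
  have h2 := (this.mul_const q).const_add (Complex.normSq w)
  rwa [zero_mul, add_zero] at h2

theorem tendsto_regRatio {f : Vec d → ℂ} {Q : Vec d → ℝ} {y : Vec d} (hf0 : f y ≠ 0) :
    Tendsto (fun n : ℕ => regRatio f Q (1 / ((n : ℝ) + 1)) y) atTop (𝓝 0) := by
  have h1 := (tendsto_one_div_add_atTop_nhds_zero_nat (𝕜 := ℝ)).mul_const (Q y)
  have := h1.div (tendsto_reg (f y) (Q y)) (Complex.normSq_pos.2 hf0).ne'
  rwa [zero_mul, zero_div] at this

theorem continuous_of_forall_tsupport {E : Type*} [TopologicalSpace E] {g : E → ℝ}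
    (h : ∀ y ∈ tsupport g, ContinuousAt g y) : Continuous g := by
  rw [continuous_iff_continuousAt]
  intro y
  by_cases hy : y ∈ tsupport g
  · exact h y hy
  · exact continuousAt_const.congr (notMem_tsupport_iff_eventuallyEq.1 hy).symm

theorem continuous_mul_of_tsupport {E : Type*} [TopologicalSpace E] {ρ T : E → ℝ}
    (hρ : Continuous ρ) (hT : ∀ y ∈ tsupport ρ, ContinuousAt T y) :
    Continuous fun y => ρ y * T y :=
  continuous_of_forall_tsupport fun y hy =>
    hρ.continuousAt.mul (hT y (tsupport_mul_subset_left hy))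

theorem integrable_mul_of_tsupport {ρ T : Vec d → ℝ} (hρ : Continuous ρ)
    (hc : HasCompactSupport ρ) (hT : ∀ y ∈ tsupport ρ, ContinuousAt T y) :
    Integrable fun y => ρ y * T y :=
  (continuous_mul_of_tsupport hρ hT).integrable_of_hasCompactSupport hc.mul_right

variable {V : Set (Vec d)} {f : Vec d → ℂ} {Q : Vec d → ℝ}

theorem continuousAt_regRatio {y : Vec d} {ε : ℝ} (hf : ContDiffAt ℂ ω f y)
    (hQ : ContDiffAt ℝ ∞ Q y) (hQ0 : 0 < Q y) (hε : 0 < ε) :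
    ContinuousAt (regRatio f Q ε) y :=
  (continuousAt_const.mul hQ.continuousAt).div ((FrameData.contDiffAt_normSq hf).continuousAt.add
    (continuousAt_const.mul hQ.continuousAt)) (reg_pos _ hε hQ0).ne'

theorem tendsto_integral_regRatio (hV : IsOpen V) (hf : ∀ y ∈ V, ContDiffAt ℂ ω f y)
    (hQ : ∀ y ∈ V, ContDiffAt ℝ ∞ Q y) (hQ0 : ∀ y ∈ V, 0 < Q y)
    (hne : ∀ p ∈ V, ¬ ∀ᶠ y in 𝓝 p, f y = 0) {ρ T : Vec d → ℝ} (hρ : Continuous ρ)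
    (hc : HasCompactSupport ρ) (hρV : tsupport ρ ⊆ V) (hT : ∀ y ∈ V, ContinuousAt T y) :
    Tendsto (fun n : ℕ => ∫ y, ρ y * (regRatio f Q (1 / ((n : ℝ) + 1)) y * T y)) atTop (𝓝 0) := by
  have hε : ∀ n : ℕ, (0 : ℝ) < 1 / ((n : ℝ) + 1) := fun n => by positivity
  have hint := integrable_mul_of_tsupport hρ hc (fun y hy => hT y (hρV hy))
  have key := tendsto_integral_of_dominated_convergence (μ := volume) (f := fun _ => (0 : ℝ))
    (F := fun (n : ℕ) y => ρ y * (regRatio f Q (1 / ((n : ℝ) + 1)) y * T y))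
    (fun y => ‖ρ y * T y‖) (fun n => ?_) hint.norm (fun n => ?_) ?_
  · simpa using key
  · exact (continuous_mul_of_tsupport hρ fun y hy => (continuousAt_regRatio (hf y (hρV hy))
      (hQ y (hρV hy)) (hQ0 y (hρV hy)) (hε n)).mul (hT y (hρV hy))).aestronglyMeasurable
  · refine Eventually.of_forall fun y => ?_
    by_cases h0 : ρ y = 0
    · simp [h0]
    have hy := hρV (subset_tsupport _ h0)
    have hr := regRatio_mem (f := f) (hQ0 y hy) (hε n)
    rw [norm_mul, norm_mul, norm_mul, Real.norm_of_nonneg hr.1]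
    have : regRatio f Q (1 / ((n : ℝ) + 1)) y * ‖T y‖ ≤ 1 * ‖T y‖ :=
      mul_le_mul_of_nonneg_right hr.2 (norm_nonneg _)
    rw [one_mul] at this
    exact mul_le_mul_of_nonneg_left this (norm_nonneg _)
  · have hz := measure_eq_zero_iff_ae_notMem.1 (volume_zeros_eq_zero hV hf hne)
    filter_upwards [hz] with y hy
    by_cases h0 : ρ y = 0
    · simp [h0]
    have hyV := hρV (subset_tsupport _ h0)
    have hfy : f y ≠ 0 := fun h => hy ⟨hyV, h⟩
    have := ((tendsto_regRatio (Q := Q) hfy).mul_const (T y)).const_mul (ρ y)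
    simpa using this

theorem fderiv_logReg {y : Vec d} {ε : ℝ} (hf : ContDiffAt ℂ ω f y)
    (hQ : ContDiffAt ℝ ∞ Q y) (hQ0 : 0 < Q y) (hε : 0 < ε) (w : Vec d) :
    fderiv ℝ (logReg f Q ε) y w =
      (fderiv ℝ (fun z => Complex.normSq (f z)) y w + ε * fderiv ℝ Q y w) /
        (Complex.normSq (f y) + ε * Q y) := by
  have h1 := ((FrameData.contDiffAt_normSq hf).differentiableAt (by simp)).hasFDerivAt
  have h2 := (hQ.differentiableAt (by simp)).hasFDerivAt
  have h3 : HasFDerivAt (logReg f Q ε) _ y :=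
    (h1.add (h2.const_mul ε)).log (reg_pos (f y) hε hQ0).ne'
  rw [h3.fderiv]
  simp [div_eq_inv_mul]
  ring

theorem continuousAt_fderiv_apply {u : Vec d → ℝ} {y : Vec d} (hu : ContDiffAt ℝ ∞ u y)
    (w : Vec d) : ContinuousAt (fun z => fderiv ℝ u z w) y :=
  ((hu.fderiv_right (m := 1) (by norm_cast)).continuousAt).clm_apply continuousAt_const

theorem tendsto_integral_fderiv_logReg (hf : ∀ y ∈ V, ContDiffAt ℂ ω f y)
    (hQ : ∀ y ∈ V, ContDiffAt ℝ ∞ Q y) (hQ0 : ∀ y ∈ V, 0 < Q y) {g : Vec d → ℝ}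
    (hg : Continuous g) (hc : HasCompactSupport g) (hgV : tsupport g ⊆ V)
    (hg0 : ∀ y ∈ tsupport g, f y ≠ 0) (w : Vec d) :
    Tendsto (fun n : ℕ => ∫ y, g y * fderiv ℝ (logReg f Q (1 / ((n : ℝ) + 1))) y w) atTop
      (𝓝 (∫ y, g y * (fderiv ℝ (fun z => Complex.normSq (f z)) y w /
        Complex.normSq (f y)))) := by
  have hε : ∀ n : ℕ, (0 : ℝ) < 1 / ((n : ℝ) + 1) := fun n => by positivity
  have hε1 : ∀ n : ℕ, 1 / ((n : ℝ) + 1) ≤ (1 : ℝ) := fun n => by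
    rw [div_le_one (by positivity)]; linarith [n.cast_nonneg (α := ℝ)]
  have hN : ∀ y ∈ V, ContDiffAt ℝ ∞ (fun z => Complex.normSq (f z)) y := fun y hy =>
    (FrameData.contDiffAt_normSq (hf y hy)).of_le le_top
  have hbd : Integrable fun y => g y *
      ((‖fderiv ℝ (fun z => Complex.normSq (f z)) y w‖ + ‖fderiv ℝ Q y w‖) /
        Complex.normSq (f y)) :=
    integrable_mul_of_tsupport hg hc fun y hy =>
      ((continuousAt_fderiv_apply (hN y (hgV hy)) w).norm.add
        (continuousAt_fderiv_apply (hQ y (hgV hy)) w).norm).div (hN y (hgV hy)).continuousAt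
        (Complex.normSq_pos.2 (hg0 y hy)).ne'
  refine tendsto_integral_of_dominated_convergence (μ := volume) _ (fun n => ?_) hbd.norm
    (fun n => Eventually.of_forall fun y => ?_) (Eventually.of_forall fun y => ?_)
  · exact (continuous_mul_of_tsupport hg fun y hy => continuousAt_fderiv_apply
      (contDiffAt_logReg (hf y (hgV hy)) (hQ y (hgV hy)) (hQ0 y (hgV hy)) (hε n))
      w).aestronglyMeasurable
  · by_cases h0 : g y = 0
    · simp [h0]
    have hy := hgV (subset_tsupport _ h0)
    have hN0 := Complex.normSq_pos.2 (hg0 y (subset_tsupport _ h0))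
    have hP := reg_pos (f y) (hε n) (hQ0 y hy)
    rw [fderiv_logReg (hf y hy) (hQ y hy) (hQ0 y hy) (hε n), norm_mul, norm_mul]
    refine mul_le_mul_of_nonneg_left ?_ (norm_nonneg _)
    rw [norm_div, norm_div, Real.norm_of_nonneg hP.le, Real.norm_of_nonneg hN0.le]
    refine div_le_div₀ (norm_nonneg _) ?_ hN0 (by linarith [mul_pos (hε n) (hQ0 y hy)])
    rw [Real.norm_of_nonneg (add_nonneg (norm_nonneg _) (norm_nonneg _))]
    refine (norm_add_le _ _).trans (add_le_add le_rfl ?_)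
    rw [norm_mul, Real.norm_of_nonneg (hε n).le]
    exact mul_le_of_le_one_left (norm_nonneg _) (hε1 n)
  · by_cases h0 : g y = 0
    · simp [h0]
    have hy := hgV (subset_tsupport _ h0)
    have hN0 := Complex.normSq_pos.2 (hg0 y (subset_tsupport _ h0))
    refine Tendsto.const_mul (g y) ?_
    have h1 := ((tendsto_one_div_add_atTop_nhds_zero_nat (𝕜 := ℝ)).mul_const
      (fderiv ℝ Q y w)).const_add (fderiv ℝ (fun z => Complex.normSq (f z)) y w)
    have h2 := h1.div (tendsto_reg (f y) (Q y)) hN0.ne'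
    rw [zero_mul, add_zero] at h2
    exact h2.congr fun n => (fderiv_logReg (hf y hy) (hQ y hy) (hQ0 y hy) (hε n) w).symm

theorem integral_mul_snd_fderiv {θ u : Vec d → ℝ} (hθ : ContDiff ℝ ∞ θ)
    (hc : HasCompactSupport θ) (hu : ∀ y ∈ tsupport θ, ContDiffAt ℝ ∞ u y) (v : Vec d) :
    ∫ y, θ y * fderiv ℝ (fderiv ℝ u) y v v = -∫ y, fderiv ℝ θ y v * fderiv ℝ u y v := by
  have hu1 : ∀ y ∈ tsupport θ, ContDiffAt ℝ 1 (fderiv ℝ u) y := fun y hy =>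
    (hu y hy).fderiv_right (by norm_cast)
  have hD : ∀ y ∈ tsupport θ, HasFDerivAt (fun z => fderiv ℝ u z v)
      ((fderiv ℝ (fderiv ℝ u) y).flip v) y := fun y hy => by
    have := ((hu1 y hy).differentiableAt (by norm_num)).hasFDerivAt.clm_apply
      (hasFDerivAt_const v y)
    refine this.congr_fderiv ?_
    ext w; simp
  have hg : ContDiff ℝ 1 fun y => θ y * fderiv ℝ u y v := by
    refine contDiff_of_forall_tsupport fun y hy => ?_
    have hy' : y ∈ tsupport θ := tsupport_mul_subset_left hy
    exact (hθ.contDiffAt.of_le (by norm_cast)).mul ((hu1 y hy').clm_apply contDiffAt_const)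
  have h0 := integral_fderiv_eq_zero hg hc.mul_right v
  have hθ1 : Continuous fun y => fderiv ℝ θ y v :=
    (hθ.continuous_fderiv (by simp)).clm_apply continuous_const
  have hθc : HasCompactSupport fun y => fderiv ℝ θ y v := hc.fderiv_apply ℝ v
  have hsub : tsupport (fun y => fderiv ℝ θ y v) ⊆ tsupport θ := tsupport_fderiv_apply_subset ℝ v
  have hpt : (fun y => fderiv ℝ (fun z => θ z * fderiv ℝ u z v) y v) = fun y =>
      θ y * fderiv ℝ (fderiv ℝ u) y v v + fderiv ℝ θ y v * fderiv ℝ u y v := by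
    funext y
    by_cases hy : y ∈ tsupport θ
    · rw [(((hθ.differentiable (by simp)) y).hasFDerivAt.fun_mul (hD y hy)).fderiv]
      simp; ring
    · have e := notMem_tsupport_iff_eventuallyEq.1 hy
      have e1 : (fun z => θ z * fderiv ℝ u z v) =ᶠ[𝓝 y] fun _ => 0 := by
        filter_upwards [e] with z hz; simp [hz]
      have e2 : θ =ᶠ[𝓝 y] fun _ => 0 := e
      rw [e1.fderiv_eq, e2.fderiv_eq, e2.self_of_nhds]; simp
  rw [hpt, integral_add] at h0
  · linarith
  · exact integrable_mul_of_tsupport hθ.continuous hc fun y hy =>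
      ((((hu y hy).fderiv_right (m := ∞) (by norm_cast)).fderiv_right (m := 1)
        (by norm_cast)).continuousAt.clm_apply continuousAt_const).clm_apply continuousAt_const
  · exact integrable_mul_of_tsupport hθ1 hθc fun y hy =>
      continuousAt_fderiv_apply (hu y (hsub hy)) v

theorem iDDbar_self (u : Vec d → ℝ) (y v : Vec d) : iDDbar u y v (Complex.I • v) =
    (1 / 2) * (fderiv ℝ (fderiv ℝ u) y v v +
      fderiv ℝ (fderiv ℝ u) y (Complex.I • v) (Complex.I • v)) := by
  unfold iDDbar
  rw [smul_smul, Complex.I_mul_I, neg_one_smul, map_neg]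
  ring

theorem continuousAt_snd_fderiv {u : Vec d → ℝ} {y : Vec d} (hu : ContDiffAt ℝ ∞ u y)
    (v w : Vec d) : ContinuousAt (fun z => fderiv ℝ (fderiv ℝ u) z v w) y :=
  (((hu.fderiv_right (m := ∞) (by norm_cast)).fderiv_right (m := 1)
    (by norm_cast)).continuousAt.clm_apply continuousAt_const).clm_apply continuousAt_const

theorem integral_mul_iDDbar_self {θ u : Vec d → ℝ} (hθ : ContDiff ℝ ∞ θ)
    (hc : HasCompactSupport θ) (hu : ∀ y ∈ tsupport θ, ContDiffAt ℝ ∞ u y) (v : Vec d) :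
    ∫ y, θ y * iDDbar u y v (Complex.I • v) = -(1 / 2) *
      ((∫ y, fderiv ℝ θ y v * fderiv ℝ u y v) +
        ∫ y, fderiv ℝ θ y (Complex.I • v) * fderiv ℝ u y (Complex.I • v)) := by
  have h1 := integral_mul_snd_fderiv hθ hc hu v
  have h2 := integral_mul_snd_fderiv hθ hc hu (Complex.I • v)
  have hi : ∀ v : Vec d, Integrable fun y => θ y * fderiv ℝ (fderiv ℝ u) y v v := fun v =>
    integrable_mul_of_tsupport hθ.continuous hc fun y hy => continuousAt_snd_fderiv (hu y hy) v v
  have : (fun y => θ y * iDDbar u y v (Complex.I • v)) = fun y => (1 / 2) *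
      (θ y * fderiv ℝ (fderiv ℝ u) y v v +
        θ y * fderiv ℝ (fderiv ℝ u) y (Complex.I • v) (Complex.I • v)) := by
    funext y; rw [iDDbar_self]; ring
  rw [this, integral_const_mul, integral_add (hi _) (hi _), h1, h2]
  ring

theorem exists_rankOne_bound (hd : 0 < d) {K : Vec d → Vec d →ₗ[ℝ] Vec d →ₗ[ℝ] ℝ}
    {C : Set (Vec d)} (hC : IsCompact C)
    (hKc : ∀ y ∈ C, ∀ v w, ContinuousAt (fun z => K z v w) y)
    (hK : ∀ y ∈ C, ∀ v w, K y (Complex.I • v) (Complex.I • w) = K y v w)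
    (hanti : ∀ y ∈ C, ∀ v w, K y v w = -K y w v)
    (hpos : ∀ y ∈ C, ∀ v, v ≠ 0 → 0 < K y v (Complex.I • v)) (v : Vec d) :
    ∃ c : ℝ, 0 < c ∧ ∀ y ∈ C, ∀ ξ : Vec d →L[ℝ] ℝ,
      c * rankOne ξ v (Complex.I • v) ≤ topCoeff (fun v w => K y v w) (rankOne ξ) := by
  have hS : IsCompact (C ×ˢ Metric.sphere (0 : Vec d →L[ℝ] ℝ) 1) := hC.prod (isCompact_sphere _ _)
  have happ : ∀ v : Vec d, Continuous fun q : Vec d × (Vec d →L[ℝ] ℝ) => q.2 v := fun v =>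
    (ContinuousLinearMap.apply ℝ ℝ v).continuous.comp continuous_snd
  have hcont : ContinuousOn (fun q : Vec d × (Vec d →L[ℝ] ℝ) =>
      topCoeff (fun v w => K q.1 v w) (rankOne q.2)) (C ×ˢ Metric.sphere 0 1) := by
    intro q hq
    refine (continuousAt_topCoeff (K := fun q : Vec d × (Vec d →L[ℝ] ℝ) => fun v w => K q.1 v w)
      (α := fun q => rankOne q.2) (fun v w => ?_) fun v w => ?_).continuousWithinAt
    · exact ContinuousAt.comp (f := Prod.fst) (hKc q.1 hq.1 v w) continuousAt_fst
    · exact (continuous_const.mul (((happ _).mul (happ _)).sub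
        ((happ _).mul (happ _)))).continuousAt
  obtain ⟨m, hm, hmin⟩ := hS.exists_forall_le' hcont (a := 0) (fun q hq =>
    topCoeff_rankOne_pos hd _ (hK q.1 hq.1) (hanti q.1 hq.1) (hpos q.1 hq.1) q.2
      (fun h0 => by
        have h2 := hq.2
        rw [h0] at h2; simp at h2))
  refine ⟨m / (‖v‖ ^ 2 + 1), by positivity, fun y hy ξ => ?_⟩
  have hscale : ∀ (t : ℝ) (ξ : Vec d →L[ℝ] ℝ), rankOne (t • ξ) = fun v w => t ^ 2 * rankOne ξ v w :=
    fun t ξ => by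
      funext v w; simp [rankOne]; ring
  have hI : ‖Complex.I • v‖ = ‖v‖ := by rw [norm_smul]; simp
  have h1 : rankOne ξ v (Complex.I • v) ≤ ‖ξ‖ ^ 2 * ‖v‖ ^ 2 := by
    rw [rankOne_self]
    have e1 : ξ v ^ 2 ≤ (‖ξ‖ * ‖v‖) ^ 2 := sq_le_sq' (neg_le_of_abs_le (ξ.le_opNorm v))
      (le_of_abs_le (ξ.le_opNorm v))
    have e2 : ξ (Complex.I • v) ^ 2 ≤ (‖ξ‖ * ‖v‖) ^ 2 := by
      have := ξ.le_opNorm (Complex.I • v)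
      rw [hI] at this
      exact sq_le_sq' (neg_le_of_abs_le this) (le_of_abs_le this)
    nlinarith
  have h2 : m * ‖ξ‖ ^ 2 ≤ topCoeff (fun v w => K y v w) (rankOne ξ) := by
    by_cases h0 : ξ = 0
    · have : rankOne (0 : Vec d →L[ℝ] ℝ) = 0 := by funext v w; simp [rankOne]
      rw [h0, this, topCoeff_zero hd]; simp
    have hn : 0 < ‖ξ‖ := norm_pos_iff.2 h0
    have h3 := hmin (y, ‖ξ‖⁻¹ • ξ) ⟨hy, by simp [norm_smul, hn.ne']⟩
    have h4 : rankOne (‖ξ‖⁻¹ • ξ) = fun v w => ‖ξ‖⁻¹ ^ 2 * rankOne ξ v w := hscale _ _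
    simp only [h4] at h3
    rw [topCoeff_smul hd] at h3
    have : m * ‖ξ‖ ^ 2 ≤ (‖ξ‖⁻¹ ^ 2 *
      topCoeff (fun v w => K y v w) (fun v w => rankOne ξ v w)) * ‖ξ‖ ^ 2 :=
      mul_le_mul_of_nonneg_right h3 (by positivity)
    refine this.trans (le_of_eq ?_)
    field_simp
  refine le_trans ?_ h2
  rw [div_mul_eq_mul_div, div_le_iff₀ (by positivity)]
  have := mul_le_mul_of_nonneg_left h1 hm.le
  nlinarith [mul_nonneg hm.le (sq_nonneg ‖ξ‖)]

/-- A cut-off function adapted to a zero `p` of a holomorphic function `f`: in the directions of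
a complex line it is locally a decreasing function of `|f|²`. -/
theorem exists_cutoff (hV : IsOpen V) (hf : ∀ y ∈ V, ContDiffAt ℂ ω f y) {p : Vec d} (hp : p ∈ V)
    (hfp : f p = 0) (hne : ¬ ∀ᶠ y in 𝓝 p, f y = 0) :
    ∃ (v : Vec d) (θ : Vec d → ℝ), ContDiff ℝ ∞ θ ∧ HasCompactSupport θ ∧ tsupport θ ⊆ V ∧
      (∀ y, 0 ≤ θ y) ∧ (∀ y, θ y ≤ 1) ∧ (∃ y, fderiv ℝ θ y v ≠ 0) ∧
      (∀ w, (w = v ∨ w = Complex.I • v) →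
        ∀ y ∈ tsupport (fun y => fderiv ℝ θ y w), f y ≠ 0) ∧
      (∀ y, ∃ k : ℝ, 0 ≤ k ∧ ∀ w, (w = v ∨ w = Complex.I • v) →
        fderiv ℝ θ y w = -k * fderiv ℝ (fun z => Complex.normSq (f z)) y w) := by
  obtain ⟨v, ℓ, b, η, δ, hℓ, hb, hη, hδ, hcyl, hbd⟩ := exists_cylinder hV hf hp hfp hne
  set Z := cylinder p v ℓ b η
  have hZ : IsCompact Z := isCompact_cylinder p v ℓ b η
  let B₁ : ContDiffBump (0 : ℂ) := ⟨b / 2, b, by positivity, by linarith⟩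
  let B₂ : ContDiffBump (0 : Vec d) := ⟨η / 2, η, by positivity, by linarith⟩
  set χ₁ : Vec d → ℝ := fun z => B₁ (ℓ (z - p))
  set χ₂ : Vec d → ℝ := fun z => B₂ (transverse ℓ v (z - p))
  set N : Vec d → ℝ := fun z => Complex.normSq (f z)
  set c : ℝ → ℝ := fun t => 1 - Real.smoothTransition ((t - δ / 2) / (δ / 2)) with hc
  have hcs : ContDiff ℝ ∞ c := contDiff_const.sub (Real.smoothTransition.contDiff.comp
    ((contDiff_id.sub contDiff_const).div_const _))
  have hc1 : ∀ t, t ≤ δ / 2 → c t = 1 := fun t ht => by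
    rw [hc]
    simp only
    rw [Real.smoothTransition.zero_of_nonpos, sub_zero]
    exact div_nonpos_of_nonpos_of_nonneg (by linarith) (by positivity)
  have hc0 : ∀ t, δ ≤ t → c t = 0 := fun t ht => by
    rw [hc]
    simp only
    rw [Real.smoothTransition.one_of_one_le, sub_self]
    rw [le_div_iff₀ (by positivity)]; linarith
  have hcanti : Antitone c := fun s t hst => by
    refine sub_le_sub_left (Real.smoothTransition.monotone ?_) _
    gcongr
  have hcd : ∀ t, deriv c t ≤ 0 := fun t => hcanti.deriv_nonpos
  have hcmem : ∀ t, 0 ≤ c t ∧ c t ≤ 1 := fun t =>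
    ⟨sub_nonneg.2 (Real.smoothTransition.le_one _),
      sub_le_self _ (Real.smoothTransition.nonneg _)⟩
  have hχ₁s : ContDiff ℝ ∞ χ₁ := B₁.contDiff.comp
    (((ℓ.restrictScalars ℝ).contDiff).comp (contDiff_id.sub contDiff_const))
  have hχ₂s : ContDiff ℝ ∞ χ₂ := B₂.contDiff.comp
    ((((transverse ℓ v).restrictScalars ℝ).contDiff).comp (contDiff_id.sub contDiff_const))
  have hNs : ∀ y ∈ V, ContDiffAt ℝ ∞ N y := fun y hy =>
    (FrameData.contDiffAt_normSq (hf y hy)).of_le le_top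
  have hχ₁0 : ∀ z, b ≤ ‖ℓ (z - p)‖ → χ₁ z = 0 := fun z hz => B₁.zero_of_le_dist (by simpa using hz)
  have hχ₂0 : ∀ z, η ≤ ‖transverse ℓ v (z - p)‖ → χ₂ z = 0 := fun z hz =>
    B₂.zero_of_le_dist (by simpa [dist_zero_right] using hz)
  set θ : Vec d → ℝ := fun z => χ₁ z * χ₂ z * c (N z) with hθ
  have hsupp : ∀ z, θ z ≠ 0 → z ∈ Z := fun z hz => by
    refine ⟨?_, ?_⟩
    · by_contra h
      exact hz (by simp only [hθ]; rw [hχ₁0 z (not_le.1 h).le]; ring)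
    · by_contra h
      exact hz (by simp only [hθ]; rw [hχ₂0 z (not_le.1 h).le]; ring)
  have htsupp : tsupport θ ⊆ Z := closure_minimal hsupp hZ.isClosed
  have hθV : tsupport θ ⊆ V := htsupp.trans hcyl
  have hθc : HasCompactSupport θ := hZ.of_isClosed_subset (isClosed_tsupport _) htsupp
  have hθs : ContDiff ℝ ∞ θ := contDiff_of_forall_tsupport fun y hy =>
    (hχ₁s.contDiffAt.mul hχ₂s.contDiffAt).mul (hcs.contDiffAt.comp y (hNs y (hθV hy)))
  have hDχ₂ : ∀ (z : Vec d) (w : Vec d), transverse ℓ v w = 0 → fderiv ℝ χ₂ z w = 0 := by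
    intro z w hw
    have h1 : HasFDerivAt (fun z => transverse ℓ v (z - p))
        ((transverse ℓ v).restrictScalars ℝ) z :=
      ((transverse ℓ v).restrictScalars ℝ).hasFDerivAt.comp z ((hasFDerivAt_id z).sub_const p)
    have h2 : HasFDerivAt χ₂ _ z := ((B₂.contDiff (n := 1)).differentiable
      (by norm_num) _).hasFDerivAt.comp z h1
    rw [h2.fderiv]
    simp [hw]
  have hDχ₁ : ∀ (z : Vec d), fderiv ℝ χ₁ z ≠ 0 → b / 2 ≤ ‖ℓ (z - p)‖ ∧ ‖ℓ (z - p)‖ ≤ b := by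
    intro z hz
    have hcℓ : Continuous fun z => ‖ℓ (z - p)‖ :=
      (ℓ.continuous.comp (continuous_id.sub continuous_const)).norm
    refine ⟨?_, ?_⟩
    · by_contra! h
      refine hz ?_
      have : χ₁ =ᶠ[𝓝 z] fun _ => 1 := by
        filter_upwards [hcℓ.continuousAt.eventually (gt_mem_nhds h)] with q hq
        exact B₁.one_of_mem_closedBall (by
          simp only [Metric.mem_closedBall, dist_zero_right]; exact le_of_lt hq)
      rw [this.fderiv_eq]; simp
    · by_contra! h
      refine hz ?_
      have : χ₁ =ᶠ[𝓝 z] fun _ => 0 := by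
        filter_upwards [hcℓ.continuousAt.eventually (lt_mem_nhds h)] with q hq
        exact hχ₁0 q (le_of_lt hq)
      rw [this.fderiv_eq]; simp
  have htr : ∀ w, (w = v ∨ w = Complex.I • v) → transverse ℓ v w = 0 := by
    have h1 : transverse ℓ v v = 0 := by rw [transverse_apply, hℓ]; simp
    rintro w (rfl | rfl)
    · exact h1
    · rw [map_smul, h1, smul_zero]
  have hDθ : ∀ y ∈ V, ∀ w, (w = v ∨ w = Complex.I • v) →
      fderiv ℝ θ y w = χ₁ y * χ₂ y * (deriv c (N y) * fderiv ℝ N y w) := by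
    intro y hy w hw
    have h1 := ((hχ₁s.differentiable (by simp)) y).hasFDerivAt
    have h2 := ((hχ₂s.differentiable (by simp)) y).hasFDerivAt
    have h3 := ((hNs y hy).differentiableAt (by simp)).hasFDerivAt
    have h4 := ((hcs.differentiable (by simp)) (N y)).hasDerivAt
    have h5 : HasFDerivAt θ _ y := (h1.mul h2).mul (h4.comp_hasFDerivAt y h3)
    have h6 : c (N y) * (χ₂ y * fderiv ℝ χ₁ y w) = 0 := by
      by_cases e1 : fderiv ℝ χ₁ y = 0
      · rw [e1]; simp
      by_cases e2 : χ₂ y = 0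
      · rw [e2]; simp
      have e3 : ‖transverse ℓ v (y - p)‖ ≤ η := by
        by_contra! h
        exact e2 (hχ₂0 y h.le)
      obtain ⟨e4, e5⟩ := hDχ₁ y e1
      rw [hc0 (N y) (hbd y ⟨e5, e3⟩ e4).le, zero_mul]
    rw [h5.fderiv]
    simp only [_root_.add_apply, _root_.smul_apply, smul_eq_mul, hDχ₂ y w (htr w hw), Pi.mul_apply]
    linear_combination h6
  have hDθ0 : ∀ y, y ∉ Z → fderiv ℝ θ y = 0 := fun y hy => by
    have : θ =ᶠ[𝓝 y] fun _ => 0 := by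
      filter_upwards [hZ.isClosed.isOpen_compl.mem_nhds hy] with z hz
      by_contra h
      exact hz (hsupp z h)
    rw [this.fderiv_eq]; simp
  refine ⟨v, θ, hθs, hθc, hθV, fun y => ?_, fun y => ?_, ?_, fun w hw y hy => ?_, fun y => ?_⟩
  · exact mul_nonneg (mul_nonneg B₁.nonneg B₂.nonneg) (hcmem _).1
  · exact mul_le_one₀ (mul_le_one₀ B₁.le_one B₂.nonneg B₂.le_one) (hcmem _).1 (hcmem _).2
  · by_contra! hcon
    have hl : ∀ t : ℝ, HasDerivAt (fun t : ℝ => θ (p + t • v)) 0 t := fun t => by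
      have h1 : HasDerivAt (fun t : ℝ => p + t • v) v t := by
        simpa using ((hasDerivAt_id t).smul_const v).const_add p
      have h2 := ((hθs.differentiable (by simp)) (p + t • v)).hasFDerivAt.comp_hasDerivAt t h1
      rwa [hcon] at h2
    have h2 := is_const_of_deriv_eq_zero (fun t => (hl t).differentiableAt)
      (fun t => (hl t).deriv) 0 b
    have e0 : θ (p + (0 : ℝ) • v) = 1 := by
      have i1 : χ₁ p = 1 := B₁.one_of_mem_closedBall (by simp [B₁]; positivity)
      have i2 : χ₂ p = 1 := B₂.one_of_mem_closedBall (by simp [B₂]; positivity)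
      have i3 : c (N p) = 1 := hc1 _ (by simp [N, hfp]; positivity)
      rw [zero_smul, add_zero]
      simp only [hθ]
      rw [i1, i2, i3]; norm_num
    have e1 : θ (p + b • v) = 0 := by
      simp only [hθ]
      rw [hχ₁0, zero_mul, zero_mul]
      have : p + b • v - p = (b : ℂ) • v := by
        rw [add_sub_cancel_left]; ext i; simp
      rw [this, map_smul, hℓ]
      simp [abs_of_pos hb]
    rw [e0, e1] at h2
    norm_num at h2
  · have hclosed : IsClosed (Z ∩ N ⁻¹' Set.Ici (δ / 2)) :=
      ContinuousOn.preimage_isClosed_of_isClosed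
        (fun z hz => (hNs z (hcyl hz)).continuousAt.continuousWithinAt) hZ.isClosed isClosed_Ici
    have hsub : tsupport (fun y => fderiv ℝ θ y w) ⊆ Z ∩ N ⁻¹' Set.Ici (δ / 2) := by
      refine closure_minimal (fun z hz => ?_) hclosed
      have hzZ : z ∈ Z := by
        by_contra h
        exact hz (by simp [hDθ0 z h])
      refine ⟨hzZ, ?_⟩
      by_contra h
      have h' : N z < δ / 2 := not_le.1 h
      refine hz ?_
      have : c =ᶠ[𝓝 (N z)] fun _ => 1 := by
        filter_upwards [gt_mem_nhds h'] with t ht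
        exact hc1 t (le_of_lt ht)
      simp only
      rw [hDθ z (hcyl hzZ) w hw, this.deriv_eq]
      simp
    intro h0
    have := (hsub hy).2
    simp only [Set.mem_preimage, Set.mem_Ici, N, h0, map_zero] at this
    linarith
  · by_cases hy : y ∈ V
    · refine ⟨χ₁ y * χ₂ y * (-deriv c (N y)), mul_nonneg (mul_nonneg B₁.nonneg B₂.nonneg)
        (neg_nonneg.2 (hcd _)), fun w hw => ?_⟩
      rw [hDθ y hy w hw]; ring
    · refine ⟨0, le_rfl, fun w _ => ?_⟩
      rw [hDθ0 y fun h => hy (hcyl h)]; simp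

end LocalEstimates

section LocalIntegrals

open Filter Topology MeasureTheory

variable {d : ℕ} {V : Set (Vec d)} {f : Vec d → ℂ} {Q : Vec d → ℝ}
  {K : Vec d → Vec d →ₗ[ℝ] Vec d →ₗ[ℝ] ℝ}

theorem continuousAt_topCoeff_iDDbar {u : Vec d → ℝ} {y : Vec d}
    (hKc : ∀ v w, ContinuousAt (fun z => K z v w) y) (hu : ContDiffAt ℝ ∞ u y) :
    ContinuousAt (fun z => topCoeff (fun v w => K z v w) (iDDbar u z)) y :=
  continuousAt_topCoeff hKc fun v w => continuousAt_iDDbar (hu.of_le (by norm_cast)) v w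

theorem topCoeff_rankOne_nonneg (hd : 0 < d) (K : Vec d →ₗ[ℝ] Vec d →ₗ[ℝ] ℝ)
    (hK : ∀ v w, K (Complex.I • v) (Complex.I • w) = K v w)
    (hanti : ∀ v w, K v w = -K w v) (hpos : ∀ v, v ≠ 0 → 0 < K v (Complex.I • v))
    (ξ : Vec d →L[ℝ] ℝ) : 0 ≤ topCoeff (fun v w => K v w) (rankOne ξ) := by
  by_cases h0 : ξ = 0
  · have : rankOne (0 : Vec d →L[ℝ] ℝ) = 0 := by funext v w; simp [rankOne]
    rw [h0, this, topCoeff_zero hd]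
  · exact (topCoeff_rankOne_pos hd K hK hanti hpos ξ h0).le

theorem topCoeff_iDDbar_logReg (hd : 0 < d) {y : Vec d} {ε : ℝ}
    (hf : ContDiffAt ℂ ω f y) (hf0 : f y ≠ 0) (hQ : ContDiffAt ℝ ∞ Q y) (hQ0 : 0 < Q y)
    (hε : 0 < ε) :
    ∃ (μ : ℝ) (ξ : Vec d →L[ℝ] ℝ), 0 ≤ μ ∧
      topCoeff (fun v w => K y v w) (iDDbar (logReg f Q ε) y) = regRatio f Q ε y *
        topCoeff (fun v w => K y v w) (iDDbar (fun z => Real.log (Q z)) y) +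
        μ * topCoeff (fun v w => K y v w) (rankOne ξ) ∧
      ∀ v w, iDDbar (logReg f Q ε) y v w =
        regRatio f Q ε y * iDDbar (fun z => Real.log (Q z)) y v w + μ * rankOne ξ v w := by
  obtain ⟨μ, ξ, hμ, h⟩ := iDDbar_logReg hf hf0 hQ hQ0 hε
  refine ⟨μ, ξ, hμ, ?_, h⟩
  have : iDDbar (logReg f Q ε) y = fun v w =>
      regRatio f Q ε y * iDDbar (fun z => Real.log (Q z)) y v w + μ * rankOne ξ v w := by
    funext v w; exact h v w
  rw [this, topCoeff_add hd, topCoeff_smul hd, topCoeff_smul hd]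

variable (hd : 0 < d) (hV : IsOpen V) (hf : ∀ y ∈ V, ContDiffAt ℂ ω f y)
  (hQ : ∀ y ∈ V, ContDiffAt ℝ ∞ Q y) (hQ0 : ∀ y ∈ V, 0 < Q y)
  (hne : ∀ p ∈ V, ¬ ∀ᶠ y in 𝓝 p, f y = 0)
  (hKc : ∀ y ∈ V, ∀ v w, ContinuousAt (fun z => K z v w) y)
  (hK : ∀ y ∈ V, ∀ v w, K y (Complex.I • v) (Complex.I • w) = K y v w)
  (hanti : ∀ y ∈ V, ∀ v w, K y v w = -K y w v)
  (hpos : ∀ y ∈ V, ∀ v, v ≠ 0 → 0 < K y v (Complex.I • v))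
  {ρ : Vec d → ℝ} (hρ : Continuous ρ) (hρc : HasCompactSupport ρ) (hρV : tsupport ρ ⊆ V)
  (hρ0 : ∀ y, 0 ≤ ρ y)

include hd hV hf hQ hQ0 hne hKc hK hanti hpos hρ hρc hρV hρ0

theorem exists_tendsto_zero_le_integral : ∃ L : ℕ → ℝ, Tendsto L atTop (𝓝 0) ∧
    ∀ n : ℕ, L n ≤ ∫ y, ρ y * topCoeff (fun v w => K y v w)
      (iDDbar (logReg f Q (1 / ((n : ℝ) + 1))) y) := by
  have hε : ∀ n : ℕ, (0 : ℝ) < 1 / ((n : ℝ) + 1) := fun n => by positivity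
  have hT : ∀ y ∈ V, ContinuousAt (fun y => topCoeff (fun v w => K y v w)
      (iDDbar (fun z => Real.log (Q z)) y)) y := fun y hy =>
    continuousAt_topCoeff_iDDbar (hKc y hy) ((hQ y hy).log (hQ0 y hy).ne')
  refine ⟨_, tendsto_integral_regRatio hV hf hQ hQ0 hne hρ hρc hρV hT, fun n => ?_⟩
  refine integral_mono_ae ?_ ?_ ?_
  · exact integrable_mul_of_tsupport hρ hρc fun y hy => (continuousAt_regRatio (hf y (hρV hy))
      (hQ y (hρV hy)) (hQ0 y (hρV hy)) (hε n)).mul (hT y (hρV hy))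
  · exact integrable_mul_of_tsupport hρ hρc fun y hy => continuousAt_topCoeff_iDDbar
      (hKc y (hρV hy)) (contDiffAt_logReg (hf y (hρV hy)) (hQ y (hρV hy)) (hQ0 y (hρV hy)) (hε n))
  · filter_upwards [measure_eq_zero_iff_ae_notMem.1 (volume_zeros_eq_zero hV hf hne)] with y hy
    by_cases h0 : ρ y = 0
    · simp [h0]
    have hyV := hρV (subset_tsupport _ h0)
    obtain ⟨μ, ξ, hμ, h1, -⟩ := topCoeff_iDDbar_logReg (K := K) hd (hf y hyV)
      (fun h => hy ⟨hyV, h⟩) (hQ y hyV) (hQ0 y hyV) (hε n)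
    refine mul_le_mul_of_nonneg_left ?_ (hρ0 y)
    rw [h1]
    exact le_add_of_nonneg_right (mul_nonneg hμ
      (topCoeff_rankOne_nonneg hd _ (hK y hyV) (hanti y hyV) (hpos y hyV) ξ))

theorem exists_tendsto_pos_le_integral {p : Vec d} (hp : p ∈ V) (hfp : f p = 0) (hρp : 0 < ρ p) :
    ∃ (L : ℕ → ℝ) (G : ℝ), 0 < G ∧ Tendsto L atTop (𝓝 G) ∧
    ∀ n : ℕ, L n ≤ ∫ y, ρ y * topCoeff (fun v w => K y v w)
      (iDDbar (logReg f Q (1 / ((n : ℝ) + 1))) y) := by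
  have hε : ∀ n : ℕ, (0 : ℝ) < 1 / ((n : ℝ) + 1) := fun n => by positivity
  have hlogQ : ∀ y ∈ V, ContDiffAt ℝ ∞ (fun z => Real.log (Q z)) y := fun y hy =>
    (hQ y hy).log (hQ0 y hy).ne'
  have hT : ∀ y ∈ V, ContinuousAt (fun y => topCoeff (fun v w => K y v w)
      (iDDbar (fun z => Real.log (Q z)) y)) y := fun y hy =>
    continuousAt_topCoeff_iDDbar (hKc y hy) (hlogQ y hy)
  set V' : Set (Vec d) := V ∩ ρ ⁻¹' Set.Ioi (ρ p / 2)
  have hV' : IsOpen V' := hV.inter (isOpen_Ioi.preimage hρ)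
  obtain ⟨v, θ, hθs, hθc, hθV', hθ0, hθ1, ⟨y₀, hy₀⟩, hDne, hDk⟩ := exists_cutoff hV'
    (fun y hy => hf y hy.1) (p := p) ⟨hp, half_lt_self hρp⟩ hfp (hne p hp)
  have hθV : tsupport θ ⊆ V := hθV'.trans Set.inter_subset_left
  obtain ⟨c, hc, hcb⟩ := exists_rankOne_bound hd hθc (fun y hy => hKc y (hθV hy))
    (fun y hy => hK y (hθV hy)) (fun y hy => hanti y (hθV hy)) (fun y hy => hpos y (hθV hy)) v
  set N : Vec d → ℝ := fun z => Complex.normSq (f z)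
  have hNs : ∀ y ∈ V, ContDiffAt ℝ ∞ N y := fun y hy =>
    (FrameData.contDiffAt_normSq (hf y hy)).of_le le_top
  have hreg : ∀ n : ℕ, ∀ y ∈ V, ContDiffAt ℝ ∞ (logReg f Q (1 / ((n : ℝ) + 1))) y := fun n y hy =>
    contDiffAt_logReg (hf y hy) (hQ y hy) (hQ0 y hy) (hε n)
  have hDθ : ∀ w, Continuous fun y => fderiv ℝ θ y w := fun w =>
    (hθs.continuous_fderiv (by simp)).clm_apply continuous_const
  have hDθc : ∀ w, HasCompactSupport fun y => fderiv ℝ θ y w := fun w => hθc.fderiv_apply ℝ w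
  have hDθV : ∀ w, tsupport (fun y => fderiv ℝ θ y w) ⊆ V := fun w =>
    (tsupport_fderiv_apply_subset ℝ w).trans hθV
  set A : Vec d → ℝ := fun w => ∫ y, fderiv ℝ θ y w * (fderiv ℝ N y w / N y)
  have hAcont : ∀ w, (w = v ∨ w = Complex.I • v) →
      Continuous fun y => fderiv ℝ θ y w * (fderiv ℝ N y w / N y) := fun w hw =>
    continuous_mul_of_tsupport (hDθ w) fun y hy =>
      (continuousAt_fderiv_apply (hNs y (hDθV w hy)) w).div (hNs y (hDθV w hy)).continuousAt
        (Complex.normSq_pos.2 (hDne w hw y hy)).ne'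
  have hApt : ∀ w, (w = v ∨ w = Complex.I • v) → ∀ y,
      0 ≤ -(fderiv ℝ θ y w * (fderiv ℝ N y w / N y)) := fun w hw y => by
    obtain ⟨k, hk, hkw⟩ := hDk y
    rw [hkw w hw]
    have : -(-k * fderiv ℝ N y w * (fderiv ℝ N y w / N y)) =
      k * (fderiv ℝ N y w) ^ 2 / N y := by ring
    rw [this]
    exact div_nonneg (mul_nonneg hk (sq_nonneg _)) (Complex.normSq_nonneg _)
  have hA2 : A (Complex.I • v) ≤ 0 := by
    have := integral_nonneg (μ := volume) (f := fun y => -(fderiv ℝ θ y (Complex.I • v) *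
      (fderiv ℝ N y (Complex.I • v) / N y))) (hApt (Complex.I • v) (Or.inr rfl))
    rw [integral_neg] at this
    simp only [A]; linarith
  have hA1 : A v < 0 := by
    have := (hAcont v (Or.inl rfl)).neg.integral_pos_of_hasCompactSupport_nonneg_nonzero
      (μ := volume) (x := y₀) (hDθc v).mul_right.neg (hApt v (Or.inl rfl)) (by
        obtain ⟨k, hk, hkw⟩ := hDk y₀
        have h1 := hkw v (Or.inl rfl)
        have h2 : fderiv ℝ N y₀ v ≠ 0 := fun h => hy₀ (by rw [h1]; simp only [N] at h; rw [h, mul_zero])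
        have h3 : N y₀ ≠ 0 := (Complex.normSq_pos.2 (hDne v (Or.inl rfl) y₀
          (subset_tsupport _ hy₀))).ne'
        exact neg_ne_zero.2 (mul_ne_zero hy₀ (div_ne_zero h2 h3)))
    have h2 : 0 < ∫ y, -(fderiv ℝ θ y v * (fderiv ℝ N y v / N y)) := this
    rw [integral_neg] at h2
    simp only [A]; linarith
  have hB : ∀ y ∈ V, ContinuousAt (fun y => iDDbar (fun z => Real.log (Q z)) y v
      (Complex.I • v)) y := fun y hy =>
    continuousAt_iDDbar ((hlogQ y hy).of_le (by norm_cast)) v _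
  have hlim1 := tendsto_integral_regRatio hV hf hQ hQ0 hne hρ hρc hρV hT
  have hlim2 := tendsto_integral_regRatio hV hf hQ hQ0 hne hθs.continuous hθc hθV hB
  have hlim3 : ∀ w, (w = v ∨ w = Complex.I • v) → Tendsto (fun n : ℕ => ∫ y, fderiv ℝ θ y w *
      fderiv ℝ (logReg f Q (1 / ((n : ℝ) + 1))) y w) atTop (𝓝 (A w)) := fun w hw =>
    tendsto_integral_fderiv_logReg hf hQ hQ0 (hDθ w) (hDθc w) (hDθV w) (hDne w hw) w
  have hlim4 : Tendsto (fun n : ℕ => ∫ y, θ y * iDDbar (logReg f Q (1 / ((n : ℝ) + 1))) y v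
      (Complex.I • v)) atTop (𝓝 (-(1 / 2) * (A v + A (Complex.I • v)))) := by
    refine (((hlim3 v (Or.inl rfl)).add (hlim3 _ (Or.inr rfl))).const_mul (-(1 / 2))).congr
      fun n => ?_
    exact (integral_mul_iDDbar_self hθs hθc (fun y hy => hreg n y (hθV hy)) v).symm
  refine ⟨_, 0 + ρ p / 2 * c * (-(1 / 2) * (A v + A (Complex.I • v)) - 0), ?_,
    hlim1.add ((hlim4.sub hlim2).const_mul (ρ p / 2 * c)), fun n => ?_⟩
  · rw [zero_add, sub_zero]
    exact mul_pos (mul_pos (by linarith) hc) (by linarith)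
  have hi1 : Integrable fun y => ρ y * (regRatio f Q (1 / ((n : ℝ) + 1)) y *
      topCoeff (fun v w => K y v w) (iDDbar (fun z => Real.log (Q z)) y)) :=
    integrable_mul_of_tsupport hρ hρc fun y hy => (continuousAt_regRatio (hf y (hρV hy))
      (hQ y (hρV hy)) (hQ0 y (hρV hy)) (hε n)).mul (hT y (hρV hy))
  have hi2 : Integrable fun y => θ y * iDDbar (logReg f Q (1 / ((n : ℝ) + 1))) y v
      (Complex.I • v) :=
    integrable_mul_of_tsupport hθs.continuous hθc fun y hy =>
      continuousAt_iDDbar ((hreg n y (hθV hy)).of_le (by norm_cast)) v _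
  have hi3 : Integrable fun y => θ y * (regRatio f Q (1 / ((n : ℝ) + 1)) y *
      iDDbar (fun z => Real.log (Q z)) y v (Complex.I • v)) :=
    integrable_mul_of_tsupport hθs.continuous hθc fun y hy => (continuousAt_regRatio (hf y (hθV hy))
      (hQ y (hθV hy)) (hQ0 y (hθV hy)) (hε n)).mul (hB y (hθV hy))
  have hi4 : Integrable fun y => ρ y * topCoeff (fun v w => K y v w)
      (iDDbar (logReg f Q (1 / ((n : ℝ) + 1))) y) :=
    integrable_mul_of_tsupport hρ hρc fun y hy => continuousAt_topCoeff_iDDbar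
      (hKc y (hρV hy)) (hreg n y (hρV hy))
  have hi5 : Integrable fun y => ρ p / 2 * c * (θ y * iDDbar (logReg f Q (1 / ((n : ℝ) + 1))) y v
      (Complex.I • v) - θ y * (regRatio f Q (1 / ((n : ℝ) + 1)) y *
      iDDbar (fun z => Real.log (Q z)) y v (Complex.I • v))) := (hi2.sub hi3).const_mul _
  rw [← integral_sub hi2 hi3, ← integral_const_mul, ← integral_add hi1 hi5]
  refine integral_mono_ae (hi1.add hi5) hi4 ?_
  filter_upwards [measure_eq_zero_iff_ae_notMem.1 (volume_zeros_eq_zero hV hf hne)] with y hy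
  by_cases h0 : ρ y = 0
  · have hθy : θ y = 0 := by
      by_contra h
      have h2 : ρ p / 2 < ρ y := (hθV' (subset_tsupport _ h)).2
      linarith
    simp [h0, hθy]
  have hyV := hρV (subset_tsupport _ h0)
  obtain ⟨μ, ξ, hμ, h1, h2⟩ := topCoeff_iDDbar_logReg (K := K) hd (hf y hyV)
    (fun h => hy ⟨hyV, h⟩) (hQ y hyV) (hQ0 y hyV) (hε n)
  have hnn := topCoeff_rankOne_nonneg hd _ (hK y hyV) (hanti y hyV) (hpos y hyV) ξ
  have hkey : ρ p / 2 * c * (θ y * (μ * rankOne ξ v (Complex.I • v))) ≤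
      ρ y * (μ * topCoeff (fun v w => K y v w) (rankOne ξ)) := by
    by_cases hθy : θ y = 0
    · rw [hθy, zero_mul, mul_zero]
      exact mul_nonneg (hρ0 y) (mul_nonneg hμ hnn)
    have hyt := subset_tsupport _ hθy
    have hρy : ρ p / 2 ≤ ρ y := (le_of_lt (hθV' hyt).2)
    have hb := hcb y hyt ξ
    have hr : 0 ≤ rankOne ξ v (Complex.I • v) := by rw [rankOne_self]; positivity
    have e1 : ρ p / 2 * θ y ≤ ρ y * 1 := mul_le_mul hρy (hθ1 y) (hθ0 y) (hρ0 y)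
    calc ρ p / 2 * c * (θ y * (μ * rankOne ξ v (Complex.I • v)))
        = (ρ p / 2 * θ y) * (μ * (c * rankOne ξ v (Complex.I • v))) := by ring
      _ ≤ (ρ y * 1) * (μ * topCoeff (fun v w => K y v w) (rankOne ξ)) :=
        mul_le_mul e1 (mul_le_mul_of_nonneg_left hb hμ)
          (mul_nonneg hμ (mul_nonneg hc.le hr)) (by linarith [hρ0 y])
      _ = _ := by ring
  rw [h1, h2]
  linarith

end LocalIntegrals

section DegreeSign

open Filter Topology MeasureTheory

variable {d : ℕ} {X : Type u} [TopologicalSpace X] [ChartedSpace (Vec d) X]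
  [T2Space X] [CompactSpace X] [IsManifold 𝓘(ℂ, Vec d) ω X]

/-- If `⋀^d φ` is not locally zero, then the degree of `Ω¹_X` is nonnegative; it is positive if
`⋀^d φ` has zeros. -/
theorem FrameData.degree_nonneg (D : FrameData d X) (h : CotangentHermitianMetric d X)
    (hd : 0 < d) (κ : KahlerForm d X)
    (hne : ∀ i, ∀ y ∈ (chartAt (Vec d) i).target, (chartAt (Vec d) i).symm y ∈ D.W i →
      ¬ ∀ᶠ z in 𝓝 y, D.f i z = 0) :
    0 ≤ cotangentDegree κ h ∧ ∀ i, ∀ y ∈ (chartAt (Vec d) i).target,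
      (chartAt (Vec d) i).symm y ∈ D.W i → D.f i y = 0 → 0 < cotangentDegree κ h := by
  classical
  obtain ⟨P⟩ := exists_finitePartition (d := d) D.W D.isOpen_W D.mem_W
  have hat : ∀ i : X, chartAt (Vec d) i ∈ atlas (Vec d) X := chart_mem_atlas (Vec d)
  set e : X → OpenPartialHomeomorph X (Vec d) := fun i => chartAt (Vec d) i
  set V : X → Set (Vec d) := fun i => (e i).target ∩ (e i).symm ⁻¹' D.W i
  have hV : ∀ i, IsOpen (V i) := fun i => (e i).isOpen_inter_preimage_symm (D.isOpen_W i)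
  set ρ : X → Vec d → ℝ := fun i => (e i).target.indicator fun y => P.ψ i ((e i).symm y)
  have hsub : ∀ i ∈ P.t, tsupport (P.ψ i) ⊆ (e i).source := fun i hi =>
    (P.tsupport_subset i hi).trans (D.W_subset i)
  have hρ : ∀ i ∈ P.t, Continuous (ρ i) := fun i hi =>
    continuous_hat (hsub i hi) _ (fun y _ h => h) fun y hy _ =>
      (P.smooth i _ (hat i) y hy).continuousAt
  have hρc : ∀ i ∈ P.t, HasCompactSupport (ρ i) := fun i hi =>
    hasCompactSupport_hat (hsub i hi) _ (fun y _ h => h)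
  have hρV : ∀ i ∈ P.t, tsupport (ρ i) ⊆ V i := fun i hi => by
    refine (tsupport_hat_subset (hsub i hi) _ (fun y _ h => h)).trans ?_
    rintro _ ⟨q, hq, rfl⟩
    refine ⟨(e i).map_source (hsub i hi hq), ?_⟩
    rw [Set.mem_preimage, (e i).left_inv (hsub i hi hq)]
    exact P.tsupport_subset i hi hq
  have hρ0 : ∀ i y, 0 ≤ ρ i y := fun i y => Set.indicator_nonneg (fun _ _ => P.nonneg _ _) y
  set K : X → Vec d → Vec d →ₗ[ℝ] Vec d →ₗ[ℝ] ℝ := fun i y => pairingForm (κ.form (e i) y)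
  set Q : X → Vec d → ℝ := fun i => D.weight P h i
  set I : X → ℕ → ℝ := fun i n => ∫ y, ρ i y * topCoeff (fun v w => K i y v w)
      (iDDbar (logReg (D.f i) (Q i) (1 / ((n : ℝ) + 1))) y) with hI
  have hdeg : ∀ n : ℕ, 2 * Real.pi * cotangentDegree κ h = ∑ i ∈ P.t, I i n := fun n => by
    rw [D.degree_eq P h hd κ (ε := 1 / ((n : ℝ) + 1)) (by positivity)]
    refine Finset.sum_congr rfl fun i hi => ?_
    rw [hI, ← integral_indicator (e i).open_target.measurableSet]
    refine integral_congr_ae (Eventually.of_forall fun y => ?_)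
    by_cases hy : y ∈ (e i).target
    · simp only [ρ, Set.indicator_of_mem hy]; rfl
    · simp only [ρ, Set.indicator_of_notMem hy]; rw [zero_mul]
  have hlow : ∀ i ∈ P.t, ∃ L : ℕ → ℝ, Tendsto L atTop (𝓝 0) ∧ ∀ n, L n ≤ I i n := fun i hi =>
    exists_tendsto_zero_le_integral (K := K i) hd (hV i) (fun y hy => D.f_an i y hy.1 hy.2)
      (fun y hy => D.contDiffAt_weight P h i hy.1 hy.2) (fun y hy => D.weight_pos P h i hy.1 hy.2)
      (fun y hy => hne i y hy.1 hy.2) (fun y hy v w => κ.continuousAt_pairing (hat i) hy.1 v w)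
      (fun y hy => κ.pairing_I (hat i) hy.1) (fun y _ => pairing_antisymm _)
      (fun y hy => κ.positive _ (hat i) y hy.1) (hρ i hi) (hρc i hi) (hρV i hi) (hρ0 i)
  have hfinal : ∀ G : X → ℝ, (∀ i ∈ P.t, ∃ L : ℕ → ℝ, Tendsto L atTop (𝓝 (G i)) ∧
      ∀ n, L n ≤ I i n) → ∑ i ∈ P.t, G i ≤ 2 * Real.pi * cotangentDegree κ h := by
    intro G hG
    choose! L hL hLI using hG
    refine le_of_tendsto' (tendsto_finsetSum P.t fun i hi => hL i hi) fun n => ?_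
    rw [hdeg n]
    exact Finset.sum_le_sum fun i hi => hLI i hi n
  have hpi := Real.pi_pos
  refine ⟨?_, fun i y hy hyW hf0 => ?_⟩
  · have := hfinal (fun _ => 0) hlow
    rw [Finset.sum_const_zero] at this
    by_contra! hcon
    nlinarith
  · obtain ⟨k, hk, hψk⟩ : ∃ k ∈ P.t, P.ψ k ((e i).symm y) ≠ 0 := by
      by_contra! hcon
      have h1 := P.sum_eq_one ((e i).symm y)
      rw [Finset.sum_eq_zero hcon] at h1
      exact zero_ne_one h1
    have hkW := P.tsupport_subset k hk (subset_tsupport _ hψk)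
    have hks := D.W_subset k hkW
    have hfk : D.f k (e k ((e i).symm y)) = 0 := by
      have h1 := D.f_trans i k y hy hyW hkW
      rw [hf0, zero_mul] at h1
      exact (mul_eq_zero.1 h1.symm).resolve_right
        (jac_ne_zero h (hat i) (hat k) hy hks)
    set p := e k ((e i).symm y)
    have hpt : p ∈ (e k).target := (e k).map_source hks
    have hps : (e k).symm p = (e i).symm y := (e k).left_inv hks
    have hpV : p ∈ V k := ⟨hpt, by rw [Set.mem_preimage, hps]; exact hkW⟩
    have hρp : 0 < ρ k p := by
      simp only [ρ, Set.indicator_of_mem hpt, hps]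
      exact lt_of_le_of_ne (P.nonneg _ _) (Ne.symm hψk)
    obtain ⟨L, G, hG, hL, hLI⟩ :=
      exists_tendsto_pos_le_integral (K := K k) hd (hV k) (fun y hy => D.f_an k y hy.1 hy.2)
        (fun y hy => D.contDiffAt_weight P h k hy.1 hy.2)
        (fun y hy => D.weight_pos P h k hy.1 hy.2)
        (fun y hy => hne k y hy.1 hy.2) (fun y hy v w => κ.continuousAt_pairing (hat k) hy.1 v w)
        (fun y hy => κ.pairing_I (hat k) hy.1) (fun y _ => pairing_antisymm _)
        (fun y hy => κ.positive _ (hat k) y hy.1) (hρ k hk) (hρc k hk) (hρV k hk) (hρ0 k)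
        hpV hfk hρp
    have := hfinal (fun j => if j = k then G else 0) fun j hj => by
      by_cases hjk : j = k
      · subst hjk
        rw [if_pos rfl]
        exact ⟨L, hL, hLI⟩
      · rw [if_neg hjk]; exact hlow j hj
    rw [Finset.sum_ite_eq' P.t k, if_pos hk] at this
    by_contra! hcon
    nlinarith

end DegreeSign

/-! ### Determinant and trace of endomorphisms of `ℂ^d` -/

section DetTrace

open Filter Topology

variable {d : ℕ}

/-- The determinant of an endomorphism. -/
def detE (L : EndVec d) : ℂ := LinearMap.det L.toLinearMap

/-- The trace of an endomorphism. -/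
def traceE : EndVec d →L[ℂ] ℂ :=
  LinearMap.toContinuousLinearMap ((LinearMap.trace ℂ (Vec d)).comp (ContinuousLinearMap.coeLM ℂ))

theorem traceE_apply (L : EndVec d) : traceE L = LinearMap.trace ℂ (Vec d) L.toLinearMap := rfl

theorem detE_eq (L : EndVec d) : detE L = (LinearMap.toMatrix' L.toLinearMap).det :=
  (LinearMap.det_toMatrix' _).symm

theorem detE_mul (L M : EndVec d) : detE (L * M) = detE L * detE M :=
  LinearMap.det_comp _ _

theorem detE_one : detE (1 : EndVec d) = 1 := LinearMap.det_id

theorem detE_units_ne_zero (g : GLVec d) : detE (g : EndVec d) ≠ 0 := by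
  intro h
  have := detE_mul (g : EndVec d) ((g⁻¹ : GLVec d) : EndVec d)
  rw [Units.mul_inv, detE_one, h, zero_mul] at this
  exact one_ne_zero this

theorem contDiff_detE : ContDiff ℂ ω (detE : EndVec d → ℂ) := by
  have : (detE : EndVec d → ℂ) = fun L => (LinearMap.toMatrix' L.toLinearMap).det :=
    funext detE_eq
  rw [this, contDiff_iff_contDiffAt]
  intro L
  refine contDiffAt_matrix_det fun i j => ?_
  have h2 : ContDiffAt ℂ ω (fun L : EndVec d => L (Pi.single j 1)) L :=
    contDiffAt_id.clm_apply contDiffAt_const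
  refine (contDiffAt_pi.1 h2 i).congr_of_eventuallyEq (Eventually.of_forall fun z => ?_)
  simp [LinearMap.toMatrix'_apply]

theorem fderiv_detE_one (M : EndVec d) : fderiv ℂ detE 1 M = traceE M := by
  have h1 : HasFDerivAt detE (fderiv ℂ detE (1 : EndVec d)) ((1 : EndVec d) + (0 : ℂ) • M) := by
    have : (1 : EndVec d) + (0 : ℂ) • M = 1 := by
      rw [show (0 : ℂ) • M = 0 from zero_smul ℂ M, add_zero]
    rw [this]
    exact (contDiff_detE.differentiable (by simp) 1).hasFDerivAt
  have h2 : HasDerivAt (fun t : ℂ => (1 : EndVec d) + t • M) M 0 := by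
    simpa using ((hasDerivAt_id (0 : ℂ)).smul_const M).const_add 1
  have h3 := h1.comp_hasDerivAt (0 : ℂ) h2
  set m := LinearMap.toMatrix' M.toLinearMap
  have e : (detE ∘ fun t : ℂ => (1 : EndVec d) + t • M) = fun t => (1 : ℂ) + Matrix.trace m * t +
      (Matrix.det (1 + (Polynomial.X : Polynomial ℂ) • m.map Polynomial.C)).divX.divX.eval t
        * t ^ 2 := by
    funext t
    rw [← Matrix.det_one_add_smul, Function.comp_apply, detE_eq]
    congr 1
    have : ((1 : EndVec d) + t • M).toLinearMap = LinearMap.id + t • M.toLinearMap := rfl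
    rw [this, map_add, map_smul, LinearMap.toMatrix'_id]
  rw [e] at h3
  set q := (Matrix.det (1 + (Polynomial.X : Polynomial ℂ) • m.map Polynomial.C)).divX.divX
  have h4 := (((hasDerivAt_id (0 : ℂ)).const_mul (Matrix.trace m)).const_add 1).add
    ((q.hasDerivAt 0).mul (hasDerivAt_pow 2 (0 : ℂ)))
  have h5 := h3.unique h4
  rw [h5, traceE_apply, LinearMap.trace_eq_matrix_trace ℂ (Pi.basisFun ℂ (Fin d))]
  simp [m, LinearMap.toMatrix_eq_toMatrix']

theorem fderiv_detE_comp {E : Type*} [NormedAddCommGroup E] [NormedSpace ℂ E] {g : E → GLVec d}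
    {y : E} (hg : DifferentiableAt ℂ (fun z => (g z : EndVec d)) y) (v : E) :
    fderiv ℂ (fun z => detE (g z : EndVec d)) y v / detE (g y : EndVec d) =
      traceE ((((g y)⁻¹ : GLVec d) : EndVec d) * fderiv ℂ (fun z => (g z : EndVec d)) y v) := by
  have h1 : HasFDerivAt (fun z => (((g y)⁻¹ : GLVec d) : EndVec d) * (g z : EndVec d)) _ y :=
    hg.hasFDerivAt.const_mul _
  have h2 : HasFDerivAt detE (fderiv ℂ detE (1 : EndVec d))
      ((((g y)⁻¹ : GLVec d) : EndVec d) * (g y : EndVec d)) := by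
    rw [Units.inv_mul]
    exact (contDiff_detE.differentiable (by simp) 1).hasFDerivAt
  have h3 := (h2.comp y h1).const_mul (detE (g y : EndVec d))
  have e : (fun z => detE (g y : EndVec d) *
      (detE ∘ fun z => (((g y)⁻¹ : GLVec d) : EndVec d) * (g z : EndVec d)) z) =
      fun z => detE (g z : EndVec d) := by
    funext z
    rw [Function.comp_apply, ← detE_mul, ← mul_assoc, Units.mul_inv, one_mul]
  rw [e] at h3
  rw [h3.fderiv]
  simp only [_root_.smul_apply, ContinuousLinearMap.comp_apply, smul_eq_mul]
  rw [mul_div_cancel_left₀ _ (detE_units_ne_zero _), fderiv_detE_one]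

theorem traceE_conj (g : GLVec d) (A : EndVec d) :
    traceE ((g : EndVec d) * A * ((g⁻¹ : GLVec d) : EndVec d)) = traceE A := by
  have h : ∀ A B : EndVec d, traceE (A * B) = traceE (B * A) := fun A B =>
    LinearMap.trace_mul_comm ℂ A.toLinearMap B.toLinearMap
  rw [h, ← mul_assoc, Units.inv_mul, one_mul]

end DetTrace

/-! ### Pulling back the Cartan form -/

section Pullback

open Filter Topology

variable {d : ℕ} {X : Type u} [TopologicalSpace X] [ChartedSpace (Vec d) X]

theorem mfderiv_units_val (g : GLVec d) :
    mfderiv 𝓘(ℂ, EndVec d) 𝓘(ℂ, EndVec d) (Units.val : GLVec d → EndVec d) g =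
      ContinuousLinearMap.id ℂ (EndVec d) := by
  refine HasMFDerivAt.mfderiv ⟨Units.continuous_val.continuousAt, ?_⟩
  refine HasFDerivWithinAt.congr_of_eventuallyEq (hasFDerivWithinAt_id _ _) ?_ ?_
  · have : Set.range (Units.val : GLVec d → EndVec d) ∈
        𝓝 (extChartAt 𝓘(ℂ, EndVec d) g g) := by
      exact Units.isOpenEmbedding_val.isOpen_range.mem_nhds ⟨g, rfl⟩
    filter_upwards [mem_nhdsWithin_of_mem_nhds this] with z hz
    obtain ⟨k, rfl⟩ := hz
    have hk : (extChartAt 𝓘(ℂ, EndVec d) g).symm (k : EndVec d) = k := by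
      have := (extChartAt 𝓘(ℂ, EndVec d) g).left_inv (x := k) (by simp)
      exact this
    change Units.val ((extChartAt 𝓘(ℂ, EndVec d) g).symm (k : EndVec d)) = (k : EndVec d)
    rw [hk]
  · change Units.val ((extChartAt 𝓘(ℂ, EndVec d) g).symm (extChartAt 𝓘(ℂ, EndVec d) g g)) =
      (g : EndVec d)
    rw [extChartAt_to_inv]

theorem mfderiv_units {k : Vec d → GLVec d} {y : Vec d}
    (hk : MDifferentiableAt 𝓘(ℂ, Vec d) 𝓘(ℂ, EndVec d) k y) (v : Vec d) :
    (mfderiv 𝓘(ℂ, Vec d) 𝓘(ℂ, EndVec d) k y v : EndVec d) =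
      fderiv ℂ (fun z => (k z : EndVec d)) y v := by
  have h1 := mfderiv_comp_apply (I := 𝓘(ℂ, Vec d)) (I' := 𝓘(ℂ, EndVec d)) (I'' := 𝓘(ℂ, EndVec d)) y
    ((Units.contMDiff_val (𝕜 := ℂ) (n := 1)).mdifferentiable (by norm_num) (k y)) hk v
  rw [mfderiv_units_val, mfderiv_eq_fderiv] at h1
  exact h1.symm

variable (Q : BranchedAffineStructure.{u, v} d X)

/-- The form `θ` in terms of the model vector space of the total space. -/
def BranchedAffineStructure.theta (p : Q.bundle.Total) : (Vec d × EndVec d) →L[ℂ] AffLie d := Q.θ p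

/-- The pull-back of `θ` under a map from `ℂ^d` to the total space. -/
def BranchedAffineStructure.pull (s : Vec d → Q.bundle.Total) (z : Vec d) :
    Vec d →L[ℂ] AffLie d :=
  (Q.theta (s z)).comp (mfderiv 𝓘(ℂ, Vec d) (bundleModel d) s z :
    Vec d →L[ℂ] (Vec d × EndVec d))

/-- The fundamental vector field of `A` at `p`. -/
def BranchedAffineStructure.fund (p : Q.bundle.Total) (A : EndVec d) : Vec d × EndVec d :=
  mfderiv 𝓘(ℂ, EndVec d) (bundleModel d) (fun g : GLVec d => Q.bundle.act p g) 1 A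

theorem BranchedAffineStructure.theta_fund (p : Q.bundle.Total) (A : EndVec d) :
    Q.theta p (Q.fund p A) = (0, A) := by
  have h : Q.theta (Q.bundle.act p 1) (Q.fund p A) = (0, A) := Q.vertical p A
  rwa [Q.bundle.act_one] at h

theorem BranchedAffineStructure.pull_comp {s : Vec d → Q.bundle.Total} {F : Vec d → Vec d}
    {z : Vec d} (hs : MDifferentiableAt 𝓘(ℂ, Vec d) (bundleModel d) s (F z))
    (hF : DifferentiableAt ℂ F z) (v : Vec d) :
    Q.pull (fun y => s (F y)) z v = Q.pull s (F z) (fderiv ℂ F z v) := by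
  have h := mfderiv_comp_apply (I := 𝓘(ℂ, Vec d)) (I' := 𝓘(ℂ, Vec d)) (I'' := bundleModel d) z
    hs hF.mdifferentiableAt v
  rw [mfderiv_eq_fderiv] at h
  exact congrArg (Q.theta (s (F z))) h

theorem BranchedAffineStructure.pull_act {s : Vec d → Q.bundle.Total} {g : Vec d → GLVec d}
    {z : Vec d} (hs : MDifferentiableAt 𝓘(ℂ, Vec d) (bundleModel d) s z)
    (hg : MDifferentiableAt 𝓘(ℂ, Vec d) 𝓘(ℂ, EndVec d) g z) (v : Vec d) :
    Q.pull (fun y => Q.bundle.act (s y) (g y)) z v = Ad (g z)⁻¹ (Q.pull s z v) +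
      (0, (((g z)⁻¹ : GLVec d) : EndVec d) * fderiv ℂ (fun y => (g y : EndVec d)) z v) := by
  set p := Q.bundle.act (s z) (g z) with hp
  set k : Vec d → GLVec d := fun y => (g z)⁻¹ * g y with hk
  set r : Vec d → Q.bundle.Total := fun y => Q.bundle.act (s y) (g z) with hr
  have hact := Q.bundle.holomorphic_act
  have hactd : MDifferentiable ((bundleModel d).prod 𝓘(ℂ, EndVec d)) (bundleModel d)
      (fun q : Q.bundle.Total × GLVec d => Q.bundle.act q.1 q.2) :=
    hact.mdifferentiable (by simp)
  have hR : MDifferentiable (bundleModel d) (bundleModel d) (fun q => Q.bundle.act q (g z)) :=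
    fun q => (hactd (q, g z)).comp (I' := (bundleModel d).prod 𝓘(ℂ, EndVec d)) q
      (mdifferentiableAt_id.prodMk mdifferentiableAt_const)
  have hkd : MDifferentiableAt 𝓘(ℂ, Vec d) 𝓘(ℂ, EndVec d) k z :=
    ((contMDiff_mul_left (I := 𝓘(ℂ, EndVec d)) (n := 1) (a := (g z)⁻¹)).mdifferentiable
      (by norm_num) (g z)).comp (I' := 𝓘(ℂ, EndVec d)) z hg
  have hrd : MDifferentiableAt 𝓘(ℂ, Vec d) (bundleModel d) r z :=
    (hR (s z)).comp (I' := bundleModel d) z hs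
  have hk1 : k z = 1 := by simp [hk]
  have hfun : (fun y => Q.bundle.act (s y) (g y)) =
      (fun q : Q.bundle.Total × GLVec d => Q.bundle.act q.1 q.2) ∘ fun y => (r y, k y) := by
    funext y
    simp only [Function.comp_apply, hr, hk]
    rw [← Q.bundle.act_mul, mul_inv_cancel_left]
  have hd1 := mfderiv_comp_apply (I := 𝓘(ℂ, Vec d)) (I' := (bundleModel d).prod 𝓘(ℂ, EndVec d))
    (I'' := bundleModel d) z (hactd (r z, k z)) (hrd.prodMk hkd) v
  rw [mfderiv_prodMk hrd hkd, mfderiv_prod_eq_add_apply (hactd (r z, k z)), ← hfun] at hd1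
  have hid : (fun q : Q.bundle.Total => Q.bundle.act q 1) = id := funext Q.bundle.act_one
  have hd2 := mfderiv_comp_apply (I := 𝓘(ℂ, Vec d)) (I' := bundleModel d) (I'' := bundleModel d) z
    (hR (s z)) hs v
  set w : Vec d × EndVec d := mfderiv 𝓘(ℂ, Vec d) (bundleModel d) r z v with hw
  set B : EndVec d := mfderiv 𝓘(ℂ, Vec d) 𝓘(ℂ, EndVec d) k z v with hB
  have hBv : B = (((g z)⁻¹ : GLVec d) : EndVec d) * fderiv ℂ (fun y => (g y : EndVec d)) z v := by
    have hgd : DifferentiableAt ℂ (fun y => (g y : EndVec d)) z := by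
      rw [← mdifferentiableAt_iff_differentiableAt]
      exact ((Units.contMDiff_val (𝕜 := ℂ) (n := 1)).mdifferentiable (by norm_num) (g z)).comp
        (I' := 𝓘(ℂ, EndVec d)) z hg
    have h1 : HasFDerivAt (fun y => (k y : EndVec d)) _ z :=
      hgd.hasFDerivAt.const_mul (((g z)⁻¹ : GLVec d) : EndVec d)
    rw [hB, mfderiv_units hkd, h1.fderiv]
    rfl
  have hact1 : ∀ u : GLVec d, u = 1 → @Eq (Vec d × EndVec d)
      (mfderiv (bundleModel d) (bundleModel d) (fun q => Q.bundle.act q u) (r z) w) w := by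
    rintro _ rfl
    rw [hid, mfderiv_id]
    rfl
  have hact2 : ∀ u : GLVec d, u = 1 → @Eq (Vec d × EndVec d)
      (mfderiv 𝓘(ℂ, EndVec d) (bundleModel d) (fun g => Q.bundle.act (r z) g) u B)
      (Q.fund (r z) B) := by
    rintro _ rfl
    rfl
  have hd3 : Q.pull (fun y => Q.bundle.act (s y) (g y)) z v =
      Q.theta p (w + Q.fund (r z) B) :=
    congrArg (Q.theta p) (hd1.trans (congrArg₂ (fun a b : Vec d × EndVec d => a + b)
      (hact1 _ hk1) (hact2 _ hk1)))
  have hd4 : Q.theta p w = Ad (g z)⁻¹ (Q.pull s z v) :=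
    (congrArg (Q.theta p) hd2).trans (Q.equivariant (g z) (s z) _)
  rw [hd3, ← hBv]
  have hd5 : Q.theta p (Q.fund (r z) B) = (0, B) := Q.theta_fund p B
  rw [map_add, hd5]
  exact congrArg (· + ((0, B) : AffLie d)) hd4

theorem BranchedAffineStructure.contDiffOn_pull {V : Set (Vec d)} (hV : IsOpen V)
    {s : Vec d → Q.bundle.Total} (hs : ContMDiffOn 𝓘(ℂ, Vec d) (bundleModel d) ω s V) :
    ContDiffOn ℂ ω (Q.pull s) V := by
  rw [contDiffOn_clm_apply]
  intro v
  have h1 := hs.contMDiffOn_tangentMapWithin (m := ω) (by simp) hV.uniqueMDiffOn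
  have h2 : ContMDiff 𝓘(ℂ, Vec d) 𝓘(ℂ, Vec d).tangent ω
      (fun z : Vec d => (⟨z, v⟩ : TangentBundle 𝓘(ℂ, Vec d) (Vec d))) :=
    contMDiff_vectorSpace_iff_contDiff.2 contDiff_const
  have h3 := (Q.holomorphic.comp_contMDiffOn h1).comp h2.contMDiffOn (s := V) (fun z hz => hz)
  refine (contMDiffOn_iff_contDiffOn.1 h3).congr fun z hz => ?_
  simp only [Function.comp_apply, tangentMapWithin]
  rw [mfderivWithin_of_isOpen hV hz]
  rfl

end Pullback

section LocalFrames

open Filter Topology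

variable {d : ℕ} {X : Type u} [TopologicalSpace X] [ChartedSpace (Vec d) X]

namespace HolPrincipalBundle

variable (B : HolPrincipalBundle.{u, v} d X)

/-- A neighbourhood of `x` over which the bundle is trivial. -/
def trivNhd (x : X) : Set X := (B.locally_trivial x).choose

theorem isOpen_trivNhd (x : X) : IsOpen (B.trivNhd x) := (B.locally_trivial x).choose_spec.1

theorem mem_trivNhd (x : X) : x ∈ B.trivNhd x := (B.locally_trivial x).choose_spec.2.1

/-- A local trivialization around `x`. -/
def triv (x : X) : OpenPartialHomeomorph B.Total (X × GLVec d) :=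
  (B.locally_trivial x).choose_spec.2.2.choose

theorem triv_source (x : X) : (B.triv x).source = B.proj ⁻¹' B.trivNhd x :=
  (B.locally_trivial x).choose_spec.2.2.choose_spec.1

theorem triv_target (x : X) : (B.triv x).target = B.trivNhd x ×ˢ Set.univ :=
  (B.locally_trivial x).choose_spec.2.2.choose_spec.2.1

theorem contMDiffOn_triv (x : X) : ContMDiffOn (bundleModel d)
    (𝓘(ℂ, Vec d).prod 𝓘(ℂ, EndVec d)) ω (B.triv x) (B.triv x).source :=
  (B.locally_trivial x).choose_spec.2.2.choose_spec.2.2.1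

theorem contMDiffOn_triv_symm (x : X) : ContMDiffOn (𝓘(ℂ, Vec d).prod 𝓘(ℂ, EndVec d))
    (bundleModel d) ω (B.triv x).symm (B.triv x).target :=
  (B.locally_trivial x).choose_spec.2.2.choose_spec.2.2.2.1

theorem triv_fst (x : X) {p : B.Total} (hp : B.proj p ∈ B.trivNhd x) :
    (B.triv x p).1 = B.proj p :=
  ((B.locally_trivial x).choose_spec.2.2.choose_spec.2.2.2.2 p
    (by have := B.triv_source x; rw [triv] at this; rw [this]; exact hp)).1

theorem triv_act (x : X) {p : B.Total} (hp : B.proj p ∈ B.trivNhd x) (g : GLVec d) :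
    B.triv x (B.act p g) = ((B.triv x p).1, (B.triv x p).2 * g) :=
  ((B.locally_trivial x).choose_spec.2.2.choose_spec.2.2.2.2 p
    (by have := B.triv_source x; rw [triv] at this; rw [this]; exact hp)).2 g

/-- The local section given by a local trivialization. -/
def frame (x q : X) : B.Total := (B.triv x).symm (q, 1)

theorem mem_triv_target (x : X) {q : X} (hq : q ∈ B.trivNhd x) (g : GLVec d) :
    (q, g) ∈ (B.triv x).target := by
  rw [triv_target]; exact ⟨hq, trivial⟩

theorem triv_frame (x : X) {q : X} (hq : q ∈ B.trivNhd x) : B.triv x (B.frame x q) = (q, 1) :=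
  (B.triv x).right_inv (B.mem_triv_target x hq 1)

theorem frame_mem_source (x : X) {q : X} (hq : q ∈ B.trivNhd x) :
    B.frame x q ∈ (B.triv x).source := (B.triv x).map_target (B.mem_triv_target x hq 1)

theorem proj_frame (x : X) {q : X} (hq : q ∈ B.trivNhd x) : B.proj (B.frame x q) = q := by
  have h1 := B.frame_mem_source x hq
  rw [triv_source] at h1
  rw [← B.triv_fst x h1, B.triv_frame x hq]

theorem act_frame (x : X) {p : B.Total} (hp : B.proj p ∈ B.trivNhd x) :
    B.act (B.frame x (B.proj p)) (B.triv x p).2 = p := by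
  have hf := B.proj_frame x hp
  refine (B.triv x).injOn ?_ ?_ ?_
  · rw [triv_source, Set.mem_preimage, B.proj_act, hf]; exact hp
  · rw [triv_source]; exact hp
  · rw [B.triv_act x (by rw [hf]; exact hp), B.triv_frame x hp, one_mul]
    exact Prod.ext (B.triv_fst x hp).symm rfl

/-- The transition functions. -/
def trans (i j q : X) : GLVec d := (B.triv j (B.frame i q)).2

theorem frame_eq (i j : X) {q : X} (hi : q ∈ B.trivNhd i) (hj : q ∈ B.trivNhd j) :
    B.frame i q = B.act (B.frame j q) (B.trans i j q) := by
  have h := B.act_frame j (p := B.frame i q) (by rw [B.proj_frame i hi]; exact hj)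
  rw [B.proj_frame i hi] at h
  exact h.symm

theorem trans_mul (i j k : X) {q : X} (hi : q ∈ B.trivNhd i) (hj : q ∈ B.trivNhd j)
    (hk : q ∈ B.trivNhd k) : B.trans i k q = B.trans j k q * B.trans i j q := by
  conv_lhs => rw [trans, B.frame_eq i j hi hj]
  rw [B.triv_act k (by rw [B.proj_frame j hj]; exact hk)]
  rfl

/-- The domain of definition of the local frame with index `i`, inside the chart at `i`. -/
def dom (i : X) : Set X := B.trivNhd i ∩ (chartAt (Vec d) i).source

/-- The local frame in the chart. -/
def chartFrame (i : X) (z : Vec d) : B.Total := B.frame i ((chartAt (Vec d) i).symm z)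

theorem isOpen_dom (i : X) : IsOpen (B.dom i) :=
  (B.isOpen_trivNhd i).inter (chartAt (Vec d) i).open_source

variable [IsManifold 𝓘(ℂ, Vec d) ω X]

theorem contMDiffAt_chart_symm (i : X) {z : Vec d} (hz : z ∈ (chartAt (Vec d) i).target) :
    ContMDiffAt 𝓘(ℂ, Vec d) 𝓘(ℂ, Vec d) ω (chartAt (Vec d) i).symm z :=
  contMDiffOn_chart_symm.contMDiffAt ((chartAt (Vec d) i).open_target.mem_nhds hz)

theorem contMDiffAt_chartFrame (i : X) {z : Vec d} (hz : z ∈ (chartAt (Vec d) i).target)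
    (hW : (chartAt (Vec d) i).symm z ∈ B.dom i) :
    ContMDiffAt 𝓘(ℂ, Vec d) (bundleModel d) ω (B.chartFrame i) z := by
  have h1 : ContMDiffAt 𝓘(ℂ, Vec d) (𝓘(ℂ, Vec d).prod 𝓘(ℂ, EndVec d)) ω
      (fun z => ((chartAt (Vec d) i).symm z, (1 : GLVec d))) z :=
    (contMDiffAt_chart_symm i hz).prodMk contMDiffAt_const
  have h2 : ContMDiffAt (𝓘(ℂ, Vec d).prod 𝓘(ℂ, EndVec d)) (bundleModel d) ω (B.triv i).symm
      ((chartAt (Vec d) i).symm z, (1 : GLVec d)) :=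
    (B.contMDiffOn_triv_symm i).contMDiffAt ((B.triv i).open_target.mem_nhds
      (B.mem_triv_target i hW.1 1))
  exact ContMDiffAt.comp (g := (B.triv i).symm)
    (f := fun z => ((chartAt (Vec d) i).symm z, (1 : GLVec d))) z h2 h1

theorem contMDiffAt_trans (i j : X) {z : Vec d} (hz : z ∈ (chartAt (Vec d) i).target)
    (hW : (chartAt (Vec d) i).symm z ∈ B.dom i) (hj : (chartAt (Vec d) i).symm z ∈ B.dom j) :
    ContMDiffAt 𝓘(ℂ, Vec d) 𝓘(ℂ, EndVec d) ω
      (fun y => B.trans i j ((chartAt (Vec d) i).symm y)) z := by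
  have hsrc : B.chartFrame i z ∈ (B.triv j).source := by
    rw [triv_source, Set.mem_preimage, chartFrame, B.proj_frame i hW.1]; exact hj.1
  have h2 := (B.contMDiffOn_triv j).contMDiffAt ((B.triv j).open_source.mem_nhds hsrc)
  have h3 := h2.comp z (B.contMDiffAt_chartFrame i hz hW)
  exact contMDiffAt_snd.comp z h3

end HolPrincipalBundle

namespace BranchedAffineStructure

variable (Q : BranchedAffineStructure.{u, v} d X)

/-- The Cartan form in a local frame. -/
def form (i : X) : Vec d → Vec d →L[ℂ] AffLie d := Q.pull (Q.bundle.chartFrame i)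

/-- The homomorphism `φ` in a local frame. -/
def phi (i : X) (z : Vec d) : EndVec d := (ContinuousLinearMap.fst ℂ _ _).comp (Q.form i z)

theorem pull_congr {s s' : Vec d → Q.bundle.Total} {z : Vec d} (h : s =ᶠ[𝓝 z] s') :
    Q.pull s z = Q.pull s' z := by
  have h1 : @Eq (Vec d →L[ℂ] (Vec d × EndVec d)) (mfderiv 𝓘(ℂ, Vec d) (bundleModel d) s z)
      (mfderiv 𝓘(ℂ, Vec d) (bundleModel d) s' z) := h.mfderiv_eq
  unfold pull
  exact congrArg₂ (fun (a : (Vec d × EndVec d) →L[ℂ] AffLie d)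
    (b : Vec d →L[ℂ] (Vec d × EndVec d)) => a.comp b) (by rw [h.self_of_nhds]) h1

variable [IsManifold 𝓘(ℂ, Vec d) ω X]

theorem contDiffAt_form (i : X) {z : Vec d} (hz : z ∈ (chartAt (Vec d) i).target)
    (hW : (chartAt (Vec d) i).symm z ∈ Q.bundle.dom i) : ContDiffAt ℂ ω (Q.form i) z := by
  have hV := (chartAt (Vec d) i).isOpen_inter_preimage_symm (Q.bundle.isOpen_dom i)
  exact (Q.contDiffOn_pull hV fun y hy =>
    (Q.bundle.contMDiffAt_chartFrame i hy.1 hy.2).contMDiffWithinAt).contDiffAt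
      (hV.mem_nhds ⟨hz, hW⟩)

theorem form_trans (i j : X) {z : Vec d} (hz : z ∈ (chartAt (Vec d) i).target)
    (hW : (chartAt (Vec d) i).symm z ∈ Q.bundle.dom i)
    (hj : (chartAt (Vec d) i).symm z ∈ Q.bundle.dom j) (v : Vec d) :
    Q.form i z v = Ad (Q.bundle.trans i j ((chartAt (Vec d) i).symm z))⁻¹
        (Q.form j (chartAt (Vec d) j ((chartAt (Vec d) i).symm z))
          (fderiv ℂ (fun y => chartAt (Vec d) j ((chartAt (Vec d) i).symm y)) z v)) +
      (0, (((Q.bundle.trans i j ((chartAt (Vec d) i).symm z))⁻¹ : GLVec d) : EndVec d) *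
        fderiv ℂ (fun y => (Q.bundle.trans i j ((chartAt (Vec d) i).symm y) : EndVec d)) z v) := by
  have hF := (contDiffAt_transition (chart_mem_atlas (Vec d) i) (chart_mem_atlas (Vec d) j) hz
    hj.2).differentiableAt (by simp)
  have hjt := (chartAt (Vec d) j).map_source hj.2
  have hjW : (chartAt (Vec d) j).symm (chartAt (Vec d) j ((chartAt (Vec d) i).symm z)) ∈
      Q.bundle.dom j := by rwa [(chartAt (Vec d) j).left_inv hj.2]
  have hs := (Q.bundle.contMDiffAt_chartFrame j hjt hjW).mdifferentiableAt (by simp)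
  have hg := (Q.bundle.contMDiffAt_trans i j hz hW hj).mdifferentiableAt (by simp)
  have hev : Q.bundle.chartFrame i =ᶠ[𝓝 z] fun y => Q.bundle.act
      (Q.bundle.chartFrame j (chartAt (Vec d) j ((chartAt (Vec d) i).symm y)))
      (Q.bundle.trans i j ((chartAt (Vec d) i).symm y)) := by
    filter_upwards [eventually_transition hz ((Q.bundle.isOpen_dom i).inter
      (Q.bundle.isOpen_dom j)) ⟨hW, hj⟩] with y hy
    rw [HolPrincipalBundle.chartFrame, HolPrincipalBundle.chartFrame,
      (chartAt (Vec d) j).left_inv hy.2.2.2]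
    exact Q.bundle.frame_eq i j hy.2.1.1 hy.2.2.1
  rw [form, Q.pull_congr hev, Q.pull_act (s := fun y => Q.bundle.chartFrame j
    (chartAt (Vec d) j ((chartAt (Vec d) i).symm y))) (MDifferentiableAt.comp
    (g := Q.bundle.chartFrame j) z hs hF.mdifferentiableAt) hg,
    Q.pull_comp hs hF]
  rfl

/-- The local expressions of a branched holomorphic affine structure. -/
def frameData : FrameData d X where
  W := Q.bundle.dom
  isOpen_W := Q.bundle.isOpen_dom
  mem_W x := ⟨Q.bundle.mem_trivNhd x, mem_chart_source (Vec d) x⟩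
  W_subset x := Set.inter_subset_right
  f i z := detE (Q.phi i z)
  a i z := traceE.comp ((ContinuousLinearMap.snd ℂ _ _).comp (Q.form i z))
  γ i j q := detE (Q.bundle.trans i j q : EndVec d)
  f_an i y hy hW := contDiff_detE.contDiffAt.comp y
    (contDiffAt_const.clm_comp (Q.contDiffAt_form i hy hW))
  a_an i y hy hW := contDiffAt_const.clm_comp
    (contDiffAt_const.clm_comp (Q.contDiffAt_form i hy hW))
  γ_an i j y hy hi hj := contDiff_detE.contDiffAt.comp y (contMDiffAt_iff_contDiffAt.1
    ((Units.contMDiff_val (𝕜 := ℂ)).contMDiffAt.comp y (Q.bundle.contMDiffAt_trans i j hy hi hj)))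
  γ_ne i j q _ _ := detE_units_ne_zero _
  γ_mul i j k q hi hj hk := by
    rw [Q.bundle.trans_mul i j k hi.1 hj.1 hk.1, Units.val_mul, detE_mul]
  f_trans i j y hy hi hj := by
    have h : Q.phi i y = (((Q.bundle.trans i j ((chartAt (Vec d) i).symm y))⁻¹ : GLVec d) :
        EndVec d) * (Q.phi j (chartAt (Vec d) j ((chartAt (Vec d) i).symm y)) *
        fderiv ℂ (fun z => chartAt (Vec d) j ((chartAt (Vec d) i).symm z)) y) := by
      refine ContinuousLinearMap.ext fun v => ?_
      have := congrArg Prod.fst (Q.form_trans i j hy hi hj v)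
      refine this.trans ?_
      simp [Ad, phi]
    rw [h, detE_mul, detE_mul]
    have h2 := detE_mul (((Q.bundle.trans i j ((chartAt (Vec d) i).symm y))⁻¹ : GLVec d) :
        EndVec d) (Q.bundle.trans i j ((chartAt (Vec d) i).symm y) : EndVec d)
    rw [Units.inv_mul, detE_one] at h2
    rw [mul_right_comm, ← h2, one_mul]
    rfl
  a_trans i j y hy hi hj v := by
    have hg : DifferentiableAt ℂ
        (fun z => (Q.bundle.trans i j ((chartAt (Vec d) i).symm z) : EndVec d)) y :=
      (contMDiffAt_iff_contDiffAt.1 ((Units.contMDiff_val (𝕜 := ℂ)).contMDiffAt.comp y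
        (Q.bundle.contMDiffAt_trans i j hy hi hj))).differentiableAt (by simp)
    rw [fderiv_detE_comp hg]
    simp only [ContinuousLinearMap.comp_apply]
    rw [Q.form_trans i j hy hi hj v]
    simp only [map_add, ContinuousLinearMap.coe_snd']
    congr 1
    have := traceE_conj (Q.bundle.trans i j ((chartAt (Vec d) i).symm y))⁻¹
      (Q.form j (chartAt (Vec d) j ((chartAt (Vec d) i).symm y))
        (fderiv ℂ (fun z => chartAt (Vec d) j ((chartAt (Vec d) i).symm z)) y v)).2
    exact this

end BranchedAffineStructure

end LocalFrames

section Degeneracy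

open Filter Topology

variable {d : ℕ} {X : Type u} [TopologicalSpace X] [ChartedSpace (Vec d) X]

theorem surjective_of_detE_ne_zero {L : EndVec d} (h : detE L ≠ 0) : Function.Surjective L :=
  ((Module.End.isUnit_iff _).1 ((LinearMap.isUnit_iff_isUnit_det L.toLinearMap).2
    (isUnit_iff_ne_zero.2 h))).2

theorem detE_ne_zero_of_injective {L : EndVec d} (h : Function.Injective L) : detE L ≠ 0 := by
  intro h0
  have := LinearMap.bot_lt_ker_of_det_eq_zero h0
  have h1 : LinearMap.ker L.toLinearMap = ⊥ := LinearMap.ker_eq_bot.2 h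
  rw [h1] at this
  exact lt_irrefl _ this

namespace BranchedAffineStructure

variable (Q : BranchedAffineStructure.{u, v} d X)

theorem bijective_theta_iff (p : Q.bundle.Total) :
    Function.Bijective (Q.theta p) ↔ Function.Surjective (Q.theta p) := by
  refine ⟨fun h => h.2, fun h => ⟨?_, h⟩⟩
  exact (LinearMap.injective_iff_surjective_of_finrank_eq_finrank
    (f := (Q.theta p).toLinearMap) rfl).2 h

theorem surjective_theta_act {p : Q.bundle.Total} (hp : Function.Surjective (Q.theta p))
    (g : GLVec d) : Function.Surjective (Q.theta (Q.bundle.act p g)) := by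
  intro b
  obtain ⟨w, hw⟩ := hp (Ad g b)
  refine ⟨mfderiv (bundleModel d) (bundleModel d) (fun q => Q.bundle.act q g) p w, ?_⟩
  refine (Q.equivariant g p w).trans ?_
  have h1 : Q.θ p w = Ad g b := hw
  rw [h1]
  ext1
  · change ((g⁻¹ : GLVec d) : EndVec d) ((g : EndVec d) b.1) = b.1
    rw [← mul_apply_eq_comp, Units.inv_mul]; rfl
  · simp [Ad, mul_assoc]

theorem surjective_theta_of_proj_eq {p q : Q.bundle.Total} (h : Q.bundle.proj p = Q.bundle.proj q)
    (hp : Function.Surjective (Q.theta p)) : Function.Surjective (Q.theta q) := by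
  have hq := Q.bundle.act_frame (Q.bundle.proj q) (Q.bundle.mem_trivNhd (Q.bundle.proj q))
  have hp' := Q.bundle.act_frame (Q.bundle.proj q) (p := p) (by
    rw [h]; exact Q.bundle.mem_trivNhd (Q.bundle.proj q))
  rw [h] at hp'
  have h1 := Q.surjective_theta_act hp (Q.bundle.triv (Q.bundle.proj q) p).2⁻¹
  have h2 : ∀ (f : Q.bundle.Total) (k : GLVec d), Q.bundle.act f k = p →
      Q.bundle.act p k⁻¹ = f := by
    rintro f k rfl
    rw [← Q.bundle.act_mul, mul_inv_cancel, Q.bundle.act_one]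
  rw [h2 _ _ hp'] at h1
  rw [← hq]
  exact Q.surjective_theta_act h1 _

variable [IsManifold 𝓘(ℂ, Vec d) ω X]

/-- The form `θ` is an isomorphism exactly outside the zeros of `⋀^d φ`. -/
theorem surjective_theta_chartFrame (i : X) {z : Vec d} (hz : z ∈ (chartAt (Vec d) i).target)
    (hW : (chartAt (Vec d) i).symm z ∈ Q.bundle.dom i) :
    Function.Surjective (Q.theta (Q.bundle.chartFrame i z)) ↔ Q.frameData.f i z ≠ 0 := by
  set s := Q.bundle.chartFrame i with hs
  set p := s z with hp
  have hproj : ∀ y, (chartAt (Vec d) i).symm y ∈ Q.bundle.dom i →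
      Q.bundle.proj (s y) = (chartAt (Vec d) i).symm y := fun y hy => Q.bundle.proj_frame i hy.1
  constructor
  · intro hsurj
    have hinj := ((Q.bijective_theta_iff p).2 hsurj).1
    refine detE_ne_zero_of_injective ?_
    refine (injective_iff_map_eq_zero (Q.phi i z)).2 fun v hv => ?_
    set D : Vec d × EndVec d := mfderiv 𝓘(ℂ, Vec d) (bundleModel d) s z v with hD
    have h1 : Q.theta p D = (0, (Q.form i z v).2) := Prod.ext hv rfl
    have h2 : D = Q.fund p (Q.form i z v).2 := hinj (h1.trans (Q.theta_fund p _).symm)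
    have hprojd : MDifferentiable (bundleModel d) 𝓘(ℂ, Vec d) Q.bundle.proj :=
      Q.bundle.holomorphic_proj.mdifferentiable (by simp)
    have hps : Q.bundle.proj p ∈ (chartAt (Vec d) i).source := by
      rw [hp, hproj z hW]; exact hW.2
    have hed : MDifferentiableAt 𝓘(ℂ, Vec d) 𝓘(ℂ, Vec d) (chartAt (Vec d) i) (Q.bundle.proj p) :=
      (contMDiffOn_chart (n := ω).contMDiffAt ((chartAt (Vec d) i).open_source.mem_nhds
        hps)).mdifferentiableAt (by simp)
    set π : Q.bundle.Total → Vec d := fun q => chartAt (Vec d) i (Q.bundle.proj q) with hπ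
    have hπd : MDifferentiableAt (bundleModel d) 𝓘(ℂ, Vec d) π p :=
      MDifferentiableAt.comp (g := chartAt (Vec d) i) p hed (hprojd p)
    have hsd := (Q.bundle.contMDiffAt_chartFrame i hz hW).mdifferentiableAt (by simp)
    have h3 := mfderiv_comp_apply (I := 𝓘(ℂ, Vec d)) (I' := bundleModel d) (I'' := 𝓘(ℂ, Vec d)) z
      hπd hsd v
    have hid : π ∘ s =ᶠ[𝓝 z] id := by
      filter_upwards [eventually_transition hz (Q.bundle.isOpen_dom i) hW] with y hy
      rw [Function.comp_apply, hπ]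
      simp only
      rw [hproj y hy.2, (chartAt (Vec d) i).right_inv hy.1, id]
    rw [hid.mfderiv_eq, mfderiv_id] at h3
    set dπ : (Vec d × EndVec d) →L[ℂ] Vec d := mfderiv (bundleModel d) 𝓘(ℂ, Vec d) π p with hdπ
    have h4 : v = dπ D := h3
    have hactd : MDifferentiableAt 𝓘(ℂ, EndVec d) (bundleModel d)
        (fun g : GLVec d => Q.bundle.act p g) 1 :=
      ((Q.bundle.holomorphic_act.mdifferentiable (by simp)) (p, (1 : GLVec d))).comp
        (I' := (bundleModel d).prod 𝓘(ℂ, EndVec d)) (1 : GLVec d)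
        (mdifferentiableAt_const.prodMk mdifferentiableAt_id)
    have h5 := mfderiv_comp_apply_of_eq (I := 𝓘(ℂ, EndVec d)) (I' := bundleModel d)
      (I'' := 𝓘(ℂ, Vec d)) (1 : GLVec d) hπd hactd (Q.bundle.act_one p) (Q.form i z v).2
    have h6 : π ∘ (fun g : GLVec d => Q.bundle.act p g) = fun _ => π p := by
      funext g
      rw [Function.comp_apply, hπ]
      simp only
      rw [Q.bundle.proj_act]
    rw [h6, mfderiv_const] at h5
    have h7 : (0 : Vec d) = dπ (Q.fund p (Q.form i z v).2) := h5
    rw [h4, h2, ← h7]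
  · intro hne b
    obtain ⟨v, hv⟩ := surjective_of_detE_ne_zero hne b.1
    set D : Vec d × EndVec d := mfderiv 𝓘(ℂ, Vec d) (bundleModel d) s z v with hD
    refine ⟨D + Q.fund p (b.2 - (Q.form i z v).2), ?_⟩
    rw [map_add, Q.theta_fund]
    have h1 : Q.theta p D = (b.1, (Q.form i z v).2) := Prod.ext hv rfl
    rw [h1]
    ext1 <;> simp

/-- The set of points over which `θ` is not an isomorphism. -/
def degenerate : Set X := {x | ∀ p, Q.bundle.proj p = x → ¬ Function.Surjective (Q.theta p)}

theorem mem_degenerate_iff (i : X) {z : Vec d} (hz : z ∈ (chartAt (Vec d) i).target)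
    (hW : (chartAt (Vec d) i).symm z ∈ Q.bundle.dom i) :
    (chartAt (Vec d) i).symm z ∈ Q.degenerate ↔ Q.frameData.f i z = 0 := by
  have hp : Q.bundle.proj (Q.bundle.chartFrame i z) = (chartAt (Vec d) i).symm z :=
    Q.bundle.proj_frame i hW.1
  rw [← not_iff_not, ← ne_eq (Q.frameData.f i z), ← Q.surjective_theta_chartFrame i hz hW]
  constructor
  · intro h
    simp only [degenerate, Set.mem_ofPred_eq, not_forall, not_not] at h
    obtain ⟨p, h1, h2⟩ := h
    exact Q.surjective_theta_of_proj_eq (h1.trans hp.symm) h2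
  · intro h hcon
    exact hcon _ hp h

theorem interior_degenerate [ConnectedSpace X] : interior Q.degenerate = ∅ := by
  have hclosed : IsClosed (interior Q.degenerate) := by
    rw [← closure_subset_iff_isClosed]
    intro x hx
    have hxt := mem_chart_target (Vec d) x
    have hxs : (chartAt (Vec d) x).symm (chartAt (Vec d) x x) = x :=
      (chartAt (Vec d) x).left_inv (mem_chart_source (Vec d) x)
    have hxW : (chartAt (Vec d) x).symm (chartAt (Vec d) x x) ∈ Q.bundle.dom x := by
      rw [hxs]; exact Q.frameData.mem_W x
    have hV := (chartAt (Vec d) x).isOpen_inter_preimage_symm (Q.bundle.isOpen_dom x)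
    obtain ⟨r, hr, hball⟩ := Metric.isOpen_iff.1 hV _ ⟨hxt, hxW⟩
    set O : Set X := (chartAt (Vec d) x).source ∩
      (chartAt (Vec d) x) ⁻¹' Metric.ball (chartAt (Vec d) x x) r
    have hO : IsOpen O := (chartAt (Vec d) x).isOpen_inter_preimage Metric.isOpen_ball
    have hxO : x ∈ O := ⟨mem_chart_source (Vec d) x, Metric.mem_ball_self hr⟩
    obtain ⟨q, hqO, hq⟩ := mem_closure_iff.1 hx O hO hxO
    have hqt := (chartAt (Vec d) x).map_source hqO.1
    have han : AnalyticOnNhd ℂ (Q.frameData.f x) (Metric.ball (chartAt (Vec d) x x) r) :=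
      fun y hy => (Q.frameData.f_an x y (hball hy).1 (hball hy).2).analyticAt
    have hzero : Q.frameData.f x =ᶠ[𝓝 (chartAt (Vec d) x q)] 0 := by
      have h1 : ∀ᶠ y in 𝓝 (chartAt (Vec d) x q),
          (chartAt (Vec d) x).symm y ∈ interior Q.degenerate :=
        ((chartAt (Vec d) x).continuousAt_symm hqt).eventually (isOpen_interior.mem_nhds (by
          rw [(chartAt (Vec d) x).left_inv hqO.1]; exact hq))
      filter_upwards [h1, Metric.isOpen_ball.mem_nhds hqO.2] with y hy hyb
      exact (Q.mem_degenerate_iff x (hball hyb).1 (hball hyb).2).1 (interior_subset hy)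
    have hall := han.eqOn_zero_of_preconnected_of_eventuallyEq_zero
      (convex_ball (chartAt (Vec d) x x) r).isPreconnected hqO.2 hzero
    refine mem_interior.2 ⟨O, fun y hy => ?_, hO, hxO⟩
    have := (Q.mem_degenerate_iff x (hball hy.2).1 (hball hy.2).2).2 (hall hy.2)
    rwa [(chartAt (Vec d) x).left_inv hy.1] at this
  rcases isClopen_iff.1 ⟨hclosed, isOpen_interior⟩ with h | h
  · exact h
  · exfalso
    obtain ⟨U, hU, ⟨x, hx⟩, hb⟩ := Q.generically_iso
    have h1 : x ∈ Q.degenerate := interior_subset (h ▸ Set.mem_univ x)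
    have hp := Q.bundle.proj_frame x (Q.bundle.mem_trivNhd x)
    exact h1 _ hp (hb _ (hp.symm ▸ hx)).2

theorem frameData_not_locally_zero [ConnectedSpace X] (i : X) {y : Vec d}
    (hy : y ∈ (chartAt (Vec d) i).target) (hW : (chartAt (Vec d) i).symm y ∈ Q.bundle.dom i) :
    ¬ ∀ᶠ z in 𝓝 y, Q.frameData.f i z = 0 := by
  intro h
  have h1 : (chartAt (Vec d) i).symm y ∈ interior Q.degenerate := by
    rw [mem_interior_iff_mem_nhds]
    have hs := (chartAt (Vec d) i).map_target hy
    have hc := (chartAt (Vec d) i).continuousAt hs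
    rw [ContinuousAt, (chartAt (Vec d) i).right_inv hy] at hc
    filter_upwards [hc.eventually h, (Q.bundle.isOpen_dom i).mem_nhds hW] with q hq hqW
    have h2 := (Q.mem_degenerate_iff i ((chartAt (Vec d) i).map_source hqW.2)
      (by rwa [(chartAt (Vec d) i).left_inv hqW.2])).2 hq
    rwa [(chartAt (Vec d) i).left_inv hqW.2] at h2
  rw [Q.interior_degenerate] at h1
  exact h1

theorem isHolomorphicAffine_of_ne_zero
    (h : ∀ x, Q.frameData.f x (chartAt (Vec d) x x) ≠ 0) : Q.IsHolomorphicAffine := by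
  intro p
  set x := Q.bundle.proj p with hx
  have hxs : (chartAt (Vec d) x).symm (chartAt (Vec d) x x) = x :=
    (chartAt (Vec d) x).left_inv (mem_chart_source (Vec d) x)
  have hxW : (chartAt (Vec d) x).symm (chartAt (Vec d) x x) ∈ Q.bundle.dom x := by
    rw [hxs]; exact Q.frameData.mem_W x
  have h1 := (Q.surjective_theta_chartFrame x (mem_chart_target (Vec d) x) hxW).2 (h x)
  exact (Q.bijective_theta_iff p).2 (Q.surjective_theta_of_proj_eq
    ((Q.bundle.proj_frame x hxW.1).trans hxs) h1)

omit [IsManifold 𝓘(ℂ, Vec d) ω X] in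
theorem branchingSupport_eq_empty (h : Q.IsHolomorphicAffine) : Q.branchingSupport = ∅ := by
  refine Set.eq_empty_iff_forall_notMem.2 fun x hx => ?_
  have hp := Q.bundle.proj_frame x (Q.bundle.mem_trivNhd x)
  choose w hw using fun j : Fin d => (h (Q.bundle.frame x x)).2 (Pi.single j 1, 0)
  have h1 := hx _ hp w
  have h2 : (Matrix.of fun i j => (Q.θ (Q.bundle.frame x x) (w j)).1 i) = 1 := by
    ext i j
    rw [Matrix.of_apply, hw j, Matrix.one_apply]
    exact Pi.single_apply _ _ _
  rw [detPhi, h2, Matrix.det_one] at h1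
  exact one_ne_zero h1

end BranchedAffineStructure

end Degeneracy
end BranchedAffine
end

theorem corollary4p2 {d : ℕ} (hd : 0 < d) {X : Type u} [TopologicalSpace X] [T2Space X]
    [CompactSpace X] [ConnectedSpace X] [ChartedSpace (Vec d) X] [IsManifold 𝓘(ℂ, Vec d) ω X]
    (κ : KahlerForm d X) (h : CotangentHermitianMetric d X) :
    (cotangentDegree κ h < 0 → IsEmpty (BranchedAffineStructure.{u, v} d X)) ∧
    (cotangentDegree κ h = 0 → ∀ Q : BranchedAffineStructure.{u, v} d X,
      Q.IsHolomorphicAffine ∧ Q.branchingSupport = ∅) := by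
  have key := fun Q : BranchedAffineStructure.{u, v} d X =>
    Q.frameData.degree_nonneg h hd κ fun i y hy hW => Q.frameData_not_locally_zero i hy hW
  refine ⟨fun hneg => ⟨fun Q => absurd (key Q).1 (not_le.2 hneg)⟩, fun h0 Q => ?_⟩
  have haff : Q.IsHolomorphicAffine := by
    refine Q.isHolomorphicAffine_of_ne_zero fun x hx => ?_
    have hW : (chartAt (Vec d) x).symm (chartAt (Vec d) x x) ∈ Q.frameData.W x := by
      rw [(chartAt (Vec d) x).left_inv (mem_chart_source (Vec d) x)]
      exact Q.frameData.mem_W x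
    exact ((key Q).2 x _ (mem_chart_target (Vec d) x) hW hx).ne' h0
  exact ⟨haff, Q.branchingSupport_eq_empty haff⟩
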